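/- **Setting.** Let $n\ge 1$ and $L\ge 0$, and write points of $\mathbb R^{n+1}$ as $X=(x,y)\in\mathbb R^n\times\mathbb R$. For $\varphi:\mathbb R^n\to\mathbb R$ Lipschitz with constant $L$, put $\Omega=\{(x,y): y>\varphi(x)\}$, and let $d\sigma$ be surface measure on $\partial\Omega$, i.e. the image of $\sqrt{1+|\nabla\varphi(x)|^2}\,dx$ under $x\mapsto(x,\varphi(x))$. For an open set $U$ let $\delta_U(X)=\operatorname{dist}(X,\partial U)$. An *adapted distance function on $\Omega$ with constant $M>0$* is a Lipschitz continuous function $\rho$ on $\overline\Omega$ with $\rho\in C^2(\Omega)$ such that (a) $\rho(x,\varphi(x))=0$ for all $x$, and $1/M\le\partial_y\rho\le M$ in $\Omega$; (b) $|\nabla\rho|\le M$ in $\Omega$; (c) $\rho|\nabla^2\rho|^2\,dX$ is a Carleson measure on $\Omega$ of norm at most $M$: for every cube $Q\subset\mathbb R^n$ of side length $r>0$, $$\int_{\{(x,\,y+\varphi(x))\,:\,x\in Q,\ 0<y\le r\}}\rho\,|\nabla^2\rho|^2\,dX\le M r^n .$$ Given such $\rho$, let $$\Omega_t=\{X=(x,y)\in\Omega:|x|<t,\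 0<\rho(X)<t\},\qquad \mathcal B_t=\{(x,\varphi(x)):|x|\le t\},$$ $$K=\{X=(x,y)\in\Omega:|x|\le 3,\ 1\le\rho(X)\le 3\}.$$ For $\kappa>\sqrt{1+L^2}$ and a function $f$ on $\Omega$ let $$N(f)(Q)=\sup\{|f(X)|: X\in\Omega,\ |X-Q|\le\kappa\,\delta_\Omega(X)\},\qquad Q\in\partial\Omega,$$ and let $A_{\Omega_3}(u)=\int_{\Omega_3}\delta_{\Omega_3}(X)\,|\nabla u(X)|^2\,dX$. **Lemma 4.4 (Main Lemma).** There is a constant $M=M(n,L)$ such that for every $\varphi$ as above there is an adapted distance function on $\Omega$ with constant $M$. Moreover, for every $M$ and every $\kappa>\sqrt{1+L^2}$ there is a constant $C$ depending only on $n$, $L$, $M$ and $\kappa$ (hence only on $n$ and $L$, once $M$ and $\kappa$ are chosen as functions of $n$ and $L$) such that, for every $\varphi$ as above, every adapted distance function $\rho$ on $\Omega$ with constant $M$, and every real-valued function $u$ that is harmonic in $\Omega_3$ and for which $u$, $\nabla u$ and $\nabla^2u$ belong to $C^\gamma(\overline{\Omega_3})$ for some $\gamma>0$, $$\int_{\mathcal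 B_1}u^2\,d\sigma\le C\left[A_{\Omega_3}(u)+A_{\Omega_3}(u)^{1/2}\left(\int_{\mathcal B_2}N(u1_{\Omega_2})^2\,d\sigma\right)^{1/2}+\int_K u^2\,dX\right].$$ -/

import Mathlib

open MeasureTheory Set
open scoped NNReal ENNReal

noncomputable section

namespace AdaptedDistance

/-- `ℝⁿ × ℝ`, written as `ℝⁿ⁺¹` with its Euclidean structure; a point is `X = (x, y)`, where
`x = horiz X` collects the first `n` coordinates and `y = height X` is the last one. -/
abbrev Space (n : ℕ) : Type := EuclideanSpace ℝ (Fin (n + 1))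

/-- The component `x ∈ ℝⁿ` of `X = (x, y)`. -/
def horiz {n : ℕ} (X : Space n) : EuclideanSpace ℝ (Fin n) := WithLp.toLp 2 fun i => X i.castSucc

/-- The component `y ∈ ℝ` of `X = (x, y)`. -/
def height {n : ℕ} (X : Space n) : ℝ := X (Fin.last n)

/-- The point `(x, y)`. -/
def pt {n : ℕ} (x : EuclideanSpace ℝ (Fin n)) (y : ℝ) : Space n :=
  WithLp.toLp 2 (Fin.snoc (α := fun _ => ℝ) (fun i => x i) y)

/-- The unit vector in the vertical direction. -/
def vert (n : ℕ) : Space n := pt 0 1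

/-- The open region above the graph of `φ`. -/
def domain {n : ℕ} (φ : EuclideanSpace ℝ (Fin n) → ℝ) : Set (Space n) :=
  {X | φ (horiz X) < height X}

/-- The distance from `X` to the boundary of `U`. -/
def delta {n : ℕ} (U : Set (Space n)) (X : Space n) : ℝ := Metric.infDist X (frontier U)

/-- Surface measure `dσ` on the graph of the Lipschitz function `φ`: the image of
`√(1 + |∇φ(x)|²) dx` under `x ↦ (x, φ x)` (`φ` is differentiable almost everywhere). -/
def surfaceMeasure {n : ℕ} (φ : EuclideanSpace ℝ (Fin n) → ℝ) : Measure (Space n) :=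
  Measure.map (fun x => pt x (φ x))
    (volume.withDensity fun x => ENNReal.ofReal (Real.sqrt (1 + ‖fderiv ℝ φ x‖ ^ 2)))

/-- The axis-parallel cube in `ℝⁿ` with lower corner `a` and side length `r`. -/
def cube {n : ℕ} (a : EuclideanSpace ℝ (Fin n)) (r : ℝ) : Set (EuclideanSpace ℝ (Fin n)) :=
  {x | ∀ i, x i ∈ Icc (a i) (a i + r)}

/-- The Carleson box `T(Q) = Q × (0, r]` over the cube `Q` of side length `r`. -/
def carlesonBox {n : ℕ} (a : EuclideanSpace ℝ (Fin n)) (r : ℝ) : Set (Space n) :=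
  {X | horiz X ∈ cube a r ∧ height X ∈ Ioc 0 r}

/-- The bi-Lipschitz map `(x, y) ↦ (x, y + φ x)` of the upper half space onto `domain φ`. -/
def shift {n : ℕ} (φ : EuclideanSpace ℝ (Fin n) → ℝ) (X : Space n) : Space n :=
  pt (horiz X) (height X + φ (horiz X))

/-- The measure `μ` on `domain φ`, pulled back to the upper half space by `shift φ`, is a Carleson
measure of norm at most `M`: `μ (shift φ (T(Q))) ≤ M |Q|` for every cube `Q`. -/
def IsCarlesonWith {n : ℕ} (φ : EuclideanSpace ℝ (Fin n) → ℝ) (M : ℝ)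
    (μ : Measure (Space n)) : Prop :=
  ∀ (a : EuclideanSpace ℝ (Fin n)) (r : ℝ), 0 < r →
    μ (shift φ '' carlesonBox a r) ≤ ENNReal.ofReal (M * r ^ n)

/-- The measure `ρ |∇²ρ|² dX` on `domain φ`. -/
def hessianMeasure {n : ℕ} (φ : EuclideanSpace ℝ (Fin n) → ℝ) (ρ : Space n → ℝ) :
    Measure (Space n) :=
  (volume.restrict (domain φ)).withDensity fun X =>
    ENNReal.ofReal (ρ X * ‖iteratedFDeriv ℝ 2 ρ X‖ ^ 2)

/-- `ρ` is an adapted distance function, with constant `M`, on the region above the graph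
of `φ`. (Only the values of `ρ` on the closure of `domain φ` matter.) -/
structure IsAdaptedDistance {n : ℕ} (φ : EuclideanSpace ℝ (Fin n) → ℝ) (M : ℝ)
    (ρ : Space n → ℝ) : Prop where
  pos : 0 < M
  lipschitz : ∃ K : ℝ≥0, LipschitzOnWith K ρ (closure (domain φ))
  contDiffOn : ContDiffOn ℝ 2 ρ (domain φ)
  eq_zero : ∀ x, ρ (pt x (φ x)) = 0
  le_vert : ∀ X ∈ domain φ, 1 / M ≤ fderiv ℝ ρ X (vert n)
  vert_le : ∀ X ∈ domain φ, fderiv ℝ ρ X (vert n) ≤ M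
  grad_le : ∀ X ∈ domain φ, ‖fderiv ℝ ρ X‖ ≤ M
  carleson : IsCarlesonWith φ M (hessianMeasure φ ρ)

/-- The cylindrical section `Ω_t = {|x| < t, 0 < ρ(X) < t}` of `Ω = domain φ`. -/
def cylSection {n : ℕ} (φ : EuclideanSpace ℝ (Fin n) → ℝ) (ρ : Space n → ℝ) (t : ℝ) :
    Set (Space n) :=
  {X | X ∈ domain φ ∧ ‖horiz X‖ < t ∧ 0 < ρ X ∧ ρ X < t}

/-- The bottom boundary `B_t = {(x, φ x) : |x| ≤ t}`. -/
def bottom {n : ℕ} (φ : EuclideanSpace ℝ (Fin n) → ℝ) (t : ℝ) : Set (Space n) :=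
  {X | ‖horiz X‖ ≤ t ∧ height X = φ (horiz X)}

/-- The set `K = {|x| ≤ 3, 1 ≤ ρ(X) ≤ 3}`. -/
def slab {n : ℕ} (φ : EuclideanSpace ℝ (Fin n) → ℝ) (ρ : Space n → ℝ) : Set (Space n) :=
  {X | X ∈ domain φ ∧ ‖horiz X‖ ≤ 3 ∧ 1 ≤ ρ X ∧ ρ X ≤ 3}

/-- The non-tangential approach region `Γ(Q) = {X ∈ U : |X - Q| ≤ κ δ_U(X)}`. -/
def approach {n : ℕ} (U : Set (Space n)) (κ : ℝ) (Q : Space n) : Set (Space n) :=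
  {X | X ∈ U ∧ dist X Q ≤ κ * delta U X}

/-- The non-tangential maximal function of `f` on `U`, with aperture `κ`. -/
def maximal {n : ℕ} (U : Set (Space n)) (κ : ℝ) (f : Space n → ℝ) (Q : Space n) : ℝ≥0∞ :=
  ⨆ X ∈ approach U κ Q, ‖f X‖ₑ

/-- The area integral `A_U(u) = ∫_U δ_U(X) |∇u(X)|² dX`. -/
def areaIntegral {n : ℕ} (U : Set (Space n)) (u : Space n → ℝ) : ℝ≥0∞ :=
  ∫⁻ X in U, ENNReal.ofReal (delta U X) * ‖fderiv ℝ u X‖ₑ ^ 2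

/-- `u`, `∇u` and `∇²u` belong to `C^γ` of the closure of `U` for some `γ > 0`. (A function that is
Hölder continuous on `U` is one that extends to a Hölder continuous function on the closure; the
boundary values of `u` itself are those of this extension.) -/
def HolderUpToBoundary {n : ℕ} (U : Set (Space n)) (u : Space n → ℝ) : Prop :=
  ∃ γ : ℝ≥0, 0 < γ ∧ ∃ H : ℝ≥0, HolderOnWith H γ u (closure U) ∧
    HolderOnWith H γ (fderiv ℝ u) U ∧ HolderOnWith H γ (iteratedFDeriv ℝ 2 u) U

end AdaptedDistance

end

open AdaptedDistance

/-! ### Coordinates on ℝⁿ⁺¹ and the region above a Lipschitz graph. -/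

noncomputable section

open MeasureTheory Set
open scoped NNReal ENNReal

namespace AdaptedDistance

variable {n : ℕ}

/-! The inequality comes from integrating the divergence of a single vector field. Let e be the
vertical unit vector, ζ a cutoff, G = ζ ∇ρ / |∇ρ|², and consider ζ u² e + ρ ((G · ∇u²) e - (G · e)
∇u² - (e · ∇u²) G). Because G is parallel to ∇ρ and G · ∇ρ = ζ, differentiating the factor ρ
produces -ζ ∂_y u², which cancels the term ζ ∂_y u² coming from ζ u² e. The second derivatives of u²
cancel by symmetry of the Hessian, except for -(G · e) Δu², which equals -2 (G · e) |∇u|² since u is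
harmonic. The divergence is therefore u² ∂_y ζ - 2 ρ (G · e) |∇u|² plus ρ times products of ∇G with
u ∇u (`sum_pd_rellich`), and its integral is zero (`integral_rellich_eq_zero`).

The cutoff is a product of a bump in x, a lower cutoff rising from 0 to 1 on ε ≤ ρ ≤ 2ε, and an
upper cutoff falling on 1 ≤ ρ ≤ 3/2. The lower transition turns u² ∂_y ζ into an approximation of
the boundary integral (`lintegral_bottom_le`); the upper one gives the integral over K. The term
with |∇u|² is controlled by the area integral, since ρ is at most a multiple of the distance to ∂Ω₃
on Ω₂ (`le_delta_cylSection`). In the remaining terms |∇G| is at most a constant times |∇²ρ| + |∇ζ|.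
The contributions of |∇²ρ| and of the bounded part of ∇ζ are split by Cauchy–Schwarz
(`lintegral_cross_le`) into the area integral and ∫ ρ (1 + |∇²ρ|²) u²; the latter is an integral
against a Carleson measure, and `carleson_embedding` bounds it by the maximal function. The part of
∇ζ of size 1/ε lives where ρ ≤ 2ε, so after multiplication by ρ it is bounded on a layer of
thickness O(ε). Since u and ∇u are bounded, it disappears as ε → 0 (`lintegral_bottom_le_section`).

For the existence of ρ, mollify φ at scale t to φ_t. The function (L + 1) t + φ_t(x) has
t-derivative between 1 and 2L + 1, so y = (L + 1) t + φ_t(x) can be solved for t = ρ(x, y).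
Everything but the Carleson condition follows from the inverse function theorem and Lipschitz
bounds. For the Carleson condition, |∇²ρ| is at most a multiple of |∇²φ_t|
(`norm_hessian_regDist_le`), and each second derivative of φ_t is t⁻¹ times an average of ∇φ against
a kernel of mean zero (`pd_pd_smoothing`). As ∇φ is bounded, a local square function estimate
(`lintegral_square_le`) applies; it is obtained from Schur's test for T Tᵀ
(`integral_sq_le_of_schur`) and the almost orthogonality of dilations of mean-zero kernels
(`abs_integral_dilate_mul_le`). -/

@[simp] lemma horiz_pt (x : EuclideanSpace ℝ (Fin n)) (y : ℝ) : horiz (pt x y) = x := by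
  ext i; simp [horiz, pt]

@[simp] lemma height_pt (x : EuclideanSpace ℝ (Fin n)) (y : ℝ) : height (pt x y) = y := by
  simp [height, pt]

@[simp] lemma pt_horiz_height (X : Space n) : pt (horiz X) (height X) = X := by
  ext i
  refine Fin.lastCases ?_ (fun i => ?_) i <;> simp [horiz, height, pt]

/-- The projection `X ↦ x` as a continuous linear map. -/
def horizL (n : ℕ) : Space n →L[ℝ] EuclideanSpace ℝ (Fin n) :=
  LinearMap.toContinuousLinearMap
    { toFun := horiz
      map_add' := fun X Y => by ext i; simp [horiz]
      map_smul' := fun c X => by ext i; simp [horiz] }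

/-- The last coordinate as a continuous linear map. -/
def heightL (n : ℕ) : Space n →L[ℝ] ℝ :=
  LinearMap.toContinuousLinearMap
    { toFun := height
      map_add' := fun X Y => by simp [height]
      map_smul' := fun c X => by simp [height] }

@[simp] lemma horizL_apply (X : Space n) : horizL n X = horiz X := rfl
@[simp] lemma heightL_apply (X : Space n) : heightL n X = height X := rfl

lemma horiz_add (X Y : Space n) : horiz (X + Y) = horiz X + horiz Y := (horizL n).map_add X Y
lemma horiz_sub (X Y : Space n) : horiz (X - Y) = horiz X - horiz Y := (horizL n).map_sub X Y
lemma horiz_smul (c : ℝ) (X : Space n) : horiz (c • X) = c • horiz X := (horizL n).map_smul c X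
lemma height_add (X Y : Space n) : height (X + Y) = height X + height Y := (heightL n).map_add X Y
lemma height_sub (X Y : Space n) : height (X - Y) = height X - height Y := (heightL n).map_sub X Y
lemma height_smul (c : ℝ) (X : Space n) : height (c • X) = c * height X := (heightL n).map_smul c X

lemma continuous_horiz : Continuous (horiz : Space n → _) := (horizL n).continuous
lemma continuous_height : Continuous (height : Space n → ℝ) := (heightL n).continuous

lemma ext_horiz_height {X Y : Space n} (h : horiz X = horiz Y) (h' : height X = height Y) :
    X = Y := by rw [← pt_horiz_height X, h, h', pt_horiz_height]

/-- `(x, y) ↦ pt x y` as a continuous linear equivalence. -/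
def ptL (n : ℕ) : (EuclideanSpace ℝ (Fin n) × ℝ) ≃L[ℝ] Space n :=
  LinearEquiv.toContinuousLinearEquiv
    { toFun := fun p => pt p.1 p.2
      invFun := fun X => (horiz X, height X)
      map_add' := fun p q => ext_horiz_height (by simp [horiz_add]) (by simp [height_add])
      map_smul' := fun c p => ext_horiz_height (by simp [horiz_smul]) (by simp [height_smul])
      left_inv := fun p => by simp
      right_inv := fun X => by simp }

@[simp] lemma ptL_apply (p : EuclideanSpace ℝ (Fin n) × ℝ) : ptL n p = pt p.1 p.2 := rfl

lemma continuous_pt : Continuous fun p : EuclideanSpace ℝ (Fin n) × ℝ => pt p.1 p.2 :=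
  (ptL n).continuous

lemma pt_sub (x x' : EuclideanSpace ℝ (Fin n)) (y y' : ℝ) :
    pt (x - x') (y - y') = pt x y - pt x' y' := (ptL n).map_sub (x, y) (x', y')
lemma pt_smul (c : ℝ) (x : EuclideanSpace ℝ (Fin n)) (y : ℝ) :
    pt (c • x) (c * y) = c • pt x y := (ptL n).map_smul c (x, y)

@[simp] lemma horiz_vert : horiz (vert n) = 0 := horiz_pt _ _
@[simp] lemma height_vert : height (vert n) = 1 := height_pt _ _

lemma pt_eq_add_smul_vert (x : EuclideanSpace ℝ (Fin n)) (y y' : ℝ) :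
    pt x y' = pt x y + (y' - y) • vert n :=
  ext_horiz_height (by simp [horiz_add, horiz_smul]) (by simp [height_add, height_smul])

lemma norm_sq_eq (X : Space n) : ‖X‖ ^ 2 = ‖horiz X‖ ^ 2 + height X ^ 2 := by
  simp [EuclideanSpace.norm_sq_eq, Fin.sum_univ_castSucc, horiz, height]

lemma norm_horiz_le (X : Space n) : ‖horiz X‖ ≤ ‖X‖ := by
  have := norm_sq_eq X
  exact le_of_sq_le_sq (by nlinarith [sq_nonneg (height X)]) (norm_nonneg _)

lemma abs_height_le (X : Space n) : |height X| ≤ ‖X‖ := by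
  have := norm_sq_eq X
  exact abs_le_of_sq_le_sq (by nlinarith [sq_nonneg ‖horiz X‖]) (norm_nonneg _)

lemma norm_le_add (X : Space n) : ‖X‖ ≤ ‖horiz X‖ + |height X| := by
  have := norm_sq_eq X
  refine le_of_sq_le_sq ?_ (by positivity)
  nlinarith [mul_nonneg (norm_nonneg (horiz X)) (abs_nonneg (height X)), sq_abs (height X)]

@[simp] lemma norm_vert : ‖vert n‖ = 1 := by
  have := norm_sq_eq (vert n)
  simp only [horiz_vert, norm_zero, height_vert] at this
  nlinarith [norm_nonneg (vert n)]

/-- The coordinate directions of `Space n`. -/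
def dir (i : Fin (n + 1)) : Space n := EuclideanSpace.single i 1

lemma vert_eq_dir : vert n = dir (Fin.last n) := by
  ext i
  refine Fin.lastCases ?_ (fun i => ?_) i <;> simp [vert, dir, pt]

@[simp] lemma norm_dir (i : Fin (n + 1)) : ‖(dir i : Space n)‖ = 1 := by simp [dir]

lemma measurePreserving_pt :
    MeasurePreserving (fun p : EuclideanSpace ℝ (Fin n) × ℝ => pt p.1 p.2)
      (volume.prod volume) volume := by
  have h1 := (PiLp.volume_preserving_toLp (Fin (n + 1)))
  have h2 := (volume_preserving_piFinSuccAbove (fun _ : Fin (n + 1) => ℝ) (Fin.last n)).symm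
  have h3 : MeasurePreserving (fun p : EuclideanSpace ℝ (Fin n) × ℝ =>
      ((p.2, WithLp.ofLp p.1) : ℝ × (Fin n → ℝ))) (volume.prod volume) (volume.prod volume) := by
    have a : MeasurePreserving (fun p : EuclideanSpace ℝ (Fin n) × ℝ =>
      ((WithLp.ofLp p.1, p.2) : (Fin n → ℝ) × ℝ)) (volume.prod volume) (volume.prod volume) :=
      (PiLp.volume_preserving_ofLp (Fin n)).prod (MeasurePreserving.id volume)
    exact (Measure.measurePreserving_swap).comp a
  have := (h1.comp h2).comp h3
  have h : (fun p : EuclideanSpace ℝ (Fin n) × ℝ => pt p.1 p.2) =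
    ((WithLp.toLp 2 ∘ (MeasurableEquiv.piFinSuccAbove (fun _ => ℝ) (Fin.last n)).symm) ∘
      fun p => (p.2, WithLp.ofLp p.1)) := by
   funext p
   ext i
   refine Fin.lastCases ?_ (fun i => ?_) i <;>
     simp [pt, MeasurableEquiv.piFinSuccAbove]
  rw [h]
  exact this

lemma measurableEmbedding_pt :
    MeasurableEmbedding (fun p : EuclideanSpace ℝ (Fin n) × ℝ => pt p.1 p.2) :=
  (ptL n).toHomeomorph.measurableEmbedding

lemma lintegral_space {f : Space n → ℝ≥0∞} (hf : Measurable f) :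
    ∫⁻ X, f X = ∫⁻ x, ∫⁻ y, f (pt x y) := by
  rw [← measurePreserving_pt.lintegral_comp_emb measurableEmbedding_pt, lintegral_prod]
  exact (hf.comp continuous_pt.measurable).aemeasurable

/-! ### The region above a Lipschitz graph -/

variable {φ : EuclideanSpace ℝ (Fin n) → ℝ} {L : ℝ≥0}

lemma mem_domain {X : Space n} : X ∈ domain φ ↔ φ (horiz X) < height X := Iff.rfl

lemma isOpen_domain (hφ : Continuous φ) : IsOpen (domain φ) :=
  isOpen_lt (hφ.comp continuous_horiz) continuous_height

lemma closure_domain (hφ : Continuous φ) :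
    closure (domain φ) = {X | φ (horiz X) ≤ height X} := by
  refine Subset.antisymm ?_ fun X hX => ?_
  · exact closure_minimal (fun X hX => le_of_lt (mem_domain.1 hX))
      (isClosed_le (hφ.comp continuous_horiz) continuous_height)
  · have : Filter.Tendsto (fun t : ℝ => X + t • vert n) (nhdsWithin 0 (Ioi 0)) (nhds X) := by
      have : Continuous (fun t : ℝ => X + t • vert n) := by fun_prop
      have := this.tendsto 0
      simp only [zero_smul, add_zero] at this
      exact this.mono_left nhdsWithin_le_nhds
    refine mem_closure_of_tendsto this ?_
    filter_upwards [self_mem_nhdsWithin] with t ht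
    have ht : 0 < t := ht
    have hX : φ (horiz X) ≤ height X := hX
    simp only [mem_domain, horiz_add, horiz_smul, horiz_vert, smul_zero, add_zero, height_add,
      height_smul, height_vert, mul_one]
    linarith

lemma frontier_domain (hφ : Continuous φ) :
    frontier (domain φ) = {X | φ (horiz X) = height X} := by
  rw [frontier, closure_domain hφ, (isOpen_domain hφ).interior_eq]
  ext X
  simp only [mem_sdiff, mem_ofPred_eq, mem_domain, not_lt]
  exact ⟨fun h => le_antisymm h.1 h.2, fun h => ⟨h.le, h.ge⟩⟩

/-- The change is at most |Δy| + L |Δx|, and Cauchy–Schwarz in the plane of (|Δx|, |Δy|) gives the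
factor √(1 + L²). This exact factor matters, because the aperture κ is only assumed to exceed it. -/
lemma abs_height_sub_le (hφ : LipschitzWith L φ) (X Z : Space n) :
    |(height Z - φ (horiz Z)) - (height X - φ (horiz X))| ≤ √(1 + (L : ℝ) ^ 2) * dist X Z := by
  have h1 := hφ.dist_le_mul (horiz X) (horiz Z)
  rw [dist_eq_norm, dist_eq_norm, ← horiz_sub] at h1
  have h2 := norm_sq_eq (X - Z)
  rw [dist_eq_norm]
  set a := ‖horiz (X - Z)‖
  set N := ‖X - Z‖
  have h3 : |(height Z - φ (horiz Z)) - (height X - φ (horiz X))| ≤ |height (X - Z)| + L * a := by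
    rw [height_sub]
    calc _ = |(φ (horiz X) - φ (horiz Z)) - (height X - height Z)| := by congr 1; ring
      _ ≤ _ := (abs_sub _ _).trans (by rw [add_comm]; gcongr; simpa using h1)
  refine h3.trans ?_
  have hs := Real.sq_sqrt (show 0 ≤ 1 + (L : ℝ) ^ 2 by positivity)
  refine le_of_sq_le_sq ?_ (by positivity)
  rw [mul_pow, hs, h2]
  nlinarith [sq_nonneg (a - L * |height (X - Z)|), sq_abs (height (X - Z))]

lemma le_delta_domain (hφ : LipschitzWith L φ) (X : Space n) :
    (height X - φ (horiz X)) ≤ √(1 + (L : ℝ) ^ 2) * delta (domain φ) X := by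
  have hs : 0 < √(1 + (L : ℝ) ^ 2) := by positivity
  rw [← div_le_iff₀' hs, delta, Metric.infDist_eq_iInf]
  have hne : (frontier (domain φ)).Nonempty :=
    ⟨pt 0 (φ 0), by rw [frontier_domain hφ.continuous]; simp⟩
  have := hne.to_subtype
  refine le_ciInf fun Z => ?_
  rw [div_le_iff₀' hs]
  have hZ : φ (horiz Z.1) = height Z.1 := by
    exact (frontier_domain hφ.continuous).subset Z.2
  have := abs_height_sub_le hφ X Z.1
  rw [hZ, sub_self, zero_sub, abs_neg] at this
  exact (le_abs_self _).trans this

end AdaptedDistance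

end

noncomputable section

open MeasureTheory Set
open scoped NNReal ENNReal

namespace AdaptedDistance

variable {n : ℕ} {φ : EuclideanSpace ℝ (Fin n) → ℝ} {L : ℝ≥0}

/-! ### Carleson embedding -/

lemma mem_shift_image {A : Set (Space n)} {X : Space n} :
    X ∈ shift φ '' A ↔ pt (horiz X) (height X - φ (horiz X)) ∈ A := by
  constructor
  · rintro ⟨Y, hY, rfl⟩
    simpa [shift] using hY
  · intro h
    exact ⟨_, h, by simp [shift]⟩

lemma mem_shift_box {a : EuclideanSpace ℝ (Fin n)} {r : ℝ} {X : Space n} :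
    X ∈ shift φ '' carlesonBox a r ↔
      horiz X ∈ cube a r ∧ height X - φ (horiz X) ∈ Ioc 0 r := by
  rw [mem_shift_image, carlesonBox, mem_ofPred_eq, horiz_pt, height_pt]

lemma dist_graph_le (hφ : LipschitzWith L φ) (x x' : EuclideanSpace ℝ (Fin n)) :
    dist (pt x (φ x)) (pt x' (φ x')) ≤ √(1 + (L : ℝ) ^ 2) * dist x x' := by
  have h1 := hφ.dist_le_mul x x'
  rw [dist_eq_norm, dist_eq_norm] at *
  rw [← pt_sub]
  have h2 := norm_sq_eq (pt (x - x') (φ x - φ x'))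
  rw [horiz_pt, height_pt] at h2
  have hs := Real.sq_sqrt (show 0 ≤ 1 + (L : ℝ) ^ 2 by positivity)
  refine le_of_sq_le_sq ?_ (by positivity)
  rw [mul_pow, hs, h2]
  have : (φ x - φ x') ^ 2 ≤ (L * ‖x - x'‖) ^ 2 := by
    rw [← sq_abs]
    gcongr
    exact h1
  nlinarith

/-- The ball in `{|x| < 2}` over which `X` is seen non-tangentially. -/
def shadowCenter (c : ℝ) (φ : EuclideanSpace ℝ (Fin n) → ℝ) (X : Space n) :
    EuclideanSpace ℝ (Fin n) :=
  (1 - c * (height X - φ (horiz X)) / 2) • horiz X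

/-- The radius of the ball in `{|x| < 2}` over which `X` is seen non-tangentially. -/
def shadowRadius (c : ℝ) (φ : EuclideanSpace ℝ (Fin n) → ℝ) (X : Space n) : ℝ :=
  c * (height X - φ (horiz X))

/-- The shadow of `X` on the base. -/
def shadow (c : ℝ) (φ : EuclideanSpace ℝ (Fin n) → ℝ) (X : Space n) :
    Set (EuclideanSpace ℝ (Fin n)) := Metric.ball (shadowCenter c φ X) (shadowRadius c φ X)

lemma dist_shadowCenter {c : ℝ} {X : Space n} (hr : 0 ≤ shadowRadius c φ X)
    (hx : ‖horiz X‖ ≤ 2) : dist (horiz X) (shadowCenter c φ X) ≤ shadowRadius c φ X := by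
  rw [dist_eq_norm]
  have : horiz X - shadowCenter c φ X = (shadowRadius c φ X / 2) • horiz X := by
    rw [shadowCenter, shadowRadius, sub_smul, one_smul, sub_sub_cancel]
  rw [this, norm_smul, Real.norm_of_nonneg (by positivity)]
  nlinarith

/-- Pulling the centre towards the origin by the factor 1 - r/2 leaves it at distance at most 2 - r
from 0, which is room for a ball of radius r. Hence the embedding theorem uses the maximal function
over |x| ≤ 2 only. -/
lemma shadow_subset {c : ℝ} {X : Space n}
    (hr1 : shadowRadius c φ X ≤ 1) (hx : ‖horiz X‖ ≤ 2) :
    shadow c φ X ⊆ Metric.closedBall 0 2 := by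
  refine Metric.ball_subset_closedBall.trans (Metric.closedBall_subset_closedBall' ?_)
  rw [dist_zero_right]
  have : shadowCenter c φ X = (1 - shadowRadius c φ X / 2) • horiz X := rfl
  rw [this, norm_smul, Real.norm_of_nonneg (by linarith)]
  nlinarith

/-- The largest value of `f` seen from `x`, with respect to shadows. -/
def shadowMax (c : ℝ) (φ : EuclideanSpace ℝ (Fin n) → ℝ) (W : Set (Space n)) (f : Space n → ℝ)
    (x : EuclideanSpace ℝ (Fin n)) : ℝ≥0∞ :=
  ⨆ X ∈ W, (shadow c φ X).indicator (fun _ => ‖f X‖ₑ) x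

/-- The supremum is uncountable, but shadows are open, so each term is lower semicontinuous. This
function stands in for the maximal function, which then only occurs as an upper bound and needs no
measurability. -/
lemma measurable_shadowMax (c : ℝ) (W : Set (Space n)) (f : Space n → ℝ) :
    Measurable (shadowMax c φ W f) :=
  (lowerSemicontinuous_biSup fun _ _ =>
    Metric.isOpen_ball.lowerSemicontinuous_indicator (zero_le)).measurable

/-- With d the height of X above the graph and s = √(1 + L²), a point of the shadow is within 2cd of
the foot of X, so the graph point above it is within d + 2scd of X. As d ≤ s δ(X), this is at most κ
δ(X). -/
lemma shadowMax_le_maximal (hφ : LipschitzWith L φ) {κ c : ℝ} (hc : 0 ≤ c)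
    (hcκ : √(1 + (L : ℝ) ^ 2) * (1 + 2 * √(1 + (L : ℝ) ^ 2) * c) ≤ κ) {W : Set (Space n)}
    (hW : W ⊆ domain φ) (hW2 : ∀ X ∈ W, ‖horiz X‖ ≤ 2) (f : Space n → ℝ)
    (x : EuclideanSpace ℝ (Fin n)) :
    shadowMax c φ W f x ≤ maximal (domain φ) κ (W.indicator f) (pt x (φ x)) := by
  refine iSup₂_le fun X hX => ?_
  by_cases hx : x ∈ shadow c φ X
  · rw [indicator_of_mem hx]
    have hd : 0 < height X - φ (horiz X) := sub_pos.2 (mem_domain.1 (hW hX))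
    have hr : 0 ≤ shadowRadius c φ X := mul_nonneg hc hd.le
    have h1 := dist_shadowCenter hr (hW2 X hX)
    have h2 : dist x (shadowCenter c φ X) < shadowRadius c φ X := hx
    have h3 : dist (horiz X) x ≤ 2 * shadowRadius c φ X := by
      linarith [dist_triangle_right (horiz X) x (shadowCenter c φ X)]
    have h4 : dist X (pt (horiz X) (φ (horiz X))) = height X - φ (horiz X) := by
      conv_lhs => rw [← pt_horiz_height X]
      rw [horiz_pt, dist_eq_norm, ← pt_sub, sub_self]
      have := pt_smul (height X - φ (horiz X)) (0 : EuclideanSpace ℝ (Fin n)) 1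
      rw [smul_zero, mul_one] at this
      rw [this, norm_smul, show pt 0 1 = vert n from rfl, norm_vert, mul_one, Real.norm_of_nonneg hd.le]
    have hmem : X ∈ approach (domain φ) κ (pt x (φ x)) := by
      refine ⟨hW hX, ?_⟩
      have h5 := le_delta_domain hφ X
      have h6 := dist_graph_le hφ (horiz X) x
      have h7 := dist_triangle X (pt (horiz X) (φ (horiz X))) (pt x (φ x))
      have hs : 0 < √(1 + (L : ℝ) ^ 2) := by positivity
      set s := √(1 + (L : ℝ) ^ 2)
      set d := height X - φ (horiz X)
      have h8 : dist X (pt x (φ x)) ≤ d * (1 + 2 * s * c) := by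
        have : s * dist (horiz X) x ≤ s * (2 * (c * d)) := by gcongr; exact h3
        nlinarith
      have hδ : 0 ≤ delta (domain φ) X := Metric.infDist_nonneg
      calc _ ≤ _ := h8
        _ ≤ (s * delta (domain φ) X) * (1 + 2 * s * c) := by gcongr
        _ = s * (1 + 2 * s * c) * delta (domain φ) X := by ring
        _ ≤ _ := by gcongr
    calc ‖f X‖ₑ = ‖W.indicator f X‖ₑ := by rw [indicator_of_mem hX]
      _ ≤ _ := le_iSup₂ (f := fun X (_ : X ∈ approach (domain φ) κ (pt x (φ x))) =>
        ‖W.indicator f X‖ₑ) X hmem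
  · rw [indicator_of_notMem hx]; exact zero_le

/-- Vitali's lemma selects disjoint shadows such that Carleson boxes of comparable size over them
cover W. The Carleson condition bounds each box by a multiple of the volume of its shadow, and the
disjoint volumes add up inside the union of all shadows. -/
lemma measure_level_le {c h : ℝ} (hc : 0 < c) (hch : c * h ≤ 1) {μ : Measure (Space n)} {M' : ℝ}
    (hM' : 0 ≤ M')
    (hμ : ∀ (a : EuclideanSpace ℝ (Fin n)) (r : ℝ), 0 < r →
      μ (shift φ '' carlesonBox a r) ≤ ENNReal.ofReal (M' * r ^ n))
    {W : Set (Space n)} (hW : ∀ X ∈ W, X ∈ domain φ ∧ ‖horiz X‖ ≤ 2 ∧ height X - φ (horiz X) ≤ h) :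
    μ W ≤ ENNReal.ofReal (M' * (10 + 2 / c) ^ n) *
      ((volume (Metric.ball (0 : EuclideanSpace ℝ (Fin n)) 1))⁻¹ *
        volume (⋃ X ∈ W, shadow c φ X)) := by
  have hd : ∀ X ∈ W, 0 < height X - φ (horiz X) := fun X hX => sub_pos.2 (mem_domain.1 (hW X hX).1)
  have hr : ∀ X ∈ W, 0 < shadowRadius c φ X := fun X hX => mul_pos hc (hd X hX)
  have hr1 : ∀ X ∈ W, shadowRadius c φ X ≤ 1 := fun X hX =>
    (mul_le_mul_of_nonneg_left (hW X hX).2.2 hc.le).trans hch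
  obtain ⟨u, hu, hdisj, hcov⟩ := Vitali.exists_disjoint_subfamily_covering_enlargement
    (shadow c φ) W (shadowRadius c φ) 2 one_lt_two (fun X hX => (hr X hX).le) 1 hr1
    (fun X hX => ⟨_, Metric.mem_ball_self (hr X hX)⟩)
  have hcount : u.Countable := hdisj.countable_of_isOpen (fun _ _ => Metric.isOpen_ball)
    (fun X hX => ⟨_, Metric.mem_ball_self (hr X (hu hX))⟩)
  -- The foot of X lies within 5 r of the selected centre: its own radius is at most 2 r, counted
  -- twice, plus r. This asks for side 10 r. The height of X is its radius divided by c, hence at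
  -- most (2 / c) r.
  set k : ℝ := 10 + 2 / c
  have hk : 0 < k := by positivity
  let corner : Space n → EuclideanSpace ℝ (Fin n) := fun b =>
    WithLp.toLp 2 fun i => shadowCenter c φ b i - 5 * shadowRadius c φ b
  have hsub : W ⊆ ⋃ b ∈ u, shift φ '' carlesonBox (corner b) (k * shadowRadius c φ b) := by
    intro X hX
    obtain ⟨b, hb, ⟨z, hz, hz'⟩, hXb⟩ := hcov X hX
    refine mem_biUnion hb (mem_shift_box.2 ⟨fun i => ?_, hd X hX, ?_⟩)
    · have h1 := dist_shadowCenter (hr X hX).le (hW X hX).2.1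
      have h2 : dist z _ < _ := hz
      have h3 : dist z _ < _ := hz'
      have h4 : dist (horiz X) (shadowCenter c φ b) ≤ 5 * shadowRadius c φ b := by
        have := dist_triangle (horiz X) (shadowCenter c φ X) (shadowCenter c φ b)
        have := dist_triangle_left (shadowCenter c φ X) (shadowCenter c φ b) z
        linarith
      have h5 : |horiz X i - shadowCenter c φ b i| ≤ 5 * shadowRadius c φ b := by
        refine le_trans ?_ h4
        rw [dist_eq_norm]
        exact PiLp.norm_apply_le (horiz X - shadowCenter c φ b) i
      rw [abs_le] at h5
      have h6 : 10 * shadowRadius c φ b ≤ k * shadowRadius c φ b := by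
        refine mul_le_mul_of_nonneg_right ?_ (hr b (hu hb)).le
        simp only [k]; linarith [show 0 < 2 / c by positivity]
      constructor
      · change shadowCenter c φ b i - 5 * shadowRadius c φ b ≤ _; linarith [h5.1]
      · change _ ≤ shadowCenter c φ b i - 5 * shadowRadius c φ b + _; linarith [h5.2]
    · have h1 : c * (height X - φ (horiz X)) ≤ 2 * shadowRadius c φ b := hXb
      have h2 : height X - φ (horiz X) ≤ 2 / c * shadowRadius c φ b := by
        rw [div_mul_eq_mul_div, le_div_iff₀' hc]; exact h1
      have := (hr b (hu hb)).le
      simp only [k]; linarith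
  set ω := volume (Metric.ball (0 : EuclideanSpace ℝ (Fin n)) 1) with hω
  have hω0 : ω ≠ 0 := (Metric.measure_ball_pos _ _ one_pos).ne'
  have hωt : ω ≠ ∞ := measure_ball_lt_top.ne
  have := hcount.to_subtype
  calc μ W ≤ ∑' b : u, μ (shift φ '' carlesonBox (corner b) (k * shadowRadius c φ b)) :=
        (measure_mono hsub).trans (measure_biUnion_le _ hcount _)
    _ ≤ ∑' b : u, ENNReal.ofReal (M' * k ^ n) * (ω⁻¹ * volume (shadow c φ b)) := by
        refine ENNReal.tsum_le_tsum fun b => ?_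
        have hrb := hr b (hu b.2)
        refine (hμ _ _ (mul_pos hk hrb)).trans ?_
        rw [shadow, Measure.addHaar_ball_of_pos _ _ hrb, ← hω, mul_comm ω⁻¹, mul_assoc,
          ENNReal.mul_inv_cancel hω0 hωt, mul_one, finrank_euclideanSpace_fin,
          ← ENNReal.ofReal_mul (by positivity), mul_pow, mul_assoc]
    _ = ENNReal.ofReal (M' * k ^ n) * (ω⁻¹ * volume (⋃ b ∈ u, shadow c φ b)) := by
        rw [ENNReal.tsum_mul_left, ENNReal.tsum_mul_left, measure_biUnion hcount hdisj
          fun _ _ => Metric.isOpen_ball.measurableSet]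
    _ ≤ _ := by
        have : (⋃ b ∈ u, shadow c φ b) ⊆ ⋃ X ∈ W, shadow c φ X := biUnion_subset_biUnion_left hu
        exact mul_le_mul_right (mul_le_mul_right (measure_mono this) _) _

/-- Carleson's embedding theorem, localised to the part of the domain above `{|x| ≤ 2}`. -/
lemma carleson_embedding {κ : ℝ} (hκ : √(1 + (L : ℝ) ^ 2) < κ) {h : ℝ} (hh : 0 < h) :
    ∃ C : ℝ≥0, ∀ φ : EuclideanSpace ℝ (Fin n) → ℝ, LipschitzWith L φ →
      ∀ (μ : Measure (Space n)) (M' : ℝ), 0 ≤ M' →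
      (∀ (a : EuclideanSpace ℝ (Fin n)) (r : ℝ), 0 < r →
        μ (shift φ '' carlesonBox a r) ≤ ENNReal.ofReal (M' * r ^ n)) →
      ∀ (W : Set (Space n)), MeasurableSet W →
      (∀ X ∈ W, X ∈ domain φ ∧ ‖horiz X‖ ≤ 2 ∧ height X - φ (horiz X) ≤ h) →
      ∀ f : Space n → ℝ, AEMeasurable f (μ.restrict W) → (∃ B, ∀ X ∈ W, |f X| ≤ B) →
      ∫⁻ X in W, ‖f X‖ₑ ^ 2 ∂μ ≤ C * ENNReal.ofReal M' *
        ∫⁻ x in Metric.closedBall 0 2,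
          maximal (domain φ) κ (W.indicator f) (pt x (φ x)) ^ 2 := by
  set s := √(1 + (L : ℝ) ^ 2) with hs
  have hs0 : 0 < s := by positivity
  -- The first bound makes shadows narrow enough for the aperture κ; the second keeps their radii at
  -- most 1, as needed for the recentring and for Vitali's lemma.
  set c := min ((κ / s - 1) / (2 * s)) (1 / h) with hc
  have hκs : 0 < κ / s - 1 := by rw [sub_pos, one_lt_div hs0]; exact hκ
  have hc0 : 0 < c := lt_min (by positivity) (by positivity)
  have hch : c * h ≤ 1 := by
    have : c ≤ 1 / h := min_le_right _ _
    rwa [le_div_iff₀ hh] at this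
  have hcκ : s * (1 + 2 * s * c) ≤ κ := by
    have : c ≤ (κ / s - 1) / (2 * s) := min_le_left _ _
    rw [le_div_iff₀ (by positivity)] at this
    have h2 : 1 + 2 * s * c ≤ κ / s := by linarith
    rwa [le_div_iff₀' hs0] at h2
  set ω := volume (Metric.ball (0 : EuclideanSpace ℝ (Fin n)) 1) with hω
  have hω0 : ω ≠ 0 := (Metric.measure_ball_pos _ _ one_pos).ne'
  refine ⟨(ENNReal.ofReal ((10 + 2 / c) ^ n) * ω⁻¹).toNNReal, ?_⟩
  rw [ENNReal.coe_toNNReal (ENNReal.mul_ne_top ENNReal.ofReal_ne_top (ENNReal.inv_ne_top.2 hω0))]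
  rintro φ hφ μ M' hM' hμ W hWm hW f hf ⟨B, hB⟩
  set g := shadowMax c φ W f with hg
  have hgm : Measurable g := measurable_shadowMax c W f
  have hgB : ∀ x, g x ≤ ENNReal.ofReal B := fun x => by
    refine iSup₂_le fun X hX => (indicator_le_self' (fun _ _ => zero_le) _).trans ?_
    rw [Real.enorm_eq_ofReal_abs]
    exact ENNReal.ofReal_le_ofReal (hB X hX)
  have hgt : ∀ x, g x ≠ ∞ := fun x => ne_top_of_le_ne_top ENNReal.ofReal_ne_top (hgB x)
  -- The shadow of a point with |f| > t lies in {g > t}. So the distribution functions can be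
  -- compared, and the layer-cake formula turns this into the L² bound.
  have key : ∀ t : ℝ, 0 < t → (μ.restrict W) {X | t < |f X|} ≤
      ENNReal.ofReal (M' * (10 + 2 / c) ^ n) * (ω⁻¹ *
        (volume.restrict (Metric.closedBall 0 2)) {x | t < (g x).toReal}) := by
    intro t ht
    have h1 : (μ.restrict W) {X | t < |f X|} = μ ({X | t < |f X|} ∩ W) :=
      Measure.restrict_apply₀ (nullMeasurableSet_lt aemeasurable_const hf.abs)
    have h2 : (volume.restrict (Metric.closedBall 0 2)) {x | t < (g x).toReal} =
      volume ({x | t < (g x).toReal} ∩ Metric.closedBall 0 2) :=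
      Measure.restrict_apply (measurableSet_lt measurable_const hgm.ennreal_toReal)
    rw [h1, h2]
    refine (measure_level_le hc0 hch hM' hμ (fun X hX => hW X hX.2)).trans ?_
    gcongr
    refine iUnion₂_subset fun X hX x hx => ?_
    refine ⟨?_, shadow_subset
      ((mul_le_mul_of_nonneg_left (hW X hX.2).2.2 hc0.le).trans hch) (hW X hX.2).2.1 hx⟩
    have h3 : t < |f X| := hX.1
    have h4 : ‖f X‖ₑ ≤ g x := by
      refine le_trans ?_ (le_iSup₂ (f := fun X (_ : X ∈ W) =>
        (shadow c φ X).indicator (fun _ => ‖f X‖ₑ) x) X hX.2)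
      simp only [indicator_of_mem hx, le_refl]
    have h5 := ENNReal.toReal_mono (hgt x) h4
    rw [toReal_enorm, Real.norm_eq_abs] at h5
    exact h3.trans_le h5
  have hL : ∫⁻ X in W, ‖f X‖ₑ ^ 2 ∂μ = ∫⁻ X in W, ENNReal.ofReal (|f X| ^ (2 : ℝ)) ∂μ := by
    refine lintegral_congr fun X => ?_
    rw [Real.enorm_eq_ofReal_abs, ← ENNReal.ofReal_pow (abs_nonneg _), Real.rpow_two]
  have hR : ∫⁻ x in Metric.closedBall 0 2, ENNReal.ofReal ((g x).toReal ^ (2 : ℝ)) ≤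
      ∫⁻ x in Metric.closedBall 0 2,
          maximal (domain φ) κ (W.indicator f) (pt x (φ x)) ^ 2 := by
    refine lintegral_mono fun x => ?_
    dsimp only
    rw [Real.rpow_two, ENNReal.ofReal_pow ENNReal.toReal_nonneg, ENNReal.ofReal_toReal (hgt x)]
    gcongr
    exact shadowMax_le_maximal hφ hc0.le hcκ (fun X hX => (hW X hX).1) (fun X hX => (hW X hX).2.1)
      f x
  refine le_trans ?_ (mul_le_mul_right hR _)
  rw [hL, lintegral_rpow_eq_lintegral_meas_lt_mul _ (Filter.Eventually.of_forall fun X => abs_nonneg _)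
    hf.abs two_pos, lintegral_rpow_eq_lintegral_meas_lt_mul _
    (Filter.Eventually.of_forall fun X => ENNReal.toReal_nonneg) hgm.ennreal_toReal.aemeasurable
    two_pos]
  have hcM : ENNReal.ofReal (M' * (10 + 2 / c) ^ n) * ω⁻¹ =
      ENNReal.ofReal ((10 + 2 / c) ^ n) * ω⁻¹ * ENNReal.ofReal M' := by
    rw [ENNReal.ofReal_mul hM']; ring
  rw [← hcM, mul_left_comm]
  gcongr
  rw [← lintegral_const_mul']
  · refine setLIntegral_mono' measurableSet_Ioi fun t ht => ?_
    rw [← mul_assoc]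
    gcongr
    rw [mul_assoc]
    exact key t ht
  · exact ENNReal.mul_ne_top ENNReal.ofReal_ne_top (ENNReal.inv_ne_top.2 hω0)

end AdaptedDistance

end

noncomputable section

open MeasureTheory Set
open scoped NNReal ENNReal

namespace AdaptedDistance

variable {n : ℕ} {φ : EuclideanSpace ℝ (Fin n) → ℝ} {L : ℝ≥0}

/-! ### Geometry of the sections -/

section Geometry

variable {M : ℝ} {ρ : Space n → ℝ}

lemma add_smul_vert_mem {X : Space n} (hX : φ (horiz X) ≤ height X) {s : ℝ} (hs : 0 < s) :
    X + s • vert n ∈ domain φ := by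
  simp only [mem_domain, horiz_add, horiz_smul, horiz_vert, smul_zero, add_zero, height_add,
      height_smul, height_vert, mul_one]
  linarith

namespace IsAdaptedDistance

lemma hasFDerivAt (h : IsAdaptedDistance φ M ρ) (hφ : Continuous φ) {X : Space n}
    (hX : X ∈ domain φ) : HasFDerivAt ρ (fderiv ℝ ρ X) X :=
  ((h.contDiffOn.contDiffAt ((isOpen_domain hφ).mem_nhds hX)).differentiableAt
    (by norm_num)).hasFDerivAt

lemma continuousOn_closure (h : IsAdaptedDistance φ M ρ) :
    ContinuousOn ρ (closure (domain φ)) := by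
  obtain ⟨K, hK⟩ := h.lipschitz
  exact hK.continuousOn

/-- The starting point may lie on the graph, where ρ need not be differentiable: continuity on the
closure is enough for the mean value inequality on the closed segment. -/
lemma vert_bounds (h : IsAdaptedDistance φ M ρ) (hφ : Continuous φ) {X : Space n}
    (hX : φ (horiz X) ≤ height X) {s : ℝ} (hs : 0 ≤ s) :
    1 / M * s ≤ ρ (X + s • vert n) - ρ X ∧ ρ (X + s • vert n) - ρ X ≤ M * s := by
  have hc : ContinuousOn (fun t : ℝ => ρ (X + t • vert n)) (Icc 0 s) := by
    refine h.continuousOn_closure.comp (by fun_prop) fun t ht => ?_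
    rw [closure_domain hφ]
    simp only [mem_ofPred_eq, horiz_add, horiz_smul, horiz_vert, smul_zero, add_zero, height_add,
      height_smul, height_vert, mul_one]
    linarith [ht.1]
  have hd : ∀ t ∈ interior (Icc 0 s), HasDerivAt (fun t : ℝ => ρ (X + t • vert n))
      (fderiv ℝ ρ (X + t • vert n) (vert n)) t := by
    intro t ht
    rw [interior_Icc] at ht
    have h1 : HasDerivAt (fun t : ℝ => X + t • vert n) (vert n) t := by
      simpa using ((hasDerivAt_id t).smul_const (vert n)).const_add X
    exact (h.hasFDerivAt hφ (add_smul_vert_mem hX ht.1)).comp_hasDerivAt t h1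
  have hdd : DifferentiableOn ℝ (fun t : ℝ => ρ (X + t • vert n)) (interior (Icc 0 s)) :=
    fun t ht => (hd t ht).differentiableAt.differentiableWithinAt
  constructor
  · have := (convex_Icc 0 s).mul_sub_le_image_sub_of_le_deriv hc hdd (C := 1 / M) (fun t ht => by
      rw [(hd t ht).deriv]
      rw [interior_Icc] at ht
      exact h.le_vert _ (add_smul_vert_mem hX ht.1)) 0 (left_mem_Icc.2 hs) s (right_mem_Icc.2 hs) hs
    simpa using this
  · have := (convex_Icc 0 s).image_sub_le_mul_sub_of_deriv_le hc hdd (C := M) (fun t ht => by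
      rw [(hd t ht).deriv]
      rw [interior_Icc] at ht
      exact h.vert_le _ (add_smul_vert_mem hX ht.1)) 0 (left_mem_Icc.2 hs) s (right_mem_Icc.2 hs) hs
    simpa using this

lemma bounds (h : IsAdaptedDistance φ M ρ) (hφ : Continuous φ) {X : Space n}
    (hX : φ (horiz X) ≤ height X) :
    1 / M * (height X - φ (horiz X)) ≤ ρ X ∧ ρ X ≤ M * (height X - φ (horiz X)) := by
  have := h.vert_bounds hφ (X := pt (horiz X) (φ (horiz X))) (by simp) (sub_nonneg.2 hX)
  rwa [← pt_eq_add_smul_vert, pt_horiz_height, h.eq_zero, sub_zero] at this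

lemma pos_of_mem (h : IsAdaptedDistance φ M ρ) (hφ : Continuous φ) {X : Space n}
    (hX : X ∈ domain φ) : 0 < ρ X :=
  lt_of_lt_of_le (mul_pos (one_div_pos.2 h.pos) (sub_pos.2 (mem_domain.1 hX)))
    (h.bounds hφ (mem_domain.1 hX).le).1

lemma one_le (h : IsAdaptedDistance φ M ρ) : 1 ≤ M := by
  have hX : pt 0 (φ 0 + 1) ∈ domain φ := by simp [mem_domain]
  have := (h.le_vert _ hX).trans (h.vert_le _ hX)
  rw [div_le_iff₀ h.pos] at this
  nlinarith [h.pos]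

lemma isOpen_cylSection (h : IsAdaptedDistance φ M ρ) (hφ : Continuous φ) (t : ℝ) :
    IsOpen (cylSection φ ρ t) := by
  have h1 : IsOpen (domain φ ∩ ρ ⁻¹' Ioo 0 t) :=
    h.contDiffOn.continuousOn.isOpen_inter_preimage (isOpen_domain hφ) isOpen_Ioo
  have h2 : IsOpen {X : Space n | ‖horiz X‖ < t} :=
    isOpen_lt (continuous_horiz.norm) continuous_const
  convert h1.inter h2 using 1
  ext X
  simp only [cylSection, mem_ofPred_eq, mem_inter_iff, mem_preimage, mem_Ioo]
  tauto

lemma isBounded_aux (h : IsAdaptedDistance φ M ρ) (hφ : LipschitzWith L φ) (t : ℝ) :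
    Bornology.IsBounded {X : Space n | φ (horiz X) ≤ height X ∧ ‖horiz X‖ ≤ t ∧ ρ X ≤ t} := by
  refine (Metric.isBounded_closedBall (x := (0 : Space n))
    (r := t + (M * t + (|φ 0| + L * t)))).subset ?_
  rintro X ⟨hX, hx, hρ⟩
  rw [mem_closedBall_zero_iff]
  refine (norm_le_add X).trans (add_le_add hx ?_)
  have h1 := (h.bounds hφ.continuous hX).1
  rw [one_div, inv_mul_le_iff₀ h.pos] at h1
  have h2 := hφ.dist_le_mul (horiz X) 0
  rw [dist_zero_right, Real.dist_eq] at h2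
  have h3 : (L : ℝ) * ‖horiz X‖ ≤ L * t := by gcongr
  have h4 : M * ρ X ≤ M * t := mul_le_mul_of_nonneg_left hρ h.pos.le
  have h5 := abs_sub_le_iff.1 (h2.trans h3)
  have h6 := neg_abs_le (φ 0)
  have h7 := le_abs_self (φ 0)
  have h8 : 0 ≤ M * t := by linarith
  rw [abs_le]
  constructor <;> linarith

lemma isBounded_cylSection (h : IsAdaptedDistance φ M ρ) (hφ : LipschitzWith L φ) (t : ℝ) :
    Bornology.IsBounded (cylSection φ ρ t) :=
  (h.isBounded_aux hφ t).subset fun _ hX => ⟨(mem_domain.1 hX.1).le, hX.2.1.le, hX.2.2.2.le⟩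

lemma isCompact_core (h : IsAdaptedDistance φ M ρ) (hφ : LipschitzWith L φ) (ε t : ℝ) :
    IsCompact {X : Space n | X ∈ closure (domain φ) ∧ ‖horiz X‖ ≤ t ∧ ρ X ∈ Icc ε t} := by
  refine Metric.isCompact_of_isClosed_isBounded ?_ ?_
  · have h1 : IsClosed (closure (domain φ) ∩ ρ ⁻¹' Icc ε t) :=
      h.continuousOn_closure.preimage_isClosed_of_isClosed isClosed_closure isClosed_Icc
    have h2 : IsClosed {X : Space n | ‖horiz X‖ ≤ t} :=
      isClosed_le (continuous_horiz.norm) continuous_const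
    have h3 : {X : Space n | X ∈ closure (domain φ) ∧ ‖horiz X‖ ≤ t ∧ ρ X ∈ Icc ε t} =
        (closure (domain φ) ∩ ρ ⁻¹' Icc ε t) ∩ {X : Space n | ‖horiz X‖ ≤ t} := by
      ext X
      simp only [mem_ofPred_eq, mem_inter_iff, mem_preimage]
      tauto
    rw [h3]
    exact h1.inter h2
  · refine (h.isBounded_aux hφ t).subset fun X hX => ⟨?_, hX.2.1, hX.2.2.2⟩
    have := hX.1
    rwa [closure_domain hφ.continuous] at this

/-- Points with ρ ≥ ε > 0 cannot lie on the graph, where ρ vanishes. This provides the compact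
support of the Rellich field inside an open section. -/
lemma core_subset (h : IsAdaptedDistance φ M ρ) (hφ : LipschitzWith L φ) {ε t t' : ℝ} (hε : 0 < ε)
    (ht : t < t') :
    {X : Space n | X ∈ closure (domain φ) ∧ ‖horiz X‖ ≤ t ∧ ρ X ∈ Icc ε t} ⊆
      cylSection φ ρ t' := by
  rintro X ⟨hX, hx, hρ⟩
  rw [closure_domain hφ.continuous] at hX
  refine ⟨?_, hx.trans_lt ht, hε.trans_le hρ.1, hρ.2.trans_lt ht⟩
  rcases (show φ (horiz X) ≤ height X from hX).lt_or_eq with h1 | h1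
  · exact h1
  · have := h.eq_zero (horiz X)
    rw [h1, pt_horiz_height] at this
    linarith [hρ.1]

/-- The three summands of the denominator serve the three requirements: 2M√(1 + L²) keeps the ball
above the graph, 2 keeps |x| < 3, and 2M keeps ρ < 3, as |∇ρ| ≤ M. -/
lemma ball_subset_cylSection (h : IsAdaptedDistance φ M ρ) (hφ : LipschitzWith L φ) {X : Space n}
    (hX : X ∈ cylSection φ ρ 2) :
    Metric.ball X (ρ X / (2 * M * √(1 + (L : ℝ) ^ 2) + 2 + 2 * M)) ⊆ cylSection φ ρ 3 := by
  obtain ⟨hX, hx, hρ, hρ2⟩ := hX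
  have hM := h.one_le
  set s := √(1 + (L : ℝ) ^ 2)
  have hs : 0 ≤ s := Real.sqrt_nonneg _
  have hD : 0 < 2 * M * s + 2 + 2 * M := by positivity
  set r := ρ X / (2 * M * s + 2 + 2 * M) with hr
  have hr0 : 0 < r := div_pos hρ hD
  have hrD : r * (2 * M * s + 2 + 2 * M) = ρ X := div_mul_cancel₀ _ hD.ne'
  have hMr : 0 < M * r := by positivity
  have hMsr : 0 ≤ M * s * r := by positivity
  have hdom : Metric.ball X r ⊆ domain φ := by
    intro Z hZ
    have h1 := abs_height_sub_le hφ X Z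
    have h2 : dist X Z < r := by rw [dist_comm]; exact hZ
    have h3 := (h.bounds hφ.continuous (mem_domain.1 hX).le).2
    have h4 := (abs_le.1 h1).1
    have h5 : s * dist X Z ≤ s * r := by gcongr
    have h6 : M * (height X - φ (horiz X)) ≥ M * (2 * s * r) + 2 * r := by nlinarith
    have h7 : s * r < height X - φ (horiz X) := by
      by_contra! hcon
      nlinarith [mul_le_mul_of_nonneg_left hcon h.pos.le]
    rw [mem_domain]
    linarith
  intro Z hZ
  have hZ' : dist Z X < r := hZ
  refine ⟨hdom hZ, ?_, h.pos_of_mem hφ.continuous (hdom hZ), ?_⟩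
  · have h1 : ‖horiz Z‖ ≤ ‖horiz X‖ + ‖horiz (Z - X)‖ := by
      rw [horiz_sub]; exact norm_le_norm_add_norm_sub' _ _
    have h2 := norm_horiz_le (Z - X)
    rw [← dist_eq_norm] at h2
    nlinarith
  · have := (convex_ball X r).norm_image_sub_le_of_norm_fderiv_le (f := ρ) (𝕜 := ℝ) (C := M)
      (fun Y hY => (h.hasFDerivAt hφ.continuous (hdom hY)).differentiableAt)
      (fun Y hY => h.grad_le _ (hdom hY)) (Metric.mem_ball_self hr0) hZ
    rw [← dist_eq_norm Z X] at this
    have h1 := (le_abs_self _).trans this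
    nlinarith

lemma le_delta_cylSection (h : IsAdaptedDistance φ M ρ) (hφ : LipschitzWith L φ) {X : Space n}
    (hX : X ∈ cylSection φ ρ 2) :
    ρ X ≤ (2 * M * √(1 + (L : ℝ) ^ 2) + 2 + 2 * M) * delta (cylSection φ ρ 3) X := by
  have hM := h.one_le
  have hD : 0 < 2 * M * √(1 + (L : ℝ) ^ 2) + 2 + 2 * M := by positivity
  have hball := h.ball_subset_cylSection hφ hX
  have hopen := h.isOpen_cylSection hφ.continuous 3
  have hXm : X ∈ cylSection φ ρ 3 := hball (Metric.mem_ball_self (div_pos hX.2.2.1 hD))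
  rw [← div_le_iff₀' hD, delta, Metric.infDist_eq_iInf]
  -- `Metric.infDist` to an empty set is zero by default, so the frontier must be shown nonempty; a
  -- nonempty bounded set is not the whole space.
  have hne : (frontier (cylSection φ ρ 3)).Nonempty := by
    refine nonempty_frontier_iff.2 ⟨⟨X, hXm⟩, fun huniv => ?_⟩
    have := h.isBounded_cylSection hφ 3
    rw [huniv] at this
    exact NormedSpace.unbounded_univ ℝ (Space n) this
  have := hne.to_subtype
  refine le_ciInf fun Z => ?_
  by_contra! hlt
  rw [dist_comm] at hlt
  have h1 := hball (Metric.mem_ball.2 hlt)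
  have h2 := Z.2
  exact (hopen.frontier_eq.subset h2).2 h1

end IsAdaptedDistance

end Geometry

end AdaptedDistance

end

noncomputable section

open MeasureTheory Set
open scoped NNReal ENNReal

namespace AdaptedDistance

variable {n : ℕ}

/-! ### Integration by parts -/

section Divergence

variable {E : Type*} [NormedAddCommGroup E] [NormedSpace ℝ E]

/-- Extension by zero: it makes the Rellich field regular on the whole space although u is only
controlled in a section, so no boundary terms have to be discussed. -/
lemma contDiff_of_eq_zero_off {f : E → ℝ} {U S : Set E} {k : ℕ∞} (hU : IsOpen U)
    (hf : ContDiffOn ℝ k f U) (hS : IsClosed S) (hSU : S ⊆ U) (h0 : ∀ x ∉ S, f x = 0) :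
    ContDiff ℝ k f := by
  rw [contDiff_iff_contDiffAt]
  intro x
  by_cases hx : x ∈ U
  · exact hf.contDiffAt (hU.mem_nhds hx)
  · have : f =ᶠ[nhds x] fun _ => 0 := by
      filter_upwards [hS.isOpen_compl.mem_nhds (fun h => hx (hSU h))] with y hy using h0 y hy
    exact contDiffAt_const.congr_of_eventuallyEq this

/-- Integration by parts against the constant function 1. -/
lemma integral_fderiv_eq_zero [MeasurableSpace E] [BorelSpace E] [FiniteDimensional ℝ E]
    (μ : Measure E) [μ.IsAddHaarMeasure] {f : E → ℝ} (hf : ContDiff ℝ 1 f)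
    (hc : HasCompactSupport f) (v : E) :
    Integrable (fun x => fderiv ℝ f x v) μ ∧ ∫ x, fderiv ℝ f x v ∂μ = 0 := by
  have hcont : Continuous fun x => fderiv ℝ f x v :=
    (hf.continuous_fderiv one_ne_zero).clm_apply continuous_const
  have hint : Integrable (fun x => fderiv ℝ f x v) μ :=
    hcont.integrable_of_hasCompactSupport (hc.fderiv_apply (𝕜 := ℝ) v)
  refine ⟨hint, ?_⟩
  have := integral_mul_fderiv_eq_neg_fderiv_mul_of_integrable (μ := μ) (f := fun _ : E => (1 : ℝ))
    (g := f) (v := v) (by simp) (by simpa using hint)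
    (by simpa using hf.continuous.integrable_of_hasCompactSupport hc)
    (fun _ _ => differentiableAt_const _) (fun _ _ => hf.differentiable one_ne_zero _)
  simpa using this

end Divergence

/-! ### The Rellich field -/

/-- The partial derivative of `f` in the direction `i`. -/
def pd (i : Fin (n + 1)) (f : Space n → ℝ) (X : Space n) : ℝ := fderiv ℝ f X (dir i)

lemma abs_pd_le (i : Fin (n + 1)) (f : Space n → ℝ) (X : Space n) :
    |pd i f X| ≤ ‖fderiv ℝ f X‖ := by
  have := (fderiv ℝ f X).le_opNorm (dir i)
  rwa [norm_dir, mul_one] at this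

lemma contDiffOn_pd {i : Fin (n + 1)} {f : Space n → ℝ} {U : Set (Space n)} (hU : IsOpen U)
    (hf : ContDiffOn ℝ 2 f U) : ContDiffOn ℝ 1 (pd i f) U :=
  (hf.fderiv_of_isOpen hU (by norm_num)).clm_apply contDiffOn_const

lemma pd_pd {i j : Fin (n + 1)} {f : Space n → ℝ} {X : Space n} (hf : ContDiffAt ℝ 2 f X) :
    pd i (pd j f) X = iteratedFDeriv ℝ 2 f X ![dir i, dir j] := by
  have h : DifferentiableAt ℝ (fderiv ℝ f) X :=
    (hf.fderiv_right (m := 1) (by norm_num)).differentiableAt one_ne_zero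
  have : HasFDerivAt (pd j f) _ X := h.hasFDerivAt.clm_apply (hasFDerivAt_const (dir j) X)
  rw [pd, this.fderiv, iteratedFDeriv_two_apply]
  simp

lemma pd_comm {i j : Fin (n + 1)} {f : Space n → ℝ} {X : Space n} (hf : ContDiffAt ℝ 2 f X) :
    pd i (pd j f) X = pd j (pd i f) X := by
  rw [pd_pd hf, pd_pd hf, iteratedFDeriv_two_apply, iteratedFDeriv_two_apply]
  exact (hf.isSymmSndFDerivAt (by simp)) _ _

lemma abs_pd_pd_le {i j : Fin (n + 1)} {f : Space n → ℝ} {X : Space n} (hf : ContDiffAt ℝ 2 f X) :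
    |pd i (pd j f) X| ≤ ‖iteratedFDeriv ℝ 2 f X‖ := by
  rw [pd_pd hf]
  refine ((iteratedFDeriv ℝ 2 f X).le_opNorm _).trans ?_
  simp

lemma sum_pd_pd_of_harmonic {u : Space n → ℝ} {X : Space n}
    (hu : InnerProductSpace.HarmonicAt u X) : ∑ i, pd i (pd i u) X = 0 := by
  have h := hu.2.eq_of_nhds
  rw [InnerProductSpace.laplacian_eq_iteratedFDeriv_orthonormalBasis u
    (EuclideanSpace.basisFun (Fin (n + 1)) ℝ)] at h
  simp only [EuclideanSpace.basisFun_apply, Pi.zero_apply] at h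
  rw [← h]
  exact Finset.sum_congr rfl fun i _ => pd_pd hu.1

section Rellich

variable (ζ ρ u : Space n → ℝ) (G : Fin (n + 1) → Space n → ℝ)

/-- The indicator of the vertical direction. -/
def ver (i : Fin (n + 1)) : ℝ := if i = Fin.last n then 1 else 0

/-- The derivative of `u²` in the direction `i`. -/
def sqd (i : Fin (n + 1)) (X : Space n) : ℝ := 2 * (u X * pd i u X)

/-- The components of the Rellich field
`ζ u² e + ρ ((G · ∇u²) e - (G · e) ∇u² - (e · ∇u²) G)`, where `e` is vertical. -/
def rellich (i : Fin (n + 1)) (X : Space n) : ℝ :=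
  ver i * (ζ X * u X ^ 2) + ρ X * (ver i * ∑ j, G j X * sqd u j X -
    G (Fin.last n) X * sqd u i X - sqd u (Fin.last n) X * G i X)

/-- The part of the divergence of the Rellich field that carries derivatives of the
coefficients. -/
def rellichErr (X : Space n) : ℝ :=
  ∑ j, (pd (Fin.last n) (G j) X * sqd u j X - pd j (G (Fin.last n)) X * sqd u j X -
    sqd u (Fin.last n) X * pd j (G j) X)

variable {ζ ρ u G}

/-- `hGρ` and `hGv` say that G · ∇ρ = ζ and that G is parallel to ∇ρ; together they remove every
term where a derivative falls on the factor ρ, against the derivative of u² in ζ u² e. What survives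
has a derivative on ζ, a derivative on G, or the Laplacian of u². -/
lemma sum_pd_rellich {X : Space n} (hζ : DifferentiableAt ℝ ζ X) (hρ : DifferentiableAt ℝ ρ X)
    (hG : ∀ j, DifferentiableAt ℝ (G j) X) (hu : InnerProductSpace.HarmonicAt u X)
    (hGρ : ∑ j, pd j ρ X * G j X = ζ X)
    (hGv : ∀ j, pd (Fin.last n) ρ X * G j X = G (Fin.last n) X * pd j ρ X) :
    ∑ i, pd i (rellich ζ ρ u G i) X = pd (Fin.last n) ζ X * u X ^ 2 +
      ρ X * (rellichErr u G X - 2 * G (Fin.last n) X * ∑ j, pd j u X ^ 2) := by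
  have hu1 : HasFDerivAt u (fderiv ℝ u X) X :=
    (hu.1.differentiableAt (by norm_num)).hasFDerivAt
  have hud : ∀ j, DifferentiableAt ℝ (pd j u) X := fun j =>
    (((hu.1.fderiv_right (m := 1) (by norm_num)).clm_apply contDiffAt_const).differentiableAt
      one_ne_zero)
  have hW : ∀ j, HasFDerivAt (sqd u j) _ X := fun j =>
    (hu1.mul (hud j).hasFDerivAt).const_mul 2
  have hF : ∀ i, HasFDerivAt (rellich ζ ρ u G i) _ X := fun i =>
    ((hζ.hasFDerivAt.mul (hu1.pow 2)).const_mul (ver i)).add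
      (hρ.hasFDerivAt.mul ((((HasFDerivAt.fun_sum fun j (_ : j ∈ Finset.univ) =>
        (hG j).hasFDerivAt.mul (hW j)).const_mul (ver i)).sub
        ((hG (Fin.last n)).hasFDerivAt.mul (hW i))).sub
        ((hW (Fin.last n)).mul (hG i).hasFDerivAt)))
  have hcomm : ∀ j, fderiv ℝ (pd (Fin.last n) u) X (dir j) =
      fderiv ℝ (pd j u) X (dir (Fin.last n)) := fun j => pd_comm hu.1
  have hval : ∀ i, pd i (rellich ζ ρ u G i) X =
      ver i * (pd i ζ X * u X ^ 2 + ζ X * sqd u i X) +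
      (pd i ρ X * (ver i * ∑ j, G j X * sqd u j X -
    G (Fin.last n) X * sqd u i X - sqd u (Fin.last n) X * G i X) +
    ρ X * (ver i * ∑ j, (pd i (G j) X * sqd u j X +
        G j X * (2 * (pd i u X * pd j u X + u X * pd i (pd j u) X))) -
      pd i (G (Fin.last n)) X * sqd u i X -
      G (Fin.last n) X * (2 * (pd i u X ^ 2 + u X * pd i (pd i u) X)) -
      2 * (pd i u X * pd (Fin.last n) u X + u X * pd (Fin.last n) (pd i u) X) * G i X -
      sqd u (Fin.last n) X * pd i (G i) X)) := by
    intro i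
    rw [pd, (hF i).fderiv]
    simp only [add_apply, smul_apply, smul_eq_mul, sub_apply, sum_apply, nsmul_eq_mul,
      Nat.cast_ofNat]
    rw [hcomm i]
    have hs : ∑ j, (G j X * (2 * (u X * (fderiv ℝ (pd j u) X) (dir i) +
          pd j u X * (fderiv ℝ u X) (dir i))) + sqd u j X * (fderiv ℝ (G j) X) (dir i)) =
        ∑ j, (pd i (G j) X * sqd u j X +
          G j X * (2 * (pd i u X * pd j u X + u X * pd i (pd j u) X))) :=
      Finset.sum_congr rfl fun j _ => by simp only [pd]; ring
    rw [hs]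
    simp only [sqd]
    simp only [show ∀ (j : Fin (n + 1)) (f : Space n → ℝ), fderiv ℝ f X (dir j) = pd j f X
      from fun _ _ => rfl]
    simp only [Nat.reduceSub, pow_one]
    ring
  have hlap := sum_pd_pd_of_harmonic hu
  -- Parallelism of G and ∇ρ: ∂_yρ (G · ∇u²) = (G · e)(∇ρ · ∇u²), so the first two terms of the
  -- field cancel when paired with ∇ρ.
  have hS : pd (Fin.last n) ρ X * ∑ j, G j X * sqd u j X =
      G (Fin.last n) X * ∑ j, pd j ρ X * sqd u j X := by
    rw [Finset.mul_sum, Finset.mul_sum]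
    exact Finset.sum_congr rfl fun j _ => by rw [← mul_assoc, hGv, mul_assoc]
  have hver : ∀ f : Fin (n + 1) → ℝ, ∑ i, ver i * f i = f (Fin.last n) := fun f => by
    simp [ver]
  have e1 : ∑ i, pd i ρ X * (ver i * ∑ j, G j X * sqd u j X -
      G (Fin.last n) X * sqd u i X - sqd u (Fin.last n) X * G i X) =
      - (sqd u (Fin.last n) X * ζ X) := by
    have : ∀ i, pd i ρ X * (ver i * ∑ j, G j X * sqd u j X -
      G (Fin.last n) X * sqd u i X - sqd u (Fin.last n) X * G i X) =
      ver i * (pd i ρ X * ∑ j, G j X * sqd u j X) - G (Fin.last n) X * (pd i ρ X * sqd u i X) -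
      sqd u (Fin.last n) X * (pd i ρ X * G i X) := fun i => by ring
    simp only [this, Finset.sum_sub_distrib, ← Finset.mul_sum, hver, hGρ, hS]
    ring
  have e2 : ∑ i, (ver i * ∑ j, (pd i (G j) X * sqd u j X +
        G j X * (2 * (pd i u X * pd j u X + u X * pd i (pd j u) X))) -
      pd i (G (Fin.last n)) X * sqd u i X -
      G (Fin.last n) X * (2 * (pd i u X ^ 2 + u X * pd i (pd i u) X)) -
      2 * (pd i u X * pd (Fin.last n) u X + u X * pd (Fin.last n) (pd i u) X) * G i X -
      sqd u (Fin.last n) X * pd i (G i) X) =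
      rellichErr u G X - 2 * G (Fin.last n) X * ∑ j, pd j u X ^ 2 := by
    have a1 : ∑ i, G (Fin.last n) X * (2 * (pd i u X ^ 2 + u X * pd i (pd i u) X)) =
        2 * G (Fin.last n) X * ∑ j, pd j u X ^ 2 := by
      have : ∀ i, G (Fin.last n) X * (2 * (pd i u X ^ 2 + u X * pd i (pd i u) X)) =
        2 * G (Fin.last n) X * pd i u X ^ 2 + 2 * G (Fin.last n) X * u X * pd i (pd i u) X :=
        fun i => by ring
      simp only [this, Finset.sum_add_distrib, ← Finset.mul_sum, hlap, mul_zero, add_zero]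
    have a2 : ∑ i, 2 * (pd i u X * pd (Fin.last n) u X + u X * pd (Fin.last n) (pd i u) X) * G i X =
        ∑ j, G j X * (2 * (pd (Fin.last n) u X * pd j u X + u X * pd (Fin.last n) (pd j u) X)) :=
      Finset.sum_congr rfl fun j _ => by ring
    simp only [Finset.sum_sub_distrib, a1, a2, hver]
    simp only [rellichErr, Finset.sum_sub_distrib, Finset.sum_add_distrib]
    ring
  rw [Finset.sum_congr rfl fun i _ => hval i, Finset.sum_add_distrib, Finset.sum_add_distrib,
    hver fun i => pd i ζ X * u X ^ 2 + ζ X * sqd u i X, e1, ← Finset.mul_sum, e2]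
  ring

end Rellich

end AdaptedDistance

end

noncomputable section

open MeasureTheory Set
open scoped NNReal ENNReal

namespace AdaptedDistance

variable {n : ℕ}

/-! ### Cutoff functions -/

lemma deriv_smoothTransition_nonneg (t : ℝ) : 0 ≤ deriv Real.smoothTransition t :=
  Real.smoothTransition.monotone.deriv_nonneg

lemma deriv_smoothTransition_of_le {t : ℝ} (ht : t < 0) : deriv Real.smoothTransition t = 0 := by
  have : Real.smoothTransition =ᶠ[nhds t] fun _ => 0 := by
    filter_upwards [Iio_mem_nhds ht] with s hs
    exact Real.smoothTransition.zero_of_nonpos (le_of_lt hs)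
  rw [this.deriv_eq, deriv_const]

lemma deriv_smoothTransition_of_ge {t : ℝ} (ht : 1 < t) : deriv Real.smoothTransition t = 0 := by
  have : Real.smoothTransition =ᶠ[nhds t] fun _ => 1 := by
    filter_upwards [Ioi_mem_nhds ht] with s hs
    exact Real.smoothTransition.one_of_one_le (le_of_lt hs)
  rw [this.deriv_eq, deriv_const]

lemma exists_deriv_smoothTransition_le : ∃ B : ℝ, 0 ≤ B ∧
    ∀ t, deriv Real.smoothTransition t ≤ B := by
  have hc : Continuous (deriv Real.smoothTransition) :=
    Real.smoothTransition.contDiff.continuous_deriv (n := 1) le_rfl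
  obtain ⟨B, hB⟩ := isCompact_Icc.exists_bound_of_continuousOn (s := Icc (0 : ℝ) 1) hc.continuousOn
  refine ⟨|B|, abs_nonneg _, fun t => ?_⟩
  by_cases ht : t ∈ Icc (0 : ℝ) 1
  · exact (le_abs_self _).trans ((hB t ht).trans (le_abs_self _))
  · rw [mem_Icc, not_and_or, not_le, not_le] at ht
    rcases ht with ht | ht
    · rw [deriv_smoothTransition_of_le ht]; positivity
    · rw [deriv_smoothTransition_of_ge ht]; positivity

lemma hasDerivAt_smoothTransition (t : ℝ) :
    HasDerivAt Real.smoothTransition (deriv Real.smoothTransition t) t :=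
  ((Real.smoothTransition.contDiff (n := 1)).differentiable one_ne_zero t).hasDerivAt

/-- A smooth cutoff on the base, equal to `1` on the unit ball. -/
def baseBump (n : ℕ) : ContDiffBump (0 : EuclideanSpace ℝ (Fin n)) :=
  ⟨1, 3 / 2, one_pos, by norm_num⟩

lemma exists_fderiv_baseBump_le (n : ℕ) : ∃ B : ℝ, 0 ≤ B ∧
    ∀ x, ‖fderiv ℝ (baseBump n) x‖ ≤ B := by
  have h1 : ContDiff ℝ 1 (baseBump n) := (baseBump n).contDiff
  obtain ⟨B, hB⟩ := (h1.continuous_fderiv one_ne_zero).bounded_above_of_compact_support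
    ((baseBump n).hasCompactSupport.fderiv (𝕜 := ℝ))
  exact ⟨|B|, abs_nonneg _, fun x => (hB x).trans (le_abs_self _)⟩

/-- The lower cutoff in the adapted distance. -/
def lowCut (ε s : ℝ) : ℝ := Real.smoothTransition (s / ε - 1)

/-- The derivative of the lower cutoff. -/
def lowCut' (ε s : ℝ) : ℝ := deriv Real.smoothTransition (s / ε - 1) / ε

/-- The upper cutoff in the adapted distance. -/
def highCut (s : ℝ) : ℝ := Real.smoothTransition (3 - 2 * s)

/-- The derivative of the upper cutoff. -/
def highCut' (s : ℝ) : ℝ := -2 * deriv Real.smoothTransition (3 - 2 * s)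

lemma hasDerivAt_lowCut (ε s : ℝ) : HasDerivAt (lowCut ε) (lowCut' ε s) s := by
  have h : HasDerivAt (fun s : ℝ => s / ε - 1) (1 / ε) s :=
    ((hasDerivAt_id s).div_const ε).sub_const 1
  have := (hasDerivAt_smoothTransition (s / ε - 1)).comp s h
  rw [show lowCut' ε s = deriv Real.smoothTransition (s / ε - 1) * (1 / ε) by
    rw [lowCut', mul_one_div]]
  exact this

lemma hasDerivAt_highCut (s : ℝ) : HasDerivAt highCut (highCut' s) s := by
  have h : HasDerivAt (fun s : ℝ => 3 - 2 * s) (-(2 * 1)) s :=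
    ((hasDerivAt_id s).const_mul 2).const_sub 3
  have := (hasDerivAt_smoothTransition (3 - 2 * s)).comp s h
  rw [show highCut' s = deriv Real.smoothTransition (3 - 2 * s) * -(2 * 1) by
    rw [highCut']; ring]
  exact this

lemma contDiff_lowCut (ε : ℝ) : ContDiff ℝ 1 (lowCut ε) :=
  Real.smoothTransition.contDiff.comp ((contDiff_id.div_const ε).sub contDiff_const)

lemma contDiff_highCut : ContDiff ℝ 1 highCut :=
  Real.smoothTransition.contDiff.comp (contDiff_const.sub (contDiff_const.mul contDiff_id))

lemma lowCut_mem (ε s : ℝ) : 0 ≤ lowCut ε s ∧ lowCut ε s ≤ 1 :=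
  ⟨Real.smoothTransition.nonneg _, Real.smoothTransition.le_one _⟩

lemma highCut_mem (s : ℝ) : 0 ≤ highCut s ∧ highCut s ≤ 1 :=
  ⟨Real.smoothTransition.nonneg _, Real.smoothTransition.le_one _⟩

lemma lowCut_of_le {ε s : ℝ} (hε : 0 < ε) (hs : s ≤ ε) : lowCut ε s = 0 :=
  Real.smoothTransition.zero_of_nonpos (by rw [sub_nonpos, div_le_one hε]; exact hs)

lemma lowCut_of_ge {ε s : ℝ} (hε : 0 < ε) (hs : 2 * ε ≤ s) : lowCut ε s = 1 :=
  Real.smoothTransition.one_of_one_le (by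
    have : 2 ≤ s / ε := by rwa [le_div_iff₀ hε]
    linarith)

lemma highCut_of_le {s : ℝ} (hs : s ≤ 1) : highCut s = 1 :=
  Real.smoothTransition.one_of_one_le (by linarith)

lemma highCut_of_ge {s : ℝ} (hs : 3 / 2 ≤ s) : highCut s = 0 :=
  Real.smoothTransition.zero_of_nonpos (by linarith)

lemma highCut'_of_lt {s : ℝ} (hs : s < 1) : highCut' s = 0 := by
  rw [highCut', deriv_smoothTransition_of_ge (by linarith), mul_zero]

lemma lowCut'_nonneg {ε : ℝ} (hε : 0 < ε) (s : ℝ) : 0 ≤ lowCut' ε s :=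
  div_nonneg (deriv_smoothTransition_nonneg _) hε.le

lemma lowCut'_of_gt {ε s : ℝ} (hε : 0 < ε) (hs : 2 * ε < s) : lowCut' ε s = 0 := by
  have : 2 < s / ε := by rwa [lt_div_iff₀ hε]
  rw [lowCut', deriv_smoothTransition_of_ge (by linarith), zero_div]

/-! ### Bounds for the coefficients of the Rellich field -/

section Coefficients

lemma pd_mul {f g : Space n → ℝ} {X : Space n} (i : Fin (n + 1)) (hf : DifferentiableAt ℝ f X)
    (hg : DifferentiableAt ℝ g X) :
    pd i (fun Y => f Y * g Y) X = f X * pd i g X + g X * pd i f X := by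
  rw [pd, (hf.hasFDerivAt.fun_mul hg.hasFDerivAt).fderiv]
  simp [pd]

lemma pd_congr {f g : Space n → ℝ} {X : Space n} {i : Fin (n + 1)} (h : f =ᶠ[nhds X] g) :
    pd i f X = pd i g X := by rw [pd, h.fderiv_eq, pd]

/-- The squared length of the gradient. -/
def gradSq (ρ : Space n → ℝ) (X : Space n) : ℝ := ∑ k, pd k ρ X ^ 2

/-- The components of `∇ρ / |∇ρ|²`. -/
def dualGrad (ρ : Space n → ℝ) (j : Fin (n + 1)) (X : Space n) : ℝ := pd j ρ X / gradSq ρ X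

variable {ρ : Space n → ℝ} {X : Space n} {M : ℝ}

lemma differentiableAt_pd {f : Space n → ℝ} (j : Fin (n + 1)) (hf : ContDiffAt ℝ 2 f X) :
    DifferentiableAt ℝ (pd j f) X :=
  ((hf.fderiv_right (m := 1) (by norm_num)).clm_apply contDiffAt_const).differentiableAt
      one_ne_zero

lemma le_gradSq (hM : 0 < M) (h : 1 / M ≤ pd (Fin.last n) ρ X) :
    1 / M ^ 2 ≤ gradSq ρ X := by
  have h1 : pd (Fin.last n) ρ X ^ 2 ≤ gradSq ρ X :=
    Finset.single_le_sum (f := fun k => pd k ρ X ^ 2) (fun k _ => sq_nonneg _) (Finset.mem_univ _)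
  refine le_trans ?_ h1
  rw [← one_div_pow]
  exact pow_le_pow_left₀ (by positivity) h 2

lemma gradSq_pos (hM : 0 < M) (h : 1 / M ≤ pd (Fin.last n) ρ X) : 0 < gradSq ρ X :=
  lt_of_lt_of_le (by positivity) (le_gradSq hM h)

lemma inv_gradSq_le (hM : 0 < M) (h : 1 / M ≤ pd (Fin.last n) ρ X) :
    (gradSq ρ X)⁻¹ ≤ M ^ 2 := by
  have := le_gradSq hM h
  rw [inv_le_comm₀ (gradSq_pos hM h) (by positivity)]
  simpa using this

lemma abs_dualGrad_le (hM : 0 < M) (h : 1 / M ≤ pd (Fin.last n) ρ X) (hg : ‖fderiv ℝ ρ X‖ ≤ M)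
    (j : Fin (n + 1)) : |dualGrad ρ j X| ≤ M ^ 3 := by
  rw [dualGrad, div_eq_mul_inv, abs_mul, abs_of_pos (inv_pos.2 (gradSq_pos hM h))]
  calc _ ≤ M * M ^ 2 := by
        gcongr
        · exact (inv_pos.2 (gradSq_pos hM h)).le
        · exact (abs_pd_le j ρ X).trans hg
        · exact inv_gradSq_le hM h
    _ = M ^ 3 := by ring

lemma differentiableAt_gradSq (hρ : ContDiffAt ℝ 2 ρ X) : DifferentiableAt ℝ (gradSq ρ) X :=
  DifferentiableAt.fun_sum fun k _ => (differentiableAt_pd k hρ).pow 2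

lemma abs_pd_gradSq_le (hM : 0 < M) (hρ : ContDiffAt ℝ 2 ρ X) (hg : ‖fderiv ℝ ρ X‖ ≤ M)
    (i : Fin (n + 1)) :
    |pd i (gradSq ρ) X| ≤ (n + 1) * (2 * (M * ‖iteratedFDeriv ℝ 2 ρ X‖)) := by
  have h : HasFDerivAt (gradSq ρ) _ X :=
    HasFDerivAt.fun_sum fun k (_ : k ∈ Finset.univ) =>
      ((differentiableAt_pd k hρ).hasFDerivAt).pow 2
  have h2 : pd i (gradSq ρ) X = ∑ k, 2 * (pd k ρ X * pd i (pd k ρ) X) := by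
    rw [pd, h.fderiv, sum_apply]
    refine Finset.sum_congr rfl fun k _ => ?_
    simp only [smul_apply, smul_eq_mul, pd]
    simp
    ring
  rw [h2]
  refine (Finset.abs_sum_le_sum_abs _ _).trans ?_
  have : ∀ k ∈ Finset.univ, |2 * (pd k ρ X * pd i (pd k ρ) X)| ≤
      2 * (M * ‖iteratedFDeriv ℝ 2 ρ X‖) := fun k _ => by
    rw [abs_mul, abs_mul, abs_two]
    gcongr
    · exact (abs_pd_le k ρ X).trans hg
    · exact abs_pd_pd_le hρ
  refine (Finset.sum_le_card_nsmul _ _ _ this).trans ?_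
  simp

lemma differentiableAt_dualGrad (hM : 0 < M) (h : 1 / M ≤ pd (Fin.last n) ρ X)
    (hρ : ContDiffAt ℝ 2 ρ X) (j : Fin (n + 1)) : DifferentiableAt ℝ (dualGrad ρ j) X :=
  (differentiableAt_pd j hρ).mul ((differentiableAt_inv (gradSq_pos hM h).ne').comp X
    (differentiableAt_gradSq hρ))

/-- The quotient rule; the lower bound on the vertical derivative keeps |∇ρ|² away from zero, so the
only unbounded factor is the Hessian, and it appears linearly. -/
lemma abs_pd_dualGrad_le (hM : 0 < M) (h : 1 / M ≤ pd (Fin.last n) ρ X)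
    (hρ : ContDiffAt ℝ 2 ρ X) (hg : ‖fderiv ℝ ρ X‖ ≤ M) (i j : Fin (n + 1)) :
    |pd i (dualGrad ρ j) X| ≤ (M ^ 2 + 2 * (n + 1) * M ^ 6) * ‖iteratedFDeriv ℝ 2 ρ X‖ := by
  have hq := gradSq_pos hM h
  have hqi := inv_gradSq_le hM h
  have h1 : HasFDerivAt (dualGrad ρ j) _ X :=
    (differentiableAt_pd j hρ).hasFDerivAt.mul
      ((hasDerivAt_inv hq.ne').comp_hasFDerivAt X (differentiableAt_gradSq hρ).hasFDerivAt)
  have h2 : pd i (dualGrad ρ j) X = pd i (pd j ρ) X * (gradSq ρ X)⁻¹ -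
      pd j ρ X * (gradSq ρ X)⁻¹ ^ 2 * pd i (gradSq ρ) X := by
    rw [pd, h1.fderiv]
    simp only [add_apply, smul_apply, smul_eq_mul, pd]
    rw [inv_pow]
    ring
  rw [h2]
  have hinv : 0 < (gradSq ρ X)⁻¹ := inv_pos.2 hq
  set H := ‖iteratedFDeriv ℝ 2 ρ X‖
  have hH : 0 ≤ H := norm_nonneg _
  refine (abs_sub _ _).trans ?_
  rw [abs_mul, abs_mul, abs_mul, abs_of_pos hinv, abs_of_pos (pow_pos hinv 2)]
  calc _ ≤ H * M ^ 2 + M * (M ^ 2) ^ 2 * ((n + 1) * (2 * (M * H))) := by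
        gcongr
        · exact abs_pd_pd_le hρ
        · exact (abs_pd_le j ρ X).trans hg
        · exact abs_pd_gradSq_le hM hρ hg i
    _ = _ := by ring

lemma sum_pd_mul_dualGrad (hM : 0 < M) (h : 1 / M ≤ pd (Fin.last n) ρ X) :
    ∑ j, pd j ρ X * dualGrad ρ j X = 1 := by
  have hq := gradSq_pos hM h
  have : ∀ j, pd j ρ X * dualGrad ρ j X = pd j ρ X ^ 2 / gradSq ρ X := fun j => by
    rw [dualGrad]; ring
  rw [Finset.sum_congr rfl fun j _ => this j, ← Finset.sum_div]
  exact div_self hq.ne'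

end Coefficients

end AdaptedDistance

end

noncomputable section

open MeasureTheory Set
open scoped NNReal ENNReal

namespace AdaptedDistance

variable {n : ℕ} {φ : EuclideanSpace ℝ (Fin n) → ℝ} {L : ℝ≥0} {ρ : Space n → ℝ} {M ε : ℝ}
  {X : Space n}

/-! ### The Rellich identity for an adapted distance -/

/-- The cutoff adapted to the cylindrical sections. -/
def cutoff (φ : EuclideanSpace ℝ (Fin n) → ℝ) (ρ : Space n → ℝ) (ε : ℝ) : Space n → ℝ :=
  (domain φ).indicator fun X => baseBump n (horiz X) * (lowCut ε (ρ X) * highCut (ρ X))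

/-- The set outside of which `cutoff` vanishes. -/
def core (φ : EuclideanSpace ℝ (Fin n) → ℝ) (ρ : Space n → ℝ) (ε t : ℝ) : Set (Space n) :=
  {X | X ∈ closure (domain φ) ∧ ‖horiz X‖ ≤ t ∧ ρ X ∈ Icc ε t}

lemma cutoff_of_notMem (hε : 0 < ε) (hX : X ∉ core φ ρ ε (3 / 2)) : cutoff φ ρ ε X = 0 := by
  by_cases hd : X ∈ domain φ
  · rw [cutoff, indicator_of_mem hd]
    by_cases h1 : ‖horiz X‖ ≤ 3 / 2
    · by_cases h2 : ε ≤ ρ X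
      · by_cases h3 : ρ X ≤ 3 / 2
        · exact absurd ⟨subset_closure hd, h1, h2, h3⟩ hX
        · rw [highCut_of_ge (not_le.1 h3).le, mul_zero, mul_zero]
      · rw [lowCut_of_le hε (not_le.1 h2).le, zero_mul, mul_zero]
    · rw [(baseBump n).zero_of_le_dist (by rw [dist_zero_right]; exact (not_le.1 h1).le), zero_mul]
  · rw [cutoff, indicator_of_notMem hd]

lemma cutoff_mem (X : Space n) : 0 ≤ cutoff φ ρ ε X ∧ cutoff φ ρ ε X ≤ 1 := by
  by_cases hd : X ∈ domain φ
  · rw [cutoff, indicator_of_mem hd]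
    have h1 := lowCut_mem ε (ρ X)
    have h2 := highCut_mem (ρ X)
    have h3 : 0 ≤ baseBump n (horiz X) := (baseBump n).nonneg
    have h4 : baseBump n (horiz X) ≤ 1 := (baseBump n).le_one
    exact ⟨mul_nonneg h3 (mul_nonneg h1.1 h2.1),
      mul_le_one₀ h4 (mul_nonneg h1.1 h2.1) (mul_le_one₀ h1.2 h2.1 h2.2)⟩
  · rw [cutoff, indicator_of_notMem hd]; simp

lemma cutoff_eventuallyEq (hφ : Continuous φ) (hX : X ∈ domain φ) : cutoff φ ρ ε =ᶠ[nhds X]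
    fun X => baseBump n (horiz X) * (lowCut ε (ρ X) * highCut (ρ X)) := by
  filter_upwards [(isOpen_domain hφ).mem_nhds hX] with Y hY
  rw [cutoff, indicator_of_mem hY]

namespace IsAdaptedDistance

variable (h : IsAdaptedDistance φ M ρ)
include h

lemma contDiffOn_cutoff : ContDiffOn ℝ 1 (cutoff φ ρ ε) (domain φ) := by
  have hρ : ContDiffOn ℝ 1 ρ (domain φ) := h.contDiffOn.of_le (by norm_num)
  have h1 : ContDiffOn ℝ 1 (fun X => baseBump n (horiz X)) (domain φ) :=
    ((baseBump n).contDiff.comp (horizL n).contDiff).contDiffOn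
  have h2 := h1.mul (((contDiff_lowCut ε).comp_contDiffOn hρ).mul
    (contDiff_highCut.comp_contDiffOn hρ))
  refine h2.congr fun X hX => ?_
  rw [cutoff, indicator_of_mem hX]
  rfl

lemma pd_cutoff (hφ : Continuous φ) (hX : X ∈ domain φ) (i : Fin (n + 1)) :
    pd i (cutoff φ ρ ε) X =
      baseBump n (horiz X) * ((lowCut' ε (ρ X) * highCut (ρ X) + lowCut ε (ρ X) * highCut' (ρ X)) *
        pd i ρ X) +
      lowCut ε (ρ X) * highCut (ρ X) * fderiv ℝ (baseBump n) (horiz X) (horiz (dir i)) := by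
  have hρ := h.hasFDerivAt hφ hX
  have hb : HasFDerivAt (baseBump n) (fderiv ℝ (baseBump n) (horiz X)) (horizL n X) :=
    (((baseBump n).contDiff (n := 1)).differentiable one_ne_zero (horiz X)).hasFDerivAt
  have h1 := hb.comp X (horizL n).hasFDerivAt
  have h2 : HasFDerivAt
    (fun X => baseBump n (horiz X) * (lowCut ε (ρ X) * highCut (ρ X))) _ X := h1.mul (((hasDerivAt_lowCut ε (ρ X)).comp_hasFDerivAt X hρ).mul
    ((hasDerivAt_highCut (ρ X)).comp_hasFDerivAt X hρ))
  rw [pd_congr (cutoff_eventuallyEq hφ hX), pd, h2.fderiv]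
  simp only [add_apply, smul_apply, smul_eq_mul, pd, ContinuousLinearMap.comp_apply, horizL_apply]
  simp only [Function.comp_apply, horizL_apply]
  ring

/-- The base bump is constant along vertical lines. This is why the vertical field e is used in ζ u²
e: no derivative of the bump ever multiplies u² without a factor ρ ∇u. -/
lemma pd_last_cutoff (hφ : Continuous φ) (hX : X ∈ domain φ) :
    pd (Fin.last n) (cutoff φ ρ ε) X =
      baseBump n (horiz X) * ((lowCut' ε (ρ X) * highCut (ρ X) + lowCut ε (ρ X) * highCut' (ρ X)) *
        pd (Fin.last n) ρ X) := by
  rw [h.pd_cutoff hφ hX, ← vert_eq_dir, horiz_vert, map_zero, mul_zero, add_zero]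

lemma abs_pd_cutoff_le (hφ : Continuous φ) (hX : X ∈ domain φ) (hε : 0 < ε) {B B₁ : ℝ}
    (hB : ∀ t, deriv Real.smoothTransition t ≤ B)
    (hB₁ : ∀ x, ‖fderiv ℝ (baseBump n) x‖ ≤ B₁) (i : Fin (n + 1)) :
    |pd i (cutoff φ ρ ε) X| ≤ (lowCut' ε (ρ X) + 2 * B) * M + B₁ := by
  rw [h.pd_cutoff hφ hX]
  have h1 := lowCut_mem ε (ρ X)
  have h2 := highCut_mem (ρ X)
  have h3 : 0 ≤ baseBump n (horiz X) := (baseBump n).nonneg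
  have h4 : baseBump n (horiz X) ≤ 1 := (baseBump n).le_one
  have h5 := lowCut'_nonneg hε (ρ X)
  have h6 : |highCut' (ρ X)| ≤ 2 * B := by
    rw [highCut', abs_mul, abs_of_nonneg (deriv_smoothTransition_nonneg _), abs_neg, abs_two]
    exact mul_le_mul_of_nonneg_left (hB _) two_pos.le
  have h7 : |pd i ρ X| ≤ M := (abs_pd_le i ρ X).trans (h.grad_le X hX)
  have h8 : |fderiv ℝ (baseBump n) (horiz X) (horiz (dir i))| ≤ B₁ := by
    refine ((fderiv ℝ (baseBump n) (horiz X)).le_opNorm _).trans ?_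
    calc _ ≤ B₁ * 1 := by
          gcongr
          · exact (norm_nonneg _).trans (hB₁ 0)
          · exact hB₁ _
          · exact (norm_horiz_le _).trans (norm_dir i).le
      _ = B₁ := mul_one _
  have h9 : |lowCut' ε (ρ X) * highCut (ρ X) + lowCut ε (ρ X) * highCut' (ρ X)| ≤
      lowCut' ε (ρ X) + 2 * B := by
    refine (abs_add_le _ _).trans (add_le_add ?_ ?_)
    · rw [abs_of_nonneg (mul_nonneg h5 h2.1)]
      exact mul_le_of_le_one_right h5 h2.2
    · rw [abs_mul, abs_of_nonneg h1.1]
      exact (mul_le_of_le_one_left (abs_nonneg _) h1.2).trans h6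
  refine (abs_add_le _ _).trans (add_le_add ?_ ?_)
  · rw [abs_mul, abs_of_nonneg h3, abs_mul]
    exact (mul_le_of_le_one_left (by positivity) h4).trans
      (mul_le_mul h9 h7 (abs_nonneg _) ((abs_nonneg _).trans h9))
  · rw [abs_mul, abs_of_nonneg (mul_nonneg h1.1 h2.1)]
    exact (mul_le_of_le_one_left (abs_nonneg _) (mul_le_one₀ h1.2 h2.1 h2.2)).trans h8

end IsAdaptedDistance

/-- The coefficient field `ζ ∇ρ / |∇ρ|²`. -/
def coeff (φ : EuclideanSpace ℝ (Fin n) → ℝ) (ρ : Space n → ℝ) (ε : ℝ) (j : Fin (n + 1))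
    (X : Space n) : ℝ := cutoff φ ρ ε X * dualGrad ρ j X

namespace IsAdaptedDistance

variable (h : IsAdaptedDistance φ M ρ)
include h

lemma le_pd_last (hX : X ∈ domain φ) : 1 / M ≤ pd (Fin.last n) ρ X := by
  rw [pd, ← vert_eq_dir]; exact h.le_vert X hX

lemma pd_last_le (hX : X ∈ domain φ) : pd (Fin.last n) ρ X ≤ M := by
  rw [pd, ← vert_eq_dir]; exact h.vert_le X hX

lemma contDiffAt (hφ : Continuous φ) (hX : X ∈ domain φ) : ContDiffAt ℝ 2 ρ X :=
  h.contDiffOn.contDiffAt ((isOpen_domain hφ).mem_nhds hX)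

lemma contDiffOn_coeff (hφ : Continuous φ) (j : Fin (n + 1)) :
    ContDiffOn ℝ 1 (coeff φ ρ ε j) (domain φ) := by
  refine h.contDiffOn_cutoff.mul ((contDiffOn_pd (isOpen_domain hφ) h.contDiffOn).div ?_ ?_)
  · exact ContDiffOn.sum fun k _ => (contDiffOn_pd (isOpen_domain hφ) h.contDiffOn).pow 2
  · exact fun X hX => (gradSq_pos h.pos (h.le_pd_last hX)).ne'

lemma differentiableAt_cutoff (hφ : Continuous φ) (hX : X ∈ domain φ) :
    DifferentiableAt ℝ (cutoff φ ρ ε) X :=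
  (h.contDiffOn_cutoff.contDiffAt ((isOpen_domain hφ).mem_nhds hX)).differentiableAt one_ne_zero

lemma abs_pd_coeff_le (hφ : Continuous φ) (hX : X ∈ domain φ) (i j : Fin (n + 1)) :
    |pd i (coeff φ ρ ε j) X| ≤ (M ^ 2 + 2 * (n + 1) * M ^ 6) * ‖iteratedFDeriv ℝ 2 ρ X‖ +
      M ^ 3 * |pd i (cutoff φ ρ ε) X| := by
  have hM := h.pos
  have h0 := h.le_pd_last hX
  have h1 : pd i (coeff φ ρ ε j) X = _ := pd_mul i (h.differentiableAt_cutoff hφ hX)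
    (differentiableAt_dualGrad h.pos h0 (h.contDiffAt hφ hX) j)
  have h2 := abs_dualGrad_le h.pos h0 (h.grad_le X hX) j
  have h3 := abs_pd_dualGrad_le h.pos h0 (h.contDiffAt hφ hX) (h.grad_le X hX) i j
  have h4 := cutoff_mem (φ := φ) (ρ := ρ) (ε := ε) X
  rw [h1]
  refine (abs_add_le _ _).trans (add_le_add ?_ ?_)
  · rw [abs_mul, abs_of_nonneg h4.1]
    exact (mul_le_of_le_one_left (abs_nonneg _) h4.2).trans h3
  · rw [abs_mul]
    gcongr

/-- The Rellich field integrates to zero. -/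
lemma integral_rellich_eq_zero (hφ : LipschitzWith L φ) (hε : 0 < ε) {u : Space n → ℝ}
    (hu : ContDiffOn ℝ 2 u (cylSection φ ρ 2)) :
    Integrable (fun X => ∑ i, pd i (rellich (cutoff φ ρ ε) ρ u (coeff φ ρ ε) i) X) ∧
    ∫ X, ∑ i, pd i (rellich (cutoff φ ρ ε) ρ u (coeff φ ρ ε) i) X = 0 ∧
    ∀ X ∉ cylSection φ ρ 2, ∑ i, pd i (rellich (cutoff φ ρ ε) ρ u (coeff φ ρ ε) i) X = 0 := by
  have hS : IsCompact (core φ ρ ε (3 / 2)) := h.isCompact_core hφ ε (3 / 2)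
  have hSU : core φ ρ ε (3 / 2) ⊆ cylSection φ ρ 2 := h.core_subset hφ hε (by norm_num)
  have hU := h.isOpen_cylSection hφ.continuous 2
  have hUd : cylSection φ ρ 2 ⊆ domain φ := fun X hX => hX.1
  have hpdu : ∀ j, ContDiffOn ℝ 1 (sqd u j) (cylSection φ ρ 2) := fun j =>
    contDiffOn_const.mul ((hu.of_le (by norm_num)).mul (contDiffOn_pd hU hu))
  have hG : ∀ j, ContDiffOn ℝ 1 (coeff φ ρ ε j) (cylSection φ ρ 2) := fun j =>
    (h.contDiffOn_coeff hφ.continuous j).mono hUd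
  have h0 : ∀ i, ∀ X ∉ core φ ρ ε (3 / 2),
      rellich (cutoff φ ρ ε) ρ u (coeff φ ρ ε) i X = 0 := fun i X hX => by
    simp [rellich, coeff, cutoff_of_notMem hε hX]
  -- The coefficients ∇ρ / |∇ρ|² and ∇u² are only once differentiable, which is exactly enough for
  -- the divergence; the cutoff supplies the extension by zero.
  have hF : ∀ i, ContDiff ℝ 1 (rellich (cutoff φ ρ ε) ρ u (coeff φ ρ ε) i) := fun i => by
    refine contDiff_of_eq_zero_off (k := 1) hU ?_ hS.isClosed hSU (h0 i)
    refine (contDiffOn_const.mul (((h.contDiffOn_cutoff).mono hUd).mul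
      ((hu.of_le (by norm_num)).pow 2))).add (((h.contDiffOn.mono hUd).of_le (by norm_num)).mul
      (((contDiffOn_const.mul (ContDiffOn.sum fun j _ => (hG j).mul (hpdu j))).sub
        ((hG _).mul (hpdu i))).sub ((hpdu _).mul (hG i))))
  have hc : ∀ i, HasCompactSupport (rellich (cutoff φ ρ ε) ρ u (coeff φ ρ ε) i) := fun i =>
    HasCompactSupport.intro hS (h0 i)
  have hI := fun i => integral_fderiv_eq_zero volume (hF i) (hc i) (dir i)
  refine ⟨integrable_finsetSum _ fun i _ => (hI i).1, ?_, fun X hX => ?_⟩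
  · refine (integral_finsetSum _ fun i _ => (hI i).1).trans ?_
    exact Finset.sum_eq_zero fun i _ => (hI i).2
  · refine Finset.sum_eq_zero fun i _ => ?_
    have : rellich (cutoff φ ρ ε) ρ u (coeff φ ρ ε) i =ᶠ[nhds X] fun _ => 0 := by
      filter_upwards [hS.isClosed.isOpen_compl.mem_nhds (fun hx => hX (hSU hx))] with Y hY
        using h0 i Y hY
    rw [pd_congr this]
    simp [pd]

lemma sum_pd_rellich_eq (hφ : LipschitzWith L φ) {u : Space n → ℝ}
    (hX : X ∈ domain φ) (hu : InnerProductSpace.HarmonicAt u X) :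
    ∑ i, pd i (rellich (cutoff φ ρ ε) ρ u (coeff φ ρ ε) i) X =
      pd (Fin.last n) (cutoff φ ρ ε) X * u X ^ 2 + ρ X * (rellichErr u (coeff φ ρ ε) X -
        2 * coeff φ ρ ε (Fin.last n) X * ∑ j, pd j u X ^ 2) := by
  have h0 := h.le_pd_last hX
  refine sum_pd_rellich (h.differentiableAt_cutoff hφ.continuous hX)
    (h.hasFDerivAt hφ.continuous hX).differentiableAt
    (fun j => ((h.contDiffOn_coeff hφ.continuous j).contDiffAt
      ((isOpen_domain hφ.continuous).mem_nhds hX)).differentiableAt one_ne_zero) hu ?_ ?_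
  · have : ∀ j, pd j ρ X * coeff φ ρ ε j X = cutoff φ ρ ε X * (pd j ρ X * dualGrad ρ j X) :=
      fun j => by rw [coeff]; ring
    rw [Finset.sum_congr rfl fun j _ => this j, ← Finset.mul_sum,
      sum_pd_mul_dualGrad h.pos h0, mul_one]
  · intro j
    rw [coeff, coeff, dualGrad, dualGrad]
    ring

end IsAdaptedDistance

lemma abs_rellichErr_le {u : Space n → ℝ} {G : Fin (n + 1) → Space n → ℝ} {D : ℝ}
    (hD : ∀ i j, |pd i (G j) X| ≤ D) :
    |rellichErr u G X| ≤ 6 * (n + 1) * D * (|u X| * ‖fderiv ℝ u X‖) := by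
  have hs : ∀ j, |sqd u j X| ≤ 2 * (|u X| * ‖fderiv ℝ u X‖) := fun j => by
    rw [sqd, abs_mul, abs_mul, abs_two]
    gcongr
    exact abs_pd_le j u X
  have hD0 : 0 ≤ D := (abs_nonneg _).trans (hD 0 0)
  refine (Finset.abs_sum_le_sum_abs _ _).trans ?_
  refine (Finset.sum_le_card_nsmul _ _ (6 * D * (|u X| * ‖fderiv ℝ u X‖)) fun j _ => ?_).trans ?_
  · refine (abs_sub _ _).trans ((add_le_add (abs_sub _ _) le_rfl).trans ?_)
    rw [abs_mul, abs_mul, abs_mul]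
    have h1 := mul_le_mul (hD (Fin.last n) j) (hs j) (abs_nonneg _) hD0
    have h2 := mul_le_mul (hD j (Fin.last n)) (hs j) (abs_nonneg _) hD0
    have h3 := mul_le_mul (hs (Fin.last n)) (hD j j) (abs_nonneg _) (by positivity)
    linarith
  · rw [Finset.card_univ, Fintype.card_fin, nsmul_eq_mul]
    apply le_of_eq
    push_cast
    ring

/-- Pointwise form of the main estimate: up to a function of zero integral, the boundary layer is
controlled by the terms of the main lemma. -/
lemma exists_pointwise_bound (n : ℕ) {M : ℝ} (hM : 1 ≤ M) : ∃ C : ℝ, 0 ≤ C ∧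
    ∀ (φ : EuclideanSpace ℝ (Fin n) → ℝ) (ρ : Space n → ℝ) (L : ℝ≥0), LipschitzWith L φ →
      IsAdaptedDistance φ M ρ →
    ∀ u : Space n → ℝ, ∀ ε : ℝ, 0 < ε → ε ≤ 1 / 4 → ∀ X ∈ cylSection φ ρ 2,
      InnerProductSpace.HarmonicAt u X →
      baseBump n (horiz X) * (lowCut' ε (ρ X) * pd (Fin.last n) ρ X) * u X ^ 2 ≤
        ∑ i, pd i (rellich (cutoff φ ρ ε) ρ u (coeff φ ρ ε) i) X +
        C * ((slab φ ρ).indicator (fun X => u X ^ 2) X + ρ X * ‖fderiv ℝ u X‖ ^ 2 +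
          ρ X * (1 + ‖iteratedFDeriv ℝ 2 ρ X‖) * (|u X| * ‖fderiv ℝ u X‖) +
          {X | ρ X ≤ 2 * ε}.indicator (fun X => |u X| * ‖fderiv ℝ u X‖) X) := by
  obtain ⟨B, hB0, hB⟩ := exists_deriv_smoothTransition_le
  obtain ⟨B₁, hB₁0, hB₁⟩ := exists_fderiv_baseBump_le n
  have hM0 : 0 < M := by linarith
  set A₁ : ℝ := M ^ 2 + 2 * (n + 1) * M ^ 6
  set A₂ : ℝ := M ^ 3 * (2 * B * M + B₁)
  set A₃ : ℝ := M ^ 3 * (2 * B * M)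
  have hA₁ : 0 ≤ A₁ := by positivity
  have hA₂ : 0 ≤ A₂ := by positivity
  have hA₃ : 0 ≤ A₃ := by positivity
  refine ⟨2 * B * M + 2 * M ^ 3 * (n + 1) + 6 * (n + 1) * (A₁ + A₂ + A₃), by positivity, ?_⟩
  intro φ ρ L hφ h u ε hε hε4 X hX hu
  have hXd : X ∈ domain φ := hX.1
  have hρ0 : 0 < ρ X := hX.2.2.1
  rw [h.sum_pd_rellich_eq hφ hXd hu, h.pd_last_cutoff hφ.continuous hXd]
  set χ := baseBump n (horiz X)
  have hχ0 : 0 ≤ χ := (baseBump n).nonneg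
  have hχ1 : χ ≤ 1 := (baseBump n).le_one
  set H := ‖iteratedFDeriv ℝ 2 ρ X‖
  have hH : 0 ≤ H := norm_nonneg _
  set g := ‖fderiv ℝ u X‖
  have hg : 0 ≤ g := norm_nonneg _
  set U := |u X| * g
  have hU : 0 ≤ U := by positivity
  have hp0 : 0 < pd (Fin.last n) ρ X := lt_of_lt_of_le (by positivity) (h.le_pd_last hXd)
  have hpM := h.pd_last_le hXd
  set p := pd (Fin.last n) ρ X
  have ha := lowCut_mem ε (ρ X)
  -- Since ε ≤ 1/4, the lower transition ends at 2ε < 1, before the upper cutoff starts to decrease.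
  have hlow : lowCut' ε (ρ X) * highCut (ρ X) = lowCut' ε (ρ X) := by
    by_cases h1 : ρ X ≤ 1
    · rw [highCut_of_le h1, mul_one]
    · rw [lowCut'_of_gt hε (by linarith), zero_mul]
  have hlow0 := lowCut'_nonneg hε (ρ X)
  -- the upper cutoff
  have hhigh : -(χ * (lowCut ε (ρ X) * highCut' (ρ X) * p) * u X ^ 2) ≤
      2 * B * M * (slab φ ρ).indicator (fun X => u X ^ 2) X := by
    by_cases h1 : ρ X < 1
    · rw [highCut'_of_lt h1]
      have : 0 ≤ (slab φ ρ).indicator (fun X => u X ^ 2) X :=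
        indicator_nonneg (fun _ _ => sq_nonneg _) _
      simp only [mul_zero, zero_mul, neg_zero]
      positivity
    · have hsl : X ∈ slab φ ρ := ⟨hXd, by linarith [hX.2.1], not_lt.1 h1, by linarith [hX.2.2.2]⟩
      rw [indicator_of_mem hsl, highCut']
      have h2 := deriv_smoothTransition_nonneg (3 - 2 * ρ X)
      have h3 := hB (3 - 2 * ρ X)
      set d := deriv Real.smoothTransition (3 - 2 * ρ X)
      calc _ = 2 * ((χ * lowCut ε (ρ X)) * d * p) * u X ^ 2 := by ring
        _ ≤ 2 * (1 * B * M) * u X ^ 2 := by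
          gcongr
          exact mul_le_one₀ hχ1 ha.1 ha.2
        _ = _ := by ring
  -- the vertical coefficient
  have hco : 2 * (ρ X * (coeff φ ρ ε (Fin.last n) X * ∑ j, pd j u X ^ 2)) ≤
      2 * M ^ 3 * (n + 1) * (ρ X * g ^ 2) := by
    have h1 : coeff φ ρ ε (Fin.last n) X ≤ M ^ 3 := by
      have h4 := cutoff_mem (φ := φ) (ρ := ρ) (ε := ε) X
      have h2 := abs_dualGrad_le hM0 (h.le_pd_last hXd) (h.grad_le X hXd) (Fin.last n)
      rw [coeff]
      calc _ ≤ cutoff φ ρ ε X * M ^ 3 := mul_le_mul_of_nonneg_left ((le_abs_self _).trans h2) h4.1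
        _ ≤ 1 * M ^ 3 := mul_le_mul_of_nonneg_right h4.2 (by positivity)
        _ = _ := one_mul _
    have h2 : ∑ j, pd j u X ^ 2 ≤ (n + 1) * g ^ 2 := by
      refine (Finset.sum_le_card_nsmul _ _ (g ^ 2) fun j _ => ?_).trans (by simp)
      rw [← sq_abs]
      exact pow_le_pow_left₀ (abs_nonneg _) (abs_pd_le j u X) 2
    have h3 : 0 ≤ ∑ j, pd j u X ^ 2 := Finset.sum_nonneg fun j _ => sq_nonneg _
    calc _ ≤ 2 * (ρ X * (M ^ 3 * ((n + 1) * g ^ 2))) := by gcongr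
      _ = _ := by ring
  -- the error
  have herr : ρ X * |rellichErr u (coeff φ ρ ε) X| ≤ 6 * (n + 1) * (A₁ + A₂ + A₃) *
      (ρ X * (1 + H) * U + {X | ρ X ≤ 2 * ε}.indicator (fun X => |u X| * ‖fderiv ℝ u X‖) X) := by
    have h1 : ∀ i j, |pd i (coeff φ ρ ε j) X| ≤ A₁ * H + (A₂ + M ^ 4 * lowCut' ε (ρ X)) := by
      intro i j
      refine (h.abs_pd_coeff_le hφ.continuous hXd i j).trans (add_le_add le_rfl ?_)
      refine (mul_le_mul_of_nonneg_left (h.abs_pd_cutoff_le hφ.continuous hXd hε hB hB₁ i)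
        (by positivity)).trans (le_of_eq ?_)
      ring
    have h2 := abs_rellichErr_le (u := u) h1
    -- The derivative of the lower cutoff is of size 1/ε, but vanishes for ρ > 2ε, so the weight ρ
    -- compensates it. The result has no small factor; its smallness comes later from the thinness
    -- of the layer.
    have h3 : M ^ 4 * (ρ X * lowCut' ε (ρ X)) * U ≤
        A₃ * {X | ρ X ≤ 2 * ε}.indicator (fun X => |u X| * ‖fderiv ℝ u X‖) X := by
      by_cases h4 : ρ X ≤ 2 * ε
      · rw [indicator_of_mem (show X ∈ {X | ρ X ≤ 2 * ε} from h4)]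
        have h5 : ρ X * lowCut' ε (ρ X) ≤ 2 * B := by
          rw [lowCut', mul_div_assoc', div_le_iff₀ hε]
          have := mul_le_mul h4 (hB (ρ X / ε - 1)) (deriv_smoothTransition_nonneg _) (by positivity)
          linarith
        calc _ ≤ M ^ 4 * (2 * B) * U := by gcongr
          _ = A₃ * U := by simp only [A₃]; ring
      · rw [lowCut'_of_gt hε (not_le.1 h4), indicator_of_notMem (show X ∉ {X | ρ X ≤ 2 * ε} from h4)]
        simp
    have hI : 0 ≤ {X | ρ X ≤ 2 * ε}.indicator (fun X => |u X| * ‖fderiv ℝ u X‖) X :=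
      indicator_nonneg (fun _ _ => by positivity) _
    set I := {X | ρ X ≤ 2 * ε}.indicator (fun X => |u X| * ‖fderiv ℝ u X‖) X
    calc _ ≤ ρ X * (6 * (n + 1) * (A₁ * H + (A₂ + M ^ 4 * lowCut' ε (ρ X))) * U) := by gcongr
      _ = 6 * (n + 1) * (A₁ * (ρ X * H * U) + A₂ * (ρ X * U) +
            M ^ 4 * (ρ X * lowCut' ε (ρ X)) * U) := by ring
      _ ≤ 6 * (n + 1) * (A₁ * (ρ X * (1 + H) * U + I) + A₂ * (ρ X * (1 + H) * U + I) +
            A₃ * (ρ X * (1 + H) * U + I)) := by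
          have e1 : ρ X * H * U ≤ ρ X * (1 + H) * U + I := by
            have : 0 ≤ ρ X * U := by positivity
            nlinarith
          have e2 : ρ X * U ≤ ρ X * (1 + H) * U + I := by
            have : 0 ≤ ρ X * H * U := by positivity
            nlinarith
          have e3 : I ≤ ρ X * (1 + H) * U + I := by
            have : 0 ≤ ρ X * (1 + H) * U := by positivity
            linarith
          have e4 := h3.trans (mul_le_mul_of_nonneg_left e3 hA₃)
          refine mul_le_mul_of_nonneg_left (add_le_add (add_le_add ?_ ?_) e4) (by positivity)
          · exact mul_le_mul_of_nonneg_left e1 hA₁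
          · exact mul_le_mul_of_nonneg_left e2 hA₂
      _ = _ := by ring
  have hI : 0 ≤ {X | ρ X ≤ 2 * ε}.indicator (fun X => |u X| * ‖fderiv ℝ u X‖) X :=
    indicator_nonneg (fun _ _ => by positivity) _
  have hI2 : 0 ≤ (slab φ ρ).indicator (fun X => u X ^ 2) X :=
    indicator_nonneg (fun _ _ => sq_nonneg _) _
  have herr' : -(ρ X * rellichErr u (coeff φ ρ ε) X) ≤ ρ X * |rellichErr u (coeff φ ρ ε) X| := by
    rw [← mul_neg]
    exact mul_le_mul_of_nonneg_left (neg_le_abs _) hρ0.le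
  set I := {X | ρ X ≤ 2 * ε}.indicator (fun X => |u X| * ‖fderiv ℝ u X‖) X
  set I2 := (slab φ ρ).indicator (fun X => u X ^ 2) X
  have t1 : 0 ≤ ρ X * g ^ 2 := by positivity
  have t2 : 0 ≤ ρ X * (1 + H) * U := by positivity
  have k1 : 0 ≤ 2 * B * M := by positivity
  have k2 : 0 ≤ 2 * M ^ 3 * ((n : ℝ) + 1) := by positivity
  have k3 : 0 ≤ 6 * ((n : ℝ) + 1) * (A₁ + A₂ + A₃) := by positivity
  have final : 2 * B * M * I2 + 2 * M ^ 3 * (n + 1) * (ρ X * g ^ 2) +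
      6 * (n + 1) * (A₁ + A₂ + A₃) * (ρ X * (1 + H) * U + I) ≤
      (2 * B * M + 2 * M ^ 3 * (n + 1) + 6 * (n + 1) * (A₁ + A₂ + A₃)) *
        (I2 + ρ X * g ^ 2 + ρ X * (1 + H) * U + I) := by
    rw [add_mul, add_mul]
    refine add_le_add (add_le_add ?_ ?_) ?_ <;>
    exact mul_le_mul_of_nonneg_left (by linarith) (by assumption)
  rw [hlow]
  linarith
end AdaptedDistance

end

noncomputable section

open MeasureTheory Set
open scoped NNReal ENNReal

namespace AdaptedDistance

variable {n : ℕ} {φ : EuclideanSpace ℝ (Fin n) → ℝ} {L : ℝ≥0} {ρ : Space n → ℝ} {M ε : ℝ}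
  {X : Space n}

/-! ### The boundary layer -/

lemma volume_strip_le (hφ : Continuous φ) {A : Set (EuclideanSpace ℝ (Fin n))}
    (hA : MeasurableSet A) (t : ℝ) :
    volume {X : Space n | horiz X ∈ A ∧ height X - φ (horiz X) ∈ Ioc 0 t} ≤
      volume A * ENNReal.ofReal t := by
  have hm : MeasurableSet {X : Space n | horiz X ∈ A ∧ height X - φ (horiz X) ∈ Ioc 0 t} :=
    (continuous_horiz.measurable hA).inter
      ((continuous_height.sub (hφ.comp continuous_horiz)).measurable measurableSet_Ioc)
  rw [← lintegral_indicator_one hm, lintegral_space (measurable_one.indicator hm)]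
  have : ∀ x, ∫⁻ y, {X : Space n | horiz X ∈ A ∧ height X - φ (horiz X) ∈ Ioc 0 t}.indicator
      (1 : Space n → ℝ≥0∞) (pt x y) ≤ A.indicator (fun _ => ENNReal.ofReal t) x := by
    intro x
    by_cases hx : x ∈ A
    · rw [indicator_of_mem hx]
      have h1 : ∀ y, {X : Space n | horiz X ∈ A ∧ height X - φ (horiz X) ∈ Ioc 0 t}.indicator
          (1 : Space n → ℝ≥0∞) (pt x y) ≤ (Ioc (φ x) (φ x + t)).indicator 1 y := by
        intro y
        by_cases hy : pt x y ∈ {X : Space n | horiz X ∈ A ∧ height X - φ (horiz X) ∈ Ioc 0 t}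
        · have h2 : height (pt x y) - φ (horiz (pt x y)) ∈ Ioc 0 t := hy.2
          rw [horiz_pt, height_pt] at h2
          rw [indicator_of_mem hy, indicator_of_mem (show y ∈ Ioc (φ x) (φ x + t) from
            ⟨by linarith [h2.1], by linarith [h2.2]⟩)]
          rfl
        · rw [indicator_of_notMem hy]; exact zero_le
      refine (lintegral_mono h1).trans ?_
      rw [lintegral_indicator_one measurableSet_Ioc, Real.volume_Ioc, add_sub_cancel_left]
    · rw [indicator_of_notMem hx]
      refine le_of_eq ((lintegral_congr fun y => indicator_of_notMem (fun h => hx ?_) _).trans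
        lintegral_zero)
      simpa using h.1
  refine (lintegral_mono this).trans ?_
  rw [lintegral_indicator hA, lintegral_const, Measure.restrict_apply_univ, mul_comm]

/-- Passes from the pointwise bound to the integral one. If ∫ R is infinite there is nothing to
prove; otherwise R is integrable, ∫ (f + R) may be split, and the signed part f contributes zero. -/
lemma lintegral_le_of_le_add {α : Type*} [MeasurableSpace α] {μ : Measure α} {f P R : α → ℝ}
    {W : Set α} (hW : MeasurableSet W) (hf : Integrable f μ) (hf0 : ∫ x, f x ∂μ = 0)
    (hfW : ∀ x ∉ W, f x = 0) (hP : ∀ x ∈ W, 0 ≤ P x) (hR : ∀ x ∈ W, 0 ≤ R x)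
    (hRm : AEMeasurable R (μ.restrict W)) (hle : ∀ x ∈ W, P x ≤ f x + R x) :
    ∫⁻ x in W, ENNReal.ofReal (P x) ∂μ ≤ ∫⁻ x in W, ENNReal.ofReal (R x) ∂μ := by
  by_cases htop : ∫⁻ x in W, ENNReal.ofReal (R x) ∂μ = ∞
  · rw [htop]; exact le_top
  have hR0 : 0 ≤ᵐ[μ.restrict W] R := ae_restrict_of_forall_mem hW hR
  have hRi : Integrable R (μ.restrict W) :=
    ⟨hRm.aestronglyMeasurable, (hasFiniteIntegral_iff_ofReal hR0).2 (lt_top_iff_ne_top.2 htop)⟩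
  have hfi : Integrable f (μ.restrict W) := hf.restrict
  have hsum0 : 0 ≤ᵐ[μ.restrict W] fun x => f x + R x :=
    ae_restrict_of_forall_mem hW fun x hx => (hP x hx).trans (hle x hx)
  calc _ ≤ ∫⁻ x in W, ENNReal.ofReal (f x + R x) ∂μ :=
        setLIntegral_mono' hW fun x hx => ENNReal.ofReal_le_ofReal (hle x hx)
    _ = ENNReal.ofReal (∫ x in W, (f x + R x) ∂μ) :=
        (ofReal_integral_eq_lintegral_ofReal (hfi.add hRi) hsum0).symm
    _ = ENNReal.ofReal (∫ x in W, R x ∂μ) := by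
        rw [integral_add hfi hRi, setIntegral_eq_integral_of_forall_compl_eq_zero hfW, hf0, zero_add]
    _ = _ := ofReal_integral_eq_lintegral_ofReal hRi hR0

namespace IsAdaptedDistance

variable (h : IsAdaptedDistance φ M ρ)
include h

lemma measurableSet_slab (hφ : LipschitzWith L φ) : MeasurableSet (slab φ ρ) := by
  have : slab φ ρ = {X : Space n | X ∈ closure (domain φ) ∧ ‖horiz X‖ ≤ 3 ∧ ρ X ∈ Icc 1 3} := by
    ext X
    constructor
    · rintro ⟨h1, h2, h3, h4⟩
      exact ⟨subset_closure h1, h2, h3, h4⟩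
    · intro hX
      exact ⟨(h.core_subset hφ one_pos (t' := 4) (by norm_num) hX).1, hX.2.1, hX.2.2.1, hX.2.2.2⟩
  rw [this]
  exact (h.isCompact_core hφ 1 3).measurableSet

lemma pt_mem_closure_cylSection (hφ : LipschitzWith L φ) {x : EuclideanSpace ℝ (Fin n)} {t : ℝ}
    (hx : ‖x‖ < t) : pt x (φ x) ∈ closure (cylSection φ ρ t) := by
  have ht : 0 < t := (norm_nonneg x).trans_lt hx
  have h1 : Filter.Tendsto (fun s : ℝ => pt x (φ x + s)) (nhdsWithin 0 (Ioi 0))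
      (nhds (pt x (φ x))) := by
    have : Continuous (fun s : ℝ => pt x (φ x + s)) :=
      continuous_pt.comp (continuous_const.prodMk (continuous_const.add continuous_id))
    have := this.tendsto 0
    rw [add_zero] at this
    exact this.mono_left nhdsWithin_le_nhds
  refine mem_closure_of_tendsto h1 ?_
  have hM := h.pos
  filter_upwards [Ioo_mem_nhdsGT (show 0 < t / M by positivity)] with s hs
  have hd : pt x (φ x + s) ∈ domain φ := by
    rw [mem_domain, horiz_pt, height_pt]; linarith [hs.1]
  have hb := h.bounds hφ.continuous (mem_domain.1 hd).le
  refine ⟨hd, by rwa [horiz_pt], h.pos_of_mem hφ.continuous hd, hb.2.trans_lt ?_⟩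
  rw [horiz_pt, height_pt, add_sub_cancel_left]
  have := hs.2
  rw [lt_div_iff₀ hM] at this
  linarith

/-- Along a vertical line the integrand is the derivative of the lower cutoff composed with ρ, which
climbs from 0 to 1: the fundamental theorem of calculus gives mass 1 on a suitable segment. -/
lemma one_le_lintegral_lowCut' (hφ : LipschitzWith L φ) (hε : 0 < ε) (hεM : M ^ 2 * ε < 1)
    {x : EuclideanSpace ℝ (Fin n)} (hx : ‖x‖ ≤ 1) :
    1 ≤ ∫⁻ y, (cylSection φ ρ 2).indicator
      (fun X => ENNReal.ofReal (lowCut' ε (ρ X) * pd (Fin.last n) ρ X)) (pt x y) := by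
  have hM := h.one_le
  have hM0 := h.pos
  -- By comparability of ρ with the height, ρ ≤ ε at y₁ and ρ ≥ 2ε at y₂. The assumption M² ε < 1
  -- keeps ρ < 2 on the segment.
  set y₁ := φ x + ε / M
  set y₂ := φ x + 2 * M * ε
  have hεM' : 0 < ε / M := by positivity
  have hle : y₁ ≤ y₂ := by
    simp only [y₁, y₂]
    have : ε / M ≤ ε := div_le_self hε.le hM
    nlinarith
  have hdom : ∀ y ∈ Icc y₁ y₂, pt x y ∈ domain φ := fun y hy => by
    rw [mem_domain, horiz_pt, height_pt]
    have := hy.1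
    simp only [y₁] at this
    linarith
  have hb : ∀ y ∈ Icc y₁ y₂, 1 / M * (y - φ x) ≤ ρ (pt x y) ∧ ρ (pt x y) ≤ M * (y - φ x) := by
    intro y hy
    have := h.bounds hφ.continuous (mem_domain.1 (hdom y hy)).le
    rwa [horiz_pt, height_pt] at this
  have hcyl : ∀ y ∈ Icc y₁ y₂, pt x y ∈ cylSection φ ρ 2 := fun y hy => by
    refine ⟨hdom y hy, by rw [horiz_pt]; linarith, h.pos_of_mem hφ.continuous (hdom y hy), ?_⟩
    refine (hb y hy).2.trans_lt ?_
    have := hy.2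
    simp only [y₂] at this
    have : M * (y - φ x) ≤ M * (2 * M * ε) := by gcongr; linarith
    nlinarith
  have hline : ∀ y ∈ Icc y₁ y₂, HasDerivAt (fun y => lowCut ε (ρ (pt x y)))
      (lowCut' ε (ρ (pt x y)) * pd (Fin.last n) ρ (pt x y)) y := by
    intro y hy
    have h1 : HasDerivAt (fun y : ℝ => pt x y) (vert n) y := by
      have : HasDerivAt (fun t : ℝ => pt x 0 + (t - 0) • vert n) ((1 : ℝ) • vert n) y :=
        (((hasDerivAt_id y).sub_const 0).smul_const (vert n)).const_add _
      simp only [← pt_eq_add_smul_vert, one_smul] at this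
      exact this
    have h2 := (h.hasFDerivAt hφ.continuous (hdom y hy)).comp_hasDerivAt y h1
    have h3 := (hasDerivAt_lowCut ε (ρ (pt x y))).comp y h2
    rw [vert_eq_dir] at h3
    exact h3
  have hcont : ContinuousOn (fun y => lowCut' ε (ρ (pt x y)) * pd (Fin.last n) ρ (pt x y))
      (Icc y₁ y₂) := by
    have hp : ContinuousOn (fun y : ℝ => pt x y) (Icc y₁ y₂) :=
      (continuous_pt.comp (continuous_const.prodMk continuous_id)).continuousOn
    have hl : Continuous (lowCut' ε) :=
      ((Real.smoothTransition.contDiff.continuous_deriv (n := 1) le_rfl).comp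
        ((continuous_id.div_const ε).sub continuous_const)).div_const ε
    exact (hl.comp_continuousOn (h.contDiffOn.continuousOn.comp hp hdom)).mul
      ((contDiffOn_pd (isOpen_domain hφ.continuous) h.contDiffOn).continuousOn.comp hp hdom)
  have hint : ∫ y in y₁..y₂, lowCut' ε (ρ (pt x y)) * pd (Fin.last n) ρ (pt x y) = 1 := by
    rw [intervalIntegral.integral_eq_sub_of_hasDerivAt (f := fun y => lowCut ε (ρ (pt x y)))
      (by rwa [uIcc_of_le hle]) (by
        apply ContinuousOn.intervalIntegrable
        rwa [uIcc_of_le hle])]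
    have e1 := (hb y₁ (left_mem_Icc.2 hle)).2
    have e2 := (hb y₂ (right_mem_Icc.2 hle)).1
    simp only [y₁, y₂, add_sub_cancel_left] at e1 e2
    rw [lowCut_of_ge hε (by
      refine le_trans (le_of_eq ?_) e2
      field_simp), lowCut_of_le hε (by
      refine e1.trans (le_of_eq ?_)
      field_simp), sub_zero]
  have hnn : ∀ y ∈ Icc y₁ y₂, 0 ≤ lowCut' ε (ρ (pt x y)) * pd (Fin.last n) ρ (pt x y) :=
    fun y hy => mul_nonneg (lowCut'_nonneg hε _)
      ((by positivity : (0:ℝ) ≤ 1 / M).trans (h.le_pd_last (hdom y hy)))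
  calc (1 : ℝ≥0∞) = ENNReal.ofReal (∫ y in Ioc y₁ y₂,
          lowCut' ε (ρ (pt x y)) * pd (Fin.last n) ρ (pt x y)) := by
        rw [← intervalIntegral.integral_of_le hle, hint, ENNReal.ofReal_one]
    _ = ∫⁻ y in Ioc y₁ y₂, ENNReal.ofReal (lowCut' ε (ρ (pt x y)) * pd (Fin.last n) ρ (pt x y)) :=
        ofReal_integral_eq_lintegral_ofReal
          ((hcont.integrableOn_Icc).mono_set Ioc_subset_Icc_self)
          (ae_restrict_of_forall_mem measurableSet_Ioc fun y hy => hnn y (Ioc_subset_Icc_self hy))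
    _ = ∫⁻ y in Ioc y₁ y₂, (cylSection φ ρ 2).indicator
          (fun X => ENNReal.ofReal (lowCut' ε (ρ X) * pd (Fin.last n) ρ X)) (pt x y) :=
        setLIntegral_congr_fun measurableSet_Ioc fun y hy => by
          rw [indicator_of_mem (hcyl y (Ioc_subset_Icc_self hy))]
    _ ≤ _ := setLIntegral_le_lintegral _ _

lemma measurable_layer (hφ : LipschitzWith L φ) {u : Space n → ℝ}
    (hu : ContinuousOn u (cylSection φ ρ 2)) :
    Measurable ((cylSection φ ρ 2).indicator fun X =>
      ENNReal.ofReal (baseBump n (horiz X) * (lowCut' ε (ρ X) * pd (Fin.last n) ρ X) * u X ^ 2)) := by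
  have hU := h.isOpen_cylSection hφ.continuous 2
  have hUd : cylSection φ ρ 2 ⊆ domain φ := fun X hX => hX.1
  have hl : Continuous (lowCut' ε) :=
      ((Real.smoothTransition.contDiff.continuous_deriv (n := 1) le_rfl).comp
        ((continuous_id.div_const ε).sub continuous_const)).div_const ε
  have hc : ContinuousOn (fun X => ENNReal.ofReal
      (baseBump n (horiz X) * (lowCut' ε (ρ X) * pd (Fin.last n) ρ X) * u X ^ 2))
      (cylSection φ ρ 2) :=
    ENNReal.continuous_ofReal.comp_continuousOn
      (((((baseBump n).continuous.comp continuous_horiz).continuousOn).mul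
      ((hl.comp_continuousOn (h.contDiffOn.continuousOn.mono hUd)).mul
      ((contDiffOn_pd (isOpen_domain hφ.continuous) h.contDiffOn).continuousOn.mono hUd))).mul
      (hu.pow 2))
  classical
  rw [← piecewise_eq_indicator]
  exact hc.measurable_piecewise continuousOn_const hU.measurableSet

/-- The boundary value squared, less τ, is averaged against a vertical density of mass at least 1
concentrated on ρ ≤ 2ε, where `hτu` allows its replacement by u² at the interior point. Fubini then
gives an integral over the section. -/
lemma lintegral_bottom_le (hφ : LipschitzWith L φ) {u : Space n → ℝ} {τ : ℝ}
    (hu : ContinuousOn u (cylSection φ ρ 2)) (hε : 0 < ε) (hεM : M ^ 2 * ε < 1)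
    (hτu : ∀ X ∈ cylSection φ ρ 2, ρ X ≤ 2 * ε → u (pt (horiz X) (φ (horiz X))) ^ 2 ≤ u X ^ 2 + τ) :
    ∫⁻ x in Metric.closedBall 0 1, ENNReal.ofReal (u (pt x (φ x)) ^ 2) ≤
      (∫⁻ X in cylSection φ ρ 2, ENNReal.ofReal
        (baseBump n (horiz X) * (lowCut' ε (ρ X) * pd (Fin.last n) ρ X) * u X ^ 2)) +
      ENNReal.ofReal τ * volume (Metric.closedBall (0 : EuclideanSpace ℝ (Fin n)) 1) := by
  have hU := h.isOpen_cylSection hφ.continuous 2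
  set Q := (cylSection φ ρ 2).indicator fun X =>
      ENNReal.ofReal (baseBump n (horiz X) * (lowCut' ε (ρ X) * pd (Fin.last n) ρ X) * u X ^ 2)
    with hQ
  have hQm : Measurable Q := h.measurable_layer hφ hu
  have key : ∀ x ∈ Metric.closedBall (0 : EuclideanSpace ℝ (Fin n)) 1,
      ENNReal.ofReal (u (pt x (φ x)) ^ 2) ≤ (∫⁻ y, Q (pt x y)) + ENNReal.ofReal τ := by
    intro x hx
    rw [mem_closedBall_zero_iff] at hx
    have h1 := h.one_le_lintegral_lowCut' hφ hε hεM hx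
    have h2 : ENNReal.ofReal (u (pt x (φ x)) ^ 2 - τ) ≤ ∫⁻ y, Q (pt x y) := by
      calc _ = ENNReal.ofReal (u (pt x (φ x)) ^ 2 - τ) * 1 := (mul_one _).symm
        _ ≤ _ := mul_le_mul_right h1 _
        _ = ∫⁻ y, ENNReal.ofReal (u (pt x (φ x)) ^ 2 - τ) * (cylSection φ ρ 2).indicator
            (fun X => ENNReal.ofReal (lowCut' ε (ρ X) * pd (Fin.last n) ρ X)) (pt x y) :=
          (lintegral_const_mul' _ _ ENNReal.ofReal_ne_top).symm
        _ ≤ _ := by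
          refine lintegral_mono fun y => ?_
          by_cases hy : pt x y ∈ cylSection φ ρ 2
          · simp only [hQ, indicator_of_mem hy]
            have hp : 0 ≤ lowCut' ε (ρ (pt x y)) * pd (Fin.last n) ρ (pt x y) :=
              mul_nonneg (lowCut'_nonneg hε _)
                ((one_div_nonneg.2 h.pos.le).trans (h.le_pd_last hy.1))
            have hb : baseBump n (horiz (pt x y)) = 1 :=
              (baseBump n).one_of_mem_closedBall (by
                rw [horiz_pt, mem_closedBall_zero_iff]; exact hx)
            rw [hb, one_mul, ← ENNReal.ofReal_mul' hp]
            refine ENNReal.ofReal_le_ofReal ?_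
            by_cases hρ : ρ (pt x y) ≤ 2 * ε
            · have := hτu _ hy hρ
              rw [horiz_pt] at this
              rw [mul_comm]
              exact mul_le_mul_of_nonneg_left (by linarith) hp
            · rw [lowCut'_of_gt hε (not_le.1 hρ)]; simp
          · simp only [indicator_of_notMem hy, mul_zero]; exact zero_le
    calc _ = ENNReal.ofReal ((u (pt x (φ x)) ^ 2 - τ) + τ) := by rw [sub_add_cancel]
      _ ≤ _ := ENNReal.ofReal_add_le
      _ ≤ _ := by gcongr
  calc _ ≤ ∫⁻ x in Metric.closedBall 0 1, ((∫⁻ y, Q (pt x y)) + ENNReal.ofReal τ) :=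
        setLIntegral_mono' Metric.isClosed_closedBall.measurableSet key
    _ = (∫⁻ x in Metric.closedBall 0 1, (∫⁻ y, Q (pt x y))) + ENNReal.ofReal τ *
        volume (Metric.closedBall (0 : EuclideanSpace ℝ (Fin n)) 1) := by
        rw [lintegral_add_right _ measurable_const, lintegral_const, Measure.restrict_apply_univ]
    _ ≤ _ := by
        gcongr
        refine (setLIntegral_le_lintegral _ _).trans ?_
        rw [← lintegral_space hQm, hQ, lintegral_indicator hU.measurableSet]

end IsAdaptedDistance

end AdaptedDistance

end

noncomputable section

open MeasureTheory Set
open scoped NNReal ENNReal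

namespace AdaptedDistance

variable {n : ℕ} {φ : EuclideanSpace ℝ (Fin n) → ℝ} {L : ℝ≥0} {ρ : Space n → ℝ} {M ε : ℝ}
  {X : Space n}

/-! ### Surface measure -/

lemma measurableEmbedding_graph (hφ : Continuous φ) :
    MeasurableEmbedding fun x => pt x (φ x) := by
  refine Continuous.measurableEmbedding (continuous_pt.comp (continuous_id.prodMk hφ)) ?_
  intro x x' hx
  have := congrArg horiz hx
  simpa using this

lemma preimage_bottom (t : ℝ) :
    (fun x => pt x (φ x)) ⁻¹' bottom φ t = Metric.closedBall 0 t := by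
  ext x
  simp [bottom]

lemma lintegral_bottom (hφ : Continuous φ) (t : ℝ) (f : Space n → ℝ≥0∞) :
    ∫⁻ Q in bottom φ t, f Q ∂(surfaceMeasure φ) =
      ∫⁻ x, f (pt x (φ x)) ∂((volume.restrict (Metric.closedBall 0 t)).withDensity fun x =>
        ENNReal.ofReal (Real.sqrt (1 + ‖fderiv ℝ φ x‖ ^ 2))) := by
  rw [surfaceMeasure, (measurableEmbedding_graph hφ).restrict_map, preimage_bottom,
    (measurableEmbedding_graph hφ).lintegral_map,
    restrict_withDensity Metric.isClosed_closedBall.measurableSet]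

/-- The density of surface measure lies between 1 and √(1 + L²) at every point, including those
where φ is not differentiable and `fderiv` is zero by default; so surface integrals may be traded
for integrals in x. -/
lemma lintegral_bottom_le_mul (hφ : LipschitzWith L φ) (t : ℝ) (f : Space n → ℝ≥0∞) :
    ∫⁻ Q in bottom φ t, f Q ∂(surfaceMeasure φ) ≤
      ENNReal.ofReal √(1 + (L : ℝ) ^ 2) * ∫⁻ x in Metric.closedBall 0 t, f (pt x (φ x)) := by
  rw [lintegral_bottom hφ.continuous]
  have : (volume.restrict (Metric.closedBall 0 t)).withDensity (fun x =>
        ENNReal.ofReal (Real.sqrt (1 + ‖fderiv ℝ φ x‖ ^ 2))) ≤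
      (volume.restrict (Metric.closedBall 0 t)).withDensity fun _ =>
        ENNReal.ofReal √(1 + (L : ℝ) ^ 2) := by
    refine withDensity_mono (Filter.Eventually.of_forall fun x => ENNReal.ofReal_le_ofReal ?_)
    gcongr
    exact norm_fderiv_le_of_lipschitz ℝ hφ
  refine (lintegral_mono' this le_rfl).trans ?_
  rw [withDensity_const, lintegral_smul_measure, smul_eq_mul]

lemma le_lintegral_bottom (hφ : Continuous φ) (t : ℝ) (f : Space n → ℝ≥0∞) :
    ∫⁻ x in Metric.closedBall 0 t, f (pt x (φ x)) ≤
      ∫⁻ Q in bottom φ t, f Q ∂(surfaceMeasure φ) := by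
  rw [lintegral_bottom hφ]
  refine lintegral_mono' ?_ le_rfl
  conv_lhs => rw [← withDensity_one (μ := volume.restrict (Metric.closedBall
    (0 : EuclideanSpace ℝ (Fin n)) t))]
  refine withDensity_mono (Filter.Eventually.of_forall fun x => ?_)
  rw [Pi.one_apply, ENNReal.one_le_ofReal, Real.one_le_sqrt]
  nlinarith [sq_nonneg ‖fderiv ℝ φ x‖]

/-! ### Carleson measures attached to an adapted distance -/

lemma cube_eq_preimage (a : EuclideanSpace ℝ (Fin n)) (r : ℝ) :
    cube a r = (WithLp.ofLp : EuclideanSpace ℝ (Fin n) → _) ⁻¹'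
      (Icc (WithLp.ofLp a) (fun i => a i + r)) := by
  ext x
  simp only [cube, mem_ofPred_eq, mem_preimage, mem_Icc, Pi.le_def, forall_and]

lemma measurableSet_cube (a : EuclideanSpace ℝ (Fin n)) (r : ℝ) : MeasurableSet (cube a r) := by
  rw [cube_eq_preimage]
  exact (PiLp.volume_preserving_ofLp (Fin n)).measurable measurableSet_Icc

lemma volume_cube (a : EuclideanSpace ℝ (Fin n)) {r : ℝ} (hr : 0 ≤ r) :
    volume (cube a r) = ENNReal.ofReal (r ^ n) := by
  rw [cube_eq_preimage, (PiLp.volume_preserving_ofLp (Fin n)).measure_preimage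
    measurableSet_Icc.nullMeasurableSet, Real.volume_Icc_pi]
  simp [ENNReal.ofReal_pow hr]

namespace IsAdaptedDistance

variable (h : IsAdaptedDistance φ M ρ)
include h

lemma height_sub_le (hφ : LipschitzWith L φ) {t : ℝ} (hX : X ∈ domain φ) (hρ : ρ X ≤ t) :
    height X - φ (horiz X) ≤ M * t := by
  have := (h.bounds hφ.continuous (mem_domain.1 hX).le).1
  rw [one_div, inv_mul_le_iff₀ h.pos] at this
  exact this.trans (mul_le_mul_of_nonneg_left hρ h.pos.le)

lemma continuousOn_hessian (hφ : Continuous φ) :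
    ContinuousOn (fun X => ‖iteratedFDeriv ℝ 2 ρ X‖) (domain φ) := by
  have hU := isOpen_domain hφ
  have := (h.contDiffOn.continuousOn_iteratedFDerivWithin (m := 2) le_rfl hU.uniqueDiffOn).norm
  refine this.congr fun X hX => ?_
  simp only [iteratedFDerivWithin_of_isOpen 2 hU hX]

/-- The measure `ρ (1 + |∇²ρ|²) dX` on `Ω₂` is a Carleson measure. -/
lemma carleson_section (hφ : LipschitzWith L φ) (a : EuclideanSpace ℝ (Fin n)) {r : ℝ}
    (hr : 0 < r) :
    ((volume.restrict (cylSection φ ρ 2)).withDensity fun X =>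
      ENNReal.ofReal (ρ X * (1 + ‖iteratedFDeriv ℝ 2 ρ X‖ ^ 2)))
      (shift φ '' carlesonBox a r) ≤ ENNReal.ofReal (5 * M * r ^ n) := by
  have hU := h.isOpen_cylSection hφ.continuous 2
  have hUd : cylSection φ ρ 2 ⊆ domain φ := fun X hX => hX.1
  have hM := h.pos
  set S := shift φ '' carlesonBox a r with hS
  have hSm : MeasurableSet S := by
    have : S = {X : Space n | horiz X ∈ cube a r ∧ height X - φ (horiz X) ∈ Ioc 0 r} := by
      ext X; exact mem_shift_box
    rw [this]
    exact (continuous_horiz.measurable (measurableSet_cube a r)).inter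
      ((continuous_height.sub (hφ.continuous.comp continuous_horiz)).measurable measurableSet_Ioc)
  have hρm : AEMeasurable (fun X => ENNReal.ofReal (ρ X)) (volume.restrict (cylSection φ ρ 2)) :=
    ((h.contDiffOn.continuousOn.mono hUd).aemeasurable hU.measurableSet).ennreal_ofReal
  rw [withDensity_apply' _ S]
  calc _ ≤ ∫⁻ X in S, (ENNReal.ofReal (ρ X) + ENNReal.ofReal
          (ρ X * ‖iteratedFDeriv ℝ 2 ρ X‖ ^ 2)) ∂(volume.restrict (cylSection φ ρ 2)) := by
        refine lintegral_mono fun X => ?_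
        rw [mul_add, mul_one]
        exact ENNReal.ofReal_add_le
    _ = (∫⁻ X in S, ENNReal.ofReal (ρ X) ∂(volume.restrict (cylSection φ ρ 2))) +
          ∫⁻ X in S, ENNReal.ofReal (ρ X * ‖iteratedFDeriv ℝ 2 ρ X‖ ^ 2)
            ∂(volume.restrict (cylSection φ ρ 2)) := lintegral_add_left' hρm.restrict _
    -- In the first term ρ ≤ 2, and the height above the graph is at most 2M; this gives 4M. The
    -- second is the hypothesis on ρ. The summand 1 beside |∇²ρ|² is what absorbs the bounded
    -- derivatives of the cutoffs.
    _ ≤ ENNReal.ofReal (4 * M * r ^ n) + ENNReal.ofReal (M * r ^ n) := by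
        gcongr
        · rw [Measure.restrict_restrict hSm]
          calc _ ≤ ∫⁻ X in S ∩ cylSection φ ρ 2, ENNReal.ofReal 2 :=
                setLIntegral_mono' (hSm.inter hU.measurableSet) fun X hX =>
                  ENNReal.ofReal_le_ofReal hX.2.2.2.2.le
            _ = ENNReal.ofReal 2 * volume (S ∩ cylSection φ ρ 2) := by
                rw [lintegral_const, Measure.restrict_apply_univ]
            _ ≤ ENNReal.ofReal 2 * (volume (cube a r) * ENNReal.ofReal (M * 2)) := by
                gcongr
                refine (measure_mono fun X hX => ?_).trans
                  (volume_strip_le hφ.continuous (measurableSet_cube a r) (M * 2))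
                have h1 := mem_shift_box.1 hX.1
                exact ⟨h1.1, h1.2.1, h.height_sub_le hφ hX.2.1 hX.2.2.2.2.le⟩
            _ = _ := by
                rw [volume_cube a hr.le, ← ENNReal.ofReal_mul (by positivity),
                  ← ENNReal.ofReal_mul (by positivity)]
                congr 1; ring
        · refine le_trans ?_ (h.carleson a r hr)
          rw [hessianMeasure, withDensity_apply' _ S]
          exact lintegral_mono' (Measure.restrict_mono le_rfl (Measure.restrict_mono hUd le_rfl))
            le_rfl
    _ = _ := by
        rw [← ENNReal.ofReal_add (by positivity) (by positivity)]
        congr 1; ring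

end IsAdaptedDistance

lemma HolderOnWith.exists_bound {α : Type*} [PseudoMetricSpace α] {F : Type*}
    [NormedAddCommGroup F] {H γ : ℝ≥0} {f : α → F} {s : Set α} (hf : HolderOnWith H γ f s)
    (hs : Bornology.IsBounded s) : ∃ B : ℝ, 0 ≤ B ∧ ∀ x ∈ s, ‖f x‖ ≤ B := by
  have : Bornology.IsBounded (f '' s) := by
    rw [Metric.isBounded_iff_ediam_ne_top]
    exact ne_top_of_le_ne_top (ENNReal.mul_ne_top ENNReal.coe_ne_top
      (ENNReal.rpow_ne_top_of_nonneg γ.2 hs.ediam_ne_top)) hf.ediam_image_le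
  obtain ⟨B, hB⟩ := this.exists_norm_le
  exact ⟨|B|, abs_nonneg _, fun x hx => (hB _ (mem_image_of_mem f hx)).trans (le_abs_self _)⟩

end AdaptedDistance

end

noncomputable section

open MeasureTheory Set
open scoped NNReal ENNReal

namespace AdaptedDistance

variable {n : ℕ} {φ : EuclideanSpace ℝ (Fin n) → ℝ} {L : ℝ≥0} {ρ : Space n → ℝ} {M ε : ℝ}
  {X : Space n}

/-! ### The main inequality -/

namespace IsAdaptedDistance

variable (h : IsAdaptedDistance φ M ρ)
include h

lemma lintegral_gradient_le (hφ : LipschitzWith L φ) (u : Space n → ℝ) :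
    ∫⁻ X in cylSection φ ρ 2, ENNReal.ofReal (ρ X * ‖fderiv ℝ u X‖ ^ 2) ≤
      ENNReal.ofReal (2 * M * √(1 + (L : ℝ) ^ 2) + 2 + 2 * M) *
        areaIntegral (cylSection φ ρ 3) u := by
  have hU := h.isOpen_cylSection hφ.continuous 2
  have hM := h.pos
  have hD : 0 ≤ 2 * M * √(1 + (L : ℝ) ^ 2) + 2 + 2 * M := by positivity
  have hsub : cylSection φ ρ 2 ⊆ cylSection φ ρ 3 := fun X hX =>
    ⟨hX.1, by linarith [hX.2.1], hX.2.2.1, by linarith [hX.2.2.2]⟩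
  rw [areaIntegral, ← lintegral_const_mul' _ _ ENNReal.ofReal_ne_top]
  refine le_trans ?_ (lintegral_mono_set hsub)
  refine setLIntegral_mono' hU.measurableSet fun X hX => ?_
  rw [← mul_assoc, ← ENNReal.ofReal_mul hD, ENNReal.ofReal_mul hX.2.2.1.le,
    ENNReal.ofReal_pow (norm_nonneg _), ofReal_norm]
  gcongr
  exact h.le_delta_cylSection hφ hX

/-- Cauchy–Schwarz for the factors √ρ |∇u| and √ρ (1 + |∇²ρ|) |u|, with (1 + H)² ≤ 2 (1 + H²). The
second factor is arranged as an L² norm for a Carleson measure. -/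
lemma lintegral_cross_le (hφ : LipschitzWith L φ) {u : Space n → ℝ}
    (hu : ContDiffOn ℝ 2 u (cylSection φ ρ 2)) :
    ∫⁻ X in cylSection φ ρ 2, ENNReal.ofReal
        (ρ X * (1 + ‖iteratedFDeriv ℝ 2 ρ X‖) * (|u X| * ‖fderiv ℝ u X‖)) ≤
      (∫⁻ X in cylSection φ ρ 2, ENNReal.ofReal (ρ X * ‖fderiv ℝ u X‖ ^ 2)) ^ (1 / 2 : ℝ) *
      (2 * ∫⁻ X in cylSection φ ρ 2, ‖u X‖ₑ ^ 2
        ∂((volume.restrict (cylSection φ ρ 2)).withDensity fun X =>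
          ENNReal.ofReal (ρ X * (1 + ‖iteratedFDeriv ℝ 2 ρ X‖ ^ 2)))) ^ (1 / 2 : ℝ) := by
  have hU := h.isOpen_cylSection hφ.continuous 2
  have hUd : cylSection φ ρ 2 ⊆ domain φ := fun X hX => hX.1
  have hρc : ContinuousOn ρ (cylSection φ ρ 2) := h.contDiffOn.continuousOn.mono hUd
  have hHc := (h.continuousOn_hessian hφ.continuous).mono hUd
  have hgc : ContinuousOn (fun X => ‖fderiv ℝ u X‖) (cylSection φ ρ 2) :=
    (hu.continuousOn_fderiv_of_isOpen hU (by norm_num)).norm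
  set W := cylSection φ ρ 2
  have hWm := hU.measurableSet
  set H := fun X => ‖iteratedFDeriv ℝ 2 ρ X‖ with hH
  have h1 : AEMeasurable (fun X => ENNReal.ofReal (√(ρ X) * ‖fderiv ℝ u X‖))
      (volume.restrict W) :=
    ((hρc.sqrt.mul hgc).aemeasurable hWm).ennreal_ofReal
  have h2 : AEMeasurable (fun X => ENNReal.ofReal (√(ρ X) * (1 + H X) * |u X|))
      (volume.restrict W) :=
    (((hρc.sqrt.mul (continuousOn_const.add hHc)).mul hu.continuousOn.abs).aemeasurable
      hWm).ennreal_ofReal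
  have hd : AEMeasurable (fun X => ENNReal.ofReal (ρ X * (1 + H X ^ 2))) (volume.restrict W) :=
    ((hρc.mul (continuousOn_const.add (hHc.pow 2))).aemeasurable hWm).ennreal_ofReal
  have hum : AEMeasurable (fun X => ‖u X‖ₑ ^ 2) (volume.restrict W) :=
    ((hu.continuousOn.aemeasurable hWm).enorm).pow_const 2
  have e1 : ∫⁻ X in W, ENNReal.ofReal (ρ X * (1 + H X) * (|u X| * ‖fderiv ℝ u X‖)) =
      ∫⁻ X in W, ((fun X => ENNReal.ofReal (√(ρ X) * ‖fderiv ℝ u X‖)) *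
        (fun X => ENNReal.ofReal (√(ρ X) * (1 + H X) * |u X|))) X := by
    refine setLIntegral_congr_fun hWm fun X hX => ?_
    have := Real.mul_self_sqrt hX.2.2.1.le
    simp only [Pi.mul_apply]
    rw [← ENNReal.ofReal_mul (by positivity)]
    congr 1
    conv_lhs => rw [← this]
    ring
  have e2 : ∫⁻ X in W, (ENNReal.ofReal (√(ρ X) * ‖fderiv ℝ u X‖)) ^ (2 : ℝ) =
      ∫⁻ X in W, ENNReal.ofReal (ρ X * ‖fderiv ℝ u X‖ ^ 2) := by
    refine setLIntegral_congr_fun hWm fun X hX => ?_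
    rw [ENNReal.rpow_two, ← ENNReal.ofReal_pow (by positivity), mul_pow, Real.sq_sqrt hX.2.2.1.le]
  have e3 : ∫⁻ X in W, (ENNReal.ofReal (√(ρ X) * (1 + H X) * |u X|)) ^ (2 : ℝ) ≤
      2 * ∫⁻ X in W, ‖u X‖ₑ ^ 2
        ∂((volume.restrict W).withDensity fun X => ENNReal.ofReal (ρ X * (1 + H X ^ 2))) := by
    rw [restrict_withDensity hWm, Measure.restrict_restrict hWm, inter_self,
      lintegral_withDensity_eq_lintegral_mul₀ hd hum, ← lintegral_const_mul' _ _ ENNReal.ofNat_ne_top]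
    refine setLIntegral_mono' hWm fun X hX => ?_
    have hH0 : 0 ≤ H X := norm_nonneg _
    have hρ0 : 0 ≤ ρ X := hX.2.2.1.le
    simp only [Pi.mul_apply]
    rw [ENNReal.rpow_two, ← ENNReal.ofReal_pow (by positivity), mul_pow, mul_pow,
      Real.sq_sqrt hρ0, ENNReal.ofReal_mul (by positivity), Real.enorm_eq_ofReal_abs,
      ← ENNReal.ofReal_pow (abs_nonneg _), ← mul_assoc, ← ENNReal.ofReal_ofNat 2,
      ← ENNReal.ofReal_mul two_pos.le]
    gcongr ENNReal.ofReal ?_ * _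
    nlinarith [mul_nonneg hρ0 (sq_nonneg (1 - H X))]
  rw [e1]
  refine (ENNReal.lintegral_mul_le_Lp_mul_Lq _ (Real.HolderConjugate.two_two) h1 h2).trans ?_
  rw [e2]
  gcongr

/-- The limit of a vanishing boundary layer. Uniform continuity of u² up to the boundary and
boundedness of u and ∇u make all ε-dependent errors a multiple of an arbitrary τ; this multiple
depends on u, but drops out in the limit. -/
lemma lintegral_bottom_le_section (hφ : LipschitzWith L φ) {C : ℝ} (hC : 0 ≤ C) {u : Space n → ℝ}
    (hC' : ∀ ε : ℝ, 0 < ε → ε ≤ 1 / 4 → ∀ X ∈ cylSection φ ρ 2,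
      InnerProductSpace.HarmonicAt u X →
      baseBump n (horiz X) * (lowCut' ε (ρ X) * pd (Fin.last n) ρ X) * u X ^ 2 ≤
        ∑ i, pd i (rellich (cutoff φ ρ ε) ρ u (coeff φ ρ ε) i) X +
        C * ((slab φ ρ).indicator (fun X => u X ^ 2) X + ρ X * ‖fderiv ℝ u X‖ ^ 2 +
          ρ X * (1 + ‖iteratedFDeriv ℝ 2 ρ X‖) * (|u X| * ‖fderiv ℝ u X‖) +
          {X | ρ X ≤ 2 * ε}.indicator (fun X => |u X| * ‖fderiv ℝ u X‖) X))
    (hu : InnerProductSpace.HarmonicOnNhd u (cylSection φ ρ 3))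
    (huH : HolderUpToBoundary (cylSection φ ρ 3) u) :
    ∫⁻ x in Metric.closedBall 0 1, ENNReal.ofReal (u (pt x (φ x)) ^ 2) ≤
      ENNReal.ofReal C * ((∫⁻ X in slab φ ρ, ‖u X‖ₑ ^ 2) +
        (∫⁻ X in cylSection φ ρ 2, ENNReal.ofReal (ρ X * ‖fderiv ℝ u X‖ ^ 2)) +
        ∫⁻ X in cylSection φ ρ 2, ENNReal.ofReal
          (ρ X * (1 + ‖iteratedFDeriv ℝ 2 ρ X‖) * (|u X| * ‖fderiv ℝ u X‖))) := by
  have hU := h.isOpen_cylSection hφ.continuous 2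
  have hUd : cylSection φ ρ 2 ⊆ domain φ := fun X hX => hX.1
  have hsub : cylSection φ ρ 2 ⊆ cylSection φ ρ 3 := fun X hX =>
    ⟨hX.1, by linarith [hX.2.1], hX.2.2.1, by linarith [hX.2.2.2]⟩
  have hM := h.pos
  have hM1 := h.one_le
  obtain ⟨γ, hγ, Hc, hu0, hu1, -⟩ := huH
  have hbdd := h.isBounded_cylSection hφ 3
  obtain ⟨B₀, hB₀, hB₀u⟩ := HolderOnWith.exists_bound hu0 hbdd.closure
  obtain ⟨B₁, hB₁, hB₁u⟩ := HolderOnWith.exists_bound hu1 hbdd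
  have hu2 : ContDiffOn ℝ 2 u (cylSection φ ρ 2) := hu.contDiffOn.mono hsub
  have huc := hu0.continuousOn hγ
  have hunif : UniformContinuousOn (fun X => u X ^ 2) (closure (cylSection φ ρ 3)) :=
    hbdd.isCompact_closure.uniformContinuousOn_of_continuous (huc.pow 2)
  rw [Metric.uniformContinuousOn_iff] at hunif
  have hρc : ContinuousOn ρ (cylSection φ ρ 2) := h.contDiffOn.continuousOn.mono hUd
  have hHc := (h.continuousOn_hessian hφ.continuous).mono hUd
  have hgc : ContinuousOn (fun X => ‖fderiv ℝ u X‖) (cylSection φ ρ 2) :=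
    (hu2.continuousOn_fderiv_of_isOpen hU (by norm_num)).norm
  have huc2 : ContinuousOn u (cylSection φ ρ 2) := hu2.continuousOn
  set W := cylSection φ ρ 2 with hW
  have hWm := hU.measurableSet
  have hslab := h.measurableSet_slab hφ
  -- the estimate for a fixed width of the boundary layer
  set V₁ := volume (Metric.closedBall (0 : EuclideanSpace ℝ (Fin n)) 1) with hV₁
  set V₂ := volume (Metric.closedBall (0 : EuclideanSpace ℝ (Fin n)) 2) with hV₂
  set Z := ENNReal.ofReal C * (ENNReal.ofReal (B₀ * B₁) * (V₂ * ENNReal.ofReal (2 * M))) + V₁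
    with hZ
  have hV₁t : V₁ ≠ ∞ := measure_closedBall_lt_top.ne
  have hV₂t : V₂ ≠ ∞ := measure_closedBall_lt_top.ne
  have hZt : Z ≠ ∞ := by
    rw [hZ]; finiteness
  set I₁ := ∫⁻ X in slab φ ρ, ‖u X‖ₑ ^ 2
  set I₂ := ∫⁻ X in W, ENNReal.ofReal (ρ X * ‖fderiv ℝ u X‖ ^ 2)
  set I₃ := ∫⁻ X in W, ENNReal.ofReal
          (ρ X * (1 + ‖iteratedFDeriv ℝ 2 ρ X‖) * (|u X| * ‖fderiv ℝ u X‖))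
  have key : ∀ τ : ℝ, 0 < τ →
      ∫⁻ x in Metric.closedBall 0 1, ENNReal.ofReal (u (pt x (φ x)) ^ 2) ≤
        ENNReal.ofReal C * (I₁ + I₂ + I₃) + ENNReal.ofReal τ * Z := by
    intro τ hτ
    obtain ⟨δ, hδ, hδu⟩ := hunif τ hτ
    -- The bounds serve, in order: separated cutoffs, a layer of size O(τ), vertical segments inside
    -- the section, and layer points within δ of their feet, since their height is at most 2Mε.
    obtain ⟨ε, hε, hε1⟩ : ∃ ε : ℝ, 0 < ε ∧ ε < min (min (1 / 4) τ) (min (1 / M ^ 2) (δ / (2 * M))) :=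
      exists_between (by positivity)
    simp only [lt_min_iff] at hε1
    obtain ⟨⟨hε4, hετ⟩, hεM, hεδ⟩ := hε1
    have hlayer : ∀ X ∈ W, ρ X ≤ 2 * ε → u (pt (horiz X) (φ (horiz X))) ^ 2 ≤ u X ^ 2 + τ := by
      intro X hX hρX
      have h1 := h.pt_mem_closure_cylSection hφ (x := horiz X) (t := 3) (by linarith [hX.2.1])
      have h2 := h.height_sub_le hφ hX.1 hρX
      have hd : 0 < height X - φ (horiz X) := sub_pos.2 (mem_domain.1 hX.1)
      have h3 : dist (pt (horiz X) (φ (horiz X))) X < δ := by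
        conv_lhs => rw [← pt_horiz_height X]
        rw [horiz_pt, dist_eq_norm, ← pt_sub, sub_self]
        refine (norm_le_add _).trans_lt ?_
        rw [horiz_pt, height_pt, norm_zero, zero_add, abs_sub_comm, abs_of_pos hd]
        rw [lt_div_iff₀ (by positivity)] at hεδ
        linarith
      have h4 := hδu _ h1 X (subset_closure (hsub hX)) h3
      rw [Real.dist_eq] at h4
      linarith [(abs_lt.1 h4).2]
    have hεM' : M ^ 2 * ε < 1 := by
      rw [lt_div_iff₀ (by positivity)] at hεM
      linarith
    refine (h.lintegral_bottom_le hφ huc2 hε hεM' hlayer).trans ?_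
    have hmi := h.integral_rellich_eq_zero hφ hε hu2
    have hind : ∀ X, 0 ≤ {X | ρ X ≤ 2 * ε}.indicator (fun X => |u X| * ‖fderiv ℝ u X‖) X := fun X =>
      indicator_nonneg (fun _ _ => by positivity) _
    have hind2 : ∀ X, 0 ≤ (slab φ ρ).indicator (fun X => u X ^ 2) X := fun X =>
      indicator_nonneg (fun _ _ => sq_nonneg _) _
    have m1 : AEMeasurable ((slab φ ρ).indicator (fun X => u X ^ 2)) (volume.restrict W) :=
      ((huc2.pow 2).aemeasurable hWm).indicator hslab
    have m2 : AEMeasurable (fun X => ρ X * ‖fderiv ℝ u X‖ ^ 2) (volume.restrict W) :=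
      (hρc.mul (hgc.pow 2)).aemeasurable hWm
    have m3 : AEMeasurable (fun X => ρ X * (1 + ‖iteratedFDeriv ℝ 2 ρ X‖) *
        (|u X| * ‖fderiv ℝ u X‖)) (volume.restrict W) :=
      ((hρc.mul (continuousOn_const.add hHc)).mul (huc2.abs.mul hgc)).aemeasurable hWm
    have m4 : AEMeasurable ({X | ρ X ≤ 2 * ε}.indicator (fun X => |u X| * ‖fderiv ℝ u X‖))
        (volume.restrict W) :=
      ((huc2.abs.mul hgc).aemeasurable hWm).indicator₀
        (nullMeasurableSet_le (hρc.aemeasurable hWm) aemeasurable_const)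
    have hmain := lintegral_le_of_le_add (P := fun X =>
        baseBump n (horiz X) * (lowCut' ε (ρ X) * pd (Fin.last n) ρ X) * u X ^ 2)
      (R := fun X => C * ((slab φ ρ).indicator (fun X => u X ^ 2) X + ρ X * ‖fderiv ℝ u X‖ ^ 2 +
          ρ X * (1 + ‖iteratedFDeriv ℝ 2 ρ X‖) * (|u X| * ‖fderiv ℝ u X‖) +
          {X | ρ X ≤ 2 * ε}.indicator (fun X => |u X| * ‖fderiv ℝ u X‖) X))
      hWm hmi.1 hmi.2.1 hmi.2.2 (fun X hX => mul_nonneg (mul_nonneg (baseBump n).nonneg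
        (mul_nonneg (lowCut'_nonneg hε _)
          ((one_div_nonneg.2 hM.le).trans (h.le_pd_last hX.1)))) (sq_nonneg _))
      (fun X hX => by
        have := hind X
        have := hind2 X
        have := hX.2.2.1.le
        positivity)
      ((((m1.add m2).add m3).add m4).const_mul C)
      (fun X hX => hC' ε hε hε4.le X hX (hu X (hsub hX)))
    have hsplit : ∫⁻ X in W, ENNReal.ofReal (C * ((slab φ ρ).indicator (fun X => u X ^ 2) X +
        ρ X * ‖fderiv ℝ u X‖ ^ 2 +
          ρ X * (1 + ‖iteratedFDeriv ℝ 2 ρ X‖) * (|u X| * ‖fderiv ℝ u X‖) +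
          {X | ρ X ≤ 2 * ε}.indicator (fun X => |u X| * ‖fderiv ℝ u X‖) X)) ≤
        ENNReal.ofReal C * ((∫⁻ X in W, ENNReal.ofReal ((slab φ ρ).indicator (fun X => u X ^ 2) X)) +
        I₂ + I₃ + ∫⁻ X in W, ENNReal.ofReal
          ({X | ρ X ≤ 2 * ε}.indicator (fun X => |u X| * ‖fderiv ℝ u X‖) X)) := by
      rw [← lintegral_add_left' m1.ennreal_ofReal, ← lintegral_add_right' _ m3.ennreal_ofReal,
        ← lintegral_add_right' _ m4.ennreal_ofReal, ← lintegral_const_mul' _ _ ENNReal.ofReal_ne_top]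
      refine lintegral_mono fun X => ?_
      simp only
      rw [ENNReal.ofReal_mul hC]
      gcongr
      exact ENNReal.ofReal_add_le.trans (add_le_add (ENNReal.ofReal_add_le.trans
        (add_le_add ENNReal.ofReal_add_le le_rfl)) le_rfl)
    have hs1 : ∫⁻ X in W, ENNReal.ofReal ((slab φ ρ).indicator (fun X => u X ^ 2) X) ≤ I₁ := by
      calc _ = ∫⁻ X in W, (slab φ ρ).indicator (fun X => ‖u X‖ₑ ^ 2) X := by
            refine lintegral_congr fun X => ?_
            by_cases hX : X ∈ slab φ ρ
            · rw [indicator_of_mem hX, indicator_of_mem hX, Real.enorm_eq_ofReal_abs,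
                ← ENNReal.ofReal_pow (abs_nonneg _), sq_abs]
            · rw [indicator_of_notMem hX, indicator_of_notMem hX, ENNReal.ofReal_zero]
        _ ≤ ∫⁻ X, (slab φ ρ).indicator (fun X => ‖u X‖ₑ ^ 2) X := setLIntegral_le_lintegral _ _
        _ = I₁ := lintegral_indicator hslab _
    -- The integrand is bounded and supported in a strip of thickness 2Mε over |x| ≤ 2.
    have hs4 : ∫⁻ X in W, ENNReal.ofReal
          ({X | ρ X ≤ 2 * ε}.indicator (fun X => |u X| * ‖fderiv ℝ u X‖) X) ≤
        ENNReal.ofReal (B₀ * B₁) * (V₂ * ENNReal.ofReal (M * (2 * ε))) := by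
      set S := {X : Space n | horiz X ∈ Metric.closedBall 0 2 ∧
        height X - φ (horiz X) ∈ Ioc 0 (M * (2 * ε))}
      calc _ ≤ ∫⁻ X in W, S.indicator (fun _ => ENNReal.ofReal (B₀ * B₁)) X := by
            refine setLIntegral_mono' hWm fun X hX => ?_
            by_cases hXε : X ∈ {X | ρ X ≤ 2 * ε}
            · have hXS : X ∈ S := ⟨by rw [mem_closedBall_zero_iff]; exact hX.2.1.le,
                sub_pos.2 (mem_domain.1 hX.1), h.height_sub_le hφ hX.1 hXε⟩
              rw [indicator_of_mem hXε, indicator_of_mem hXS]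
              refine ENNReal.ofReal_le_ofReal (mul_le_mul ?_ ?_ (norm_nonneg _) hB₀)
              · exact hB₀u X (subset_closure (hsub hX))
              · exact hB₁u X (hsub hX)
            · rw [indicator_of_notMem hXε, ENNReal.ofReal_zero]; exact zero_le
        _ ≤ ∫⁻ X, S.indicator (fun _ => ENNReal.ofReal (B₀ * B₁)) X :=
            setLIntegral_le_lintegral _ _
        _ ≤ ∫⁻ X in S, ENNReal.ofReal (B₀ * B₁) := lintegral_indicator_le _ _
        _ = ENNReal.ofReal (B₀ * B₁) * volume S := by
            rw [lintegral_const, Measure.restrict_apply_univ]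
        _ ≤ _ := by
            gcongr
            exact volume_strip_le hφ.continuous Metric.isClosed_closedBall.measurableSet _
    calc _ ≤ ENNReal.ofReal C * (I₁ + I₂ + I₃ +
          ENNReal.ofReal (B₀ * B₁) * (V₂ * ENNReal.ofReal (M * (2 * ε)))) +
          ENNReal.ofReal τ * V₁ := by
          gcongr
          refine hmain.trans (hsplit.trans ?_)
          gcongr
      _ ≤ ENNReal.ofReal C * (I₁ + I₂ + I₃ +
          ENNReal.ofReal (B₀ * B₁) * (V₂ * (ENNReal.ofReal (2 * M) * ENNReal.ofReal τ))) +
          ENNReal.ofReal τ * V₁ := by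
          rw [← ENNReal.ofReal_mul (by positivity)]
          gcongr ENNReal.ofReal C * (I₁ + I₂ + I₃ +
            ENNReal.ofReal (B₀ * B₁) * (V₂ * ENNReal.ofReal ?_)) + ENNReal.ofReal τ * V₁
          nlinarith
      _ = _ := by rw [hZ]; ring
  refine ENNReal.le_of_forall_pos_le_add fun δ hδ _ => ?_
  have h1 := key (δ / (Z.toReal + 1)) (by positivity)
  refine h1.trans ?_
  gcongr
  calc _ = ENNReal.ofReal (δ / (Z.toReal + 1)) * ENNReal.ofReal Z.toReal := by
        rw [ENNReal.ofReal_toReal hZt]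
    _ = ENNReal.ofReal (δ / (Z.toReal + 1) * Z.toReal) :=
        (ENNReal.ofReal_mul (by positivity)).symm
    _ ≤ ENNReal.ofReal δ := by
        refine ENNReal.ofReal_le_ofReal ?_
        rw [div_mul_eq_mul_div, div_le_iff₀ (by positivity)]
        exact mul_le_mul_of_nonneg_left (by linarith) δ.2
    _ = δ := ENNReal.ofReal_coe_nnreal

end IsAdaptedDistance

/-- The main inequality, for a given adapted distance. -/
lemma exists_main_bound (n : ℕ) (L : ℝ≥0) (M κ : ℝ) (hκ : √(1 + (L : ℝ) ^ 2) < κ) :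
    ∃ C : ℝ≥0, ∀ φ : EuclideanSpace ℝ (Fin n) → ℝ, LipschitzWith L φ →
        ∀ ρ : Space n → ℝ, IsAdaptedDistance φ M ρ →
        ∀ u : Space n → ℝ,
          InnerProductSpace.HarmonicOnNhd u (cylSection φ ρ 3) →
          HolderUpToBoundary (cylSection φ ρ 3) u →
          ∫⁻ Q in bottom φ 1, ‖u Q‖ₑ ^ 2 ∂(surfaceMeasure φ) ≤
            C * (areaIntegral (cylSection φ ρ 3) u +
              areaIntegral (cylSection φ ρ 3) u ^ (1 / 2 : ℝ) *
                (∫⁻ Q in bottom φ 2,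
                  maximal (domain φ) κ
                    ((cylSection φ ρ 2).indicator u) Q ^ 2
                    ∂(surfaceMeasure φ)) ^ (1 / 2 : ℝ) +
              ∫⁻ X in slab φ ρ, ‖u X‖ₑ ^ 2) := by
  -- For smaller M there is no adapted distance at all, because 1/M ≤ ∂_yρ ≤ M.
  by_cases hM : 1 ≤ M
  swap
  · exact ⟨0, fun φ _ ρ h => absurd h.one_le hM⟩
  have hM0 : 0 < M := by linarith
  obtain ⟨C₀, hC₀, hpt⟩ := exists_pointwise_bound n hM
  -- On the section ρ < 2, so heights above the graph are at most 2M.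
  obtain ⟨C₁, hC₁⟩ := carleson_embedding (n := n) hκ (h := M * 2) (by positivity)
  set s := ENNReal.ofReal √(1 + (L : ℝ) ^ 2) with hs
  set D := ENNReal.ofReal (2 * M * √(1 + (L : ℝ) ^ 2) + 2 + 2 * M) with hD
  set E := 2 * ((C₁ : ℝ≥0∞) * ENNReal.ofReal (5 * M)) with hE
  set T : ℝ≥0∞ := s * ENNReal.ofReal C₀ * (1 + D + D ^ (1 / 2 : ℝ) * E ^ (1 / 2 : ℝ)) with hT
  have hEt : E ≠ ∞ := by rw [hE]; finiteness
  have hDh : D ^ (1 / 2 : ℝ) ≠ ∞ :=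
    ENNReal.rpow_ne_top_of_nonneg (by norm_num) ENNReal.ofReal_ne_top
  have hEh : E ^ (1 / 2 : ℝ) ≠ ∞ := ENNReal.rpow_ne_top_of_nonneg (by norm_num) hEt
  have hTt : T ≠ ∞ := by rw [hT]; finiteness
  refine ⟨T.toNNReal, fun φ hφ ρ h u hu huH => ?_⟩
  rw [ENNReal.coe_toNNReal hTt]
  have hsub : cylSection φ ρ 2 ⊆ cylSection φ ρ 3 := fun X hX =>
    ⟨hX.1, by linarith [hX.2.1], hX.2.2.1, by linarith [hX.2.2.2]⟩
  have hU := h.isOpen_cylSection hφ.continuous 2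
  have hu2 : ContDiffOn ℝ 2 u (cylSection φ ρ 2) := hu.contDiffOn.mono hsub
  set A := areaIntegral (cylSection φ ρ 3) u
  set N := ∫⁻ Q in bottom φ 2, maximal (domain φ) κ ((cylSection φ ρ 2).indicator u) Q ^ 2
    ∂(surfaceMeasure φ)
  set K := ∫⁻ X in slab φ ρ, ‖u X‖ₑ ^ 2
  have h1 := h.lintegral_bottom_le_section hφ hC₀ (hpt φ ρ L hφ h u) hu huH
  have h2 := h.lintegral_gradient_le hφ u
  have h3 := h.lintegral_cross_le hφ hu2
  have h4 : ∫⁻ X in cylSection φ ρ 2, ‖u X‖ₑ ^ 2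
        ∂((volume.restrict (cylSection φ ρ 2)).withDensity fun X =>
          ENNReal.ofReal (ρ X * (1 + ‖iteratedFDeriv ℝ 2 ρ X‖ ^ 2))) ≤
      C₁ * ENNReal.ofReal (5 * M) * N := by
    refine (hC₁ φ hφ _ (5 * M) (by positivity) (fun a r hr => h.carleson_section hφ a hr)
      (cylSection φ ρ 2) hU.measurableSet (fun X hX => ⟨hX.1, hX.2.1.le,
        h.height_sub_le hφ hX.1 hX.2.2.2.le⟩) u
      (hu2.continuousOn.aemeasurable hU.measurableSet) ?_).trans ?_
    · obtain ⟨γ, -, Hc, hu0, -⟩ := huH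
      obtain ⟨B₀, -, hB₀u⟩ := HolderOnWith.exists_bound hu0 (h.isBounded_cylSection hφ 3).closure
      exact ⟨B₀, fun X hX => hB₀u X (subset_closure (hsub hX))⟩
    · gcongr
      exact le_lintegral_bottom hφ.continuous 2 fun Q =>
        maximal (domain φ) κ ((cylSection φ ρ 2).indicator u) Q ^ 2
  have h5 : ∫⁻ X in cylSection φ ρ 2, ENNReal.ofReal
        (ρ X * (1 + ‖iteratedFDeriv ℝ 2 ρ X‖) * (|u X| * ‖fderiv ℝ u X‖)) ≤
      (D ^ (1 / 2 : ℝ) * E ^ (1 / 2 : ℝ)) * (A ^ (1 / 2 : ℝ) * N ^ (1 / 2 : ℝ)) := by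
    refine h3.trans ?_
    calc _ ≤ (D * A) ^ (1 / 2 : ℝ) * (E * N) ^ (1 / 2 : ℝ) := by
          rw [hE, mul_assoc 2]
          gcongr
      _ = _ := by
          rw [ENNReal.mul_rpow_of_nonneg _ _ (by norm_num),
            ENNReal.mul_rpow_of_nonneg _ _ (by norm_num)]
          ring
  calc _ ≤ s * ∫⁻ x in Metric.closedBall 0 1, ‖u (pt x (φ x))‖ₑ ^ 2 :=
        lintegral_bottom_le_mul hφ 1 fun Q => ‖u Q‖ₑ ^ 2
    _ = s * ∫⁻ x in Metric.closedBall 0 1, ENNReal.ofReal (u (pt x (φ x)) ^ 2) := by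
        congr 1
        refine lintegral_congr fun x => ?_
        rw [Real.enorm_eq_ofReal_abs, ← ENNReal.ofReal_pow (abs_nonneg _), sq_abs]
    _ ≤ s * (ENNReal.ofReal C₀ * (K + D * A +
          (D ^ (1 / 2 : ℝ) * E ^ (1 / 2 : ℝ)) * (A ^ (1 / 2 : ℝ) * N ^ (1 / 2 : ℝ)))) := by
        gcongr
        exact h1.trans (by gcongr)
    _ ≤ s * (ENNReal.ofReal C₀ * ((1 + D + D ^ (1 / 2 : ℝ) * E ^ (1 / 2 : ℝ)) *
          (A + A ^ (1 / 2 : ℝ) * N ^ (1 / 2 : ℝ) + K))) := by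
        gcongr s * (ENNReal.ofReal C₀ * ?_)
        set k := D ^ (1 / 2 : ℝ) * E ^ (1 / 2 : ℝ)
        set b := A ^ (1 / 2 : ℝ) * N ^ (1 / 2 : ℝ)
        calc K + D * A + k * b = 1 * K + D * A + k * b := by rw [one_mul]
          _ ≤ (1 + D + k) * K + (1 + D + k) * A + (1 + D + k) * b := by
              gcongr
              · rw [add_assoc]; exact le_self_add
              · exact le_add_right le_add_self
              · exact le_add_self
          _ = _ := by ring
    _ = _ := by rw [hT]; ring

end AdaptedDistance

end

noncomputable section

open MeasureTheory Set
open scoped NNReal ENNReal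

namespace AdaptedDistance

/-! ### A square function estimate -/

section Schur

variable {α β : Type*} [MeasurableSpace α] [MeasurableSpace β] {μ : Measure α} {ν : Measure β}

lemma integrable_of_abs_le {γ : Type*} [MeasurableSpace γ] {τ : Measure γ} [IsFiniteMeasure τ]
    {f : γ → ℝ} {D : ℝ} (hf : Measurable f) (hD : ∀ x, |f x| ≤ D) : Integrable f τ :=
  Integrable.of_bound hf.aestronglyMeasurable _ (Filter.Eventually.of_forall hD)

lemma abs_integral_le {γ : Type*} [MeasurableSpace γ] {τ : Measure γ} [IsFiniteMeasure τ]
    {f : γ → ℝ} {D : ℝ} (hD : ∀ x, |f x| ≤ D) : |∫ x, f x ∂τ| ≤ D * τ.real univ := by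
  rw [← Real.norm_eq_abs]
  exact norm_integral_le_of_norm_le_const (Filter.Eventually.of_forall hD)

/-- An `L²` bound for an integral operator `T`, from Schur's test for `T Tᵀ`. -/
lemma integral_sq_le_of_schur [IsFiniteMeasure μ] [IsFiniteMeasure ν] {k : α → β → ℝ} {b : β → ℝ}
    (hk : Measurable (Function.uncurry k)) (hb : Measurable b) {B B' : ℝ}
    (hkB : ∀ p y, |k p y| ≤ B) (hbB : ∀ y, |b y| ≤ B') {C : ℝ} (hC : 0 < C)
    (hS : ∀ᵐ p ∂μ, ∫ p', |∫ y, k p y * k p' y ∂ν| ∂μ ≤ C) :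
    ∫ p, (∫ y, k p y * b y ∂ν) ^ 2 ∂μ ≤ C * ∫ y, b y ^ 2 ∂ν := by
  set H : α → ℝ := fun p => ∫ y, k p y * b y ∂ν with hH
  set K : α × α → ℝ := fun z => ∫ y, k z.1 y * k z.2 y ∂ν with hK
  set W : β → ℝ := fun y => ∫ p, k p y * H p ∂μ with hW
  have hkb : Measurable (Function.uncurry fun p y => k p y * b y) :=
    hk.mul (hb.comp measurable_snd)
  have hHm : Measurable H := hkb.stronglyMeasurable.integral_prod_right.measurable
  have hkk : Measurable (Function.uncurry fun (z : α × α) y => k z.1 y * k z.2 y) :=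
    (hk.comp ((measurable_fst.comp measurable_fst).prodMk measurable_snd)).mul
      (hk.comp ((measurable_snd.comp measurable_fst).prodMk measurable_snd))
  have hKm : Measurable K := hkk.stronglyMeasurable.integral_prod_right.measurable
  have hkH : Measurable (Function.uncurry fun y p => k p y * H p) :=
    (hk.comp measurable_swap).mul (hHm.comp measurable_snd)
  have hWm : Measurable W := hkH.stronglyMeasurable.integral_prod_right.measurable
  -- everything is bounded
  obtain ⟨BH, hBH⟩ : ∃ BH, ∀ p, |H p| ≤ BH := by
    refine ⟨B * B' * ν.real univ, fun p =>
      abs_integral_le fun y => ?_⟩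
    rw [abs_mul]
    exact mul_le_mul (hkB p y) (hbB y) (abs_nonneg _) ((abs_nonneg _).trans (hkB p y))
  obtain ⟨BK, hBK⟩ : ∃ BK, ∀ z, |K z| ≤ BK := by
    refine ⟨B * B * ν.real univ, fun z =>
      abs_integral_le fun y => ?_⟩
    rw [abs_mul]
    exact mul_le_mul (hkB _ y) (hkB _ y) (abs_nonneg _) ((abs_nonneg _).trans (hkB z.1 y))
  obtain ⟨BW, hBW⟩ : ∃ BW, ∀ y, |W y| ≤ BW := by
    refine ⟨B * BH * μ.real univ, fun y =>
      abs_integral_le fun p => ?_⟩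
    rw [abs_mul]
    exact mul_le_mul (hkB p y) (hBH p) (abs_nonneg _) ((abs_nonneg _).trans (hkB p y))
  have mulb : ∀ {x y D D' : ℝ}, |x| ≤ D → |y| ≤ D' → |x * y| ≤ D * D' := fun hx hy => by
    rw [abs_mul]
    exact mul_le_mul hx hy (abs_nonneg _) ((abs_nonneg _).trans hx)
  set I := ∫ p, H p ^ 2 ∂μ with hI
  have hI0 : 0 ≤ I := integral_nonneg fun p => sq_nonneg _
  have hH2 : Integrable (fun p => H p ^ 2) μ :=
    integrable_of_abs_le (hHm.pow_const 2) (D := BH * BH) fun p => by rw [sq]; exact mulb (hBH p) (hBH p)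
  -- duality
  have e1 : I = ∫ y, b y * W y ∂ν := by
    have h1 : I = ∫ p, ∫ y, k p y * b y * H p ∂ν ∂μ := by
      refine integral_congr_ae (Filter.Eventually.of_forall fun p => ?_)
      simp only
      rw [integral_mul_const, sq]
    rw [h1, integral_integral_swap]
    · refine integral_congr_ae (Filter.Eventually.of_forall fun y => ?_)
      simp only [hW]
      rw [← integral_const_mul]
      exact integral_congr_ae (Filter.Eventually.of_forall fun p => by ring_nf)
    · refine integrable_of_abs_le (hkb.mul (hHm.comp measurable_fst)) (D := B * B' * BH) ?_
      rintro ⟨p, y⟩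
      exact mulb (mulb (hkB p y) (hbB y)) (hBH p)
  -- the `T Tᵀ` kernel
  have e2 : ∫ y, W y ^ 2 ∂ν = ∫ z, H z.1 * H z.2 * K z ∂(μ.prod μ) := by
    have h1 : ∀ y, W y ^ 2 = ∫ z, (k z.1 y * H z.1) * (k z.2 y * H z.2) ∂(μ.prod μ) := fun y => by
      rw [sq, integral_prod_mul (fun p => k p y * H p) (fun p => k p y * H p)]
    simp only [h1]
    rw [integral_integral_swap]
    · refine integral_congr_ae (Filter.Eventually.of_forall fun z => ?_)
      simp only [hK]
      rw [← integral_const_mul]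
      exact integral_congr_ae (Filter.Eventually.of_forall fun y => by ring_nf)
    · refine integrable_of_abs_le (D := (B * BH) * (B * BH)) ?_ ?_
      · exact ((hk.comp ((measurable_fst.comp measurable_snd).prodMk measurable_fst)).mul
          (hHm.comp (measurable_fst.comp measurable_snd))).mul
          ((hk.comp ((measurable_snd.comp measurable_snd).prodMk measurable_fst)).mul
          (hHm.comp (measurable_snd.comp measurable_snd)))
      · rintro ⟨y, z⟩
        exact mulb (mulb (hkB _ y) (hBH _)) (mulb (hkB _ y) (hBH _))
  have hK1 : Integrable (fun z : α × α => |K z| * H z.1 ^ 2) (μ.prod μ) :=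
    integrable_of_abs_le (hKm.abs.mul ((hHm.comp measurable_fst).pow_const 2)) (D := BK * (BH * BH)) fun z =>
      mulb (by rw [abs_abs]; exact hBK z) (by rw [sq]; exact mulb (hBH _) (hBH _))
  have hK2 : Integrable (fun z : α × α => |K z| * H z.2 ^ 2) (μ.prod μ) :=
    integrable_of_abs_le (hKm.abs.mul ((hHm.comp measurable_snd).pow_const 2)) (D := BK * (BH * BH)) fun z =>
      mulb (by rw [abs_abs]; exact hBK z) (by rw [sq]; exact mulb (hBH _) (hBH _))
  have s1 : ∫ z, |K z| * H z.1 ^ 2 ∂(μ.prod μ) ≤ C * I := by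
    rw [integral_prod _ hK1, hI, ← integral_const_mul]
    refine integral_mono_ae hK1.integral_prod_left (hH2.const_mul C) ?_
    filter_upwards [hS] with p hp
    rw [integral_mul_const]
    exact mul_le_mul_of_nonneg_right hp (sq_nonneg _)
  have s2 : ∫ z, |K z| * H z.2 ^ 2 ∂(μ.prod μ) ≤ C * I := by
    rw [← integral_prod_swap]
    refine le_trans (le_of_eq ?_) s1
    refine integral_congr_ae (Filter.Eventually.of_forall fun z => ?_)
    simp only [hK, Prod.fst_swap, Prod.snd_swap]
    congr 2
    exact integral_congr_ae (Filter.Eventually.of_forall fun y => by ring_nf)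
  -- Schur's test: |H H' K| ≤ ½ |K| (H² + H'²), and since K is symmetric the row bound controls both
  -- halves.
  have e3 : ∫ y, W y ^ 2 ∂ν ≤ C * I := by
    rw [e2]
    have h1 : ∫ z, H z.1 * H z.2 * K z ∂(μ.prod μ) ≤
        ∫ z, (1 / 2) * (|K z| * H z.1 ^ 2 + |K z| * H z.2 ^ 2) ∂(μ.prod μ) := by
      refine integral_mono ?_ ((hK1.add hK2).const_mul _) fun z => ?_
      · exact integrable_of_abs_le (((hHm.comp measurable_fst).mul (hHm.comp measurable_snd)).mul hKm)
          (D := BH * BH * BK) fun z => mulb (mulb (hBH _) (hBH _)) (hBK z)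
      · have h2 : H z.1 * H z.2 * K z ≤ |H z.1 * H z.2| * |K z| := by
          rw [← abs_mul]; exact le_abs_self _
        have h3 : |H z.1 * H z.2| ≤ (1 / 2) * (H z.1 ^ 2 + H z.2 ^ 2) := by
          rw [abs_le]
          constructor <;> nlinarith [sq_nonneg (H z.1 - H z.2), sq_nonneg (H z.1 + H z.2)]
        nlinarith [mul_le_mul_of_nonneg_right h3 (abs_nonneg (K z))]
    rw [integral_const_mul, integral_add hK1 hK2] at h1
    linarith
  have i1 : Integrable (fun y => b y ^ 2) ν :=
    integrable_of_abs_le (hb.pow_const 2) (D := B' * B') fun y => by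
      rw [sq]; exact mulb (hbB y) (hbB y)
  have i2 : Integrable (fun y => W y ^ 2) ν :=
    integrable_of_abs_le (hWm.pow_const 2) (D := BW * BW) fun y => by
      rw [sq]; exact mulb (hBW y) (hBW y)
  -- The weights are chosen so that the W term contributes at most I/2, which is absorbed on the
  -- left.
  have e4 : ∫ y, b y * W y ∂ν ≤ ∫ y, (C / 2 * b y ^ 2 + 1 / (2 * C) * W y ^ 2) ∂ν := by
    refine integral_mono (integrable_of_abs_le (hb.mul hWm) (D := B' * BW) fun y => mulb (hbB y) (hBW y))
      ((i1.const_mul _).add (i2.const_mul _)) fun y => ?_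
    have h2 : 0 ≤ (C * b y - W y) ^ 2 / (2 * C) := by positivity
    have h3 : (C * b y - W y) ^ 2 / (2 * C) =
        C / 2 * b y ^ 2 + 1 / (2 * C) * W y ^ 2 - b y * W y := by
      field_simp; ring
    simp only
    linarith
  rw [integral_add (i1.const_mul _) (i2.const_mul _), integral_const_mul, integral_const_mul,
    ← e1] at e4
  have e5 : 1 / (2 * C) * ∫ y, W y ^ 2 ∂ν ≤ I / 2 := by
    calc _ ≤ 1 / (2 * C) * (C * I) := by gcongr
      _ = I / 2 := by field_simp
  linarith

end Schur

end AdaptedDistance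

end

/-! ### Almost orthogonality of dilations. -/

noncomputable section

open MeasureTheory Set
open scoped NNReal ENNReal

namespace AdaptedDistance

section SquareFunction

variable {n : ℕ} {ψ : EuclideanSpace ℝ (Fin n) → ℝ} {s t : ℝ}

/-- The `L¹`-normalized dilation `t⁻ⁿ ψ (z / t)`. -/
def dilate (ψ : EuclideanSpace ℝ (Fin n) → ℝ) (t : ℝ) (z : EuclideanSpace ℝ (Fin n)) : ℝ :=
  (t ^ n)⁻¹ * ψ (t⁻¹ • z)

lemma integral_dilate (ψ : EuclideanSpace ℝ (Fin n) → ℝ) (ht : 0 < t) :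
    ∫ z, dilate ψ t z = ∫ z, ψ z := by
  simp only [dilate]
  rw [integral_const_mul, Measure.integral_comp_inv_smul, finrank_euclideanSpace_fin,
    abs_of_pos (by positivity), smul_eq_mul, ← mul_assoc, inv_mul_cancel₀ (by positivity), one_mul]

lemma integral_dilate_sub (ψ : EuclideanSpace ℝ (Fin n) → ℝ) (ht : 0 < t)
    (x : EuclideanSpace ℝ (Fin n)) : ∫ y, dilate ψ t (x - y) = ∫ z, ψ z := by
  rw [integral_sub_left_eq_self (dilate ψ t) volume x, integral_dilate ψ ht]

lemma abs_dilate (ht : 0 < t) (z : EuclideanSpace ℝ (Fin n)) :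
    |dilate ψ t z| = dilate (fun z => |ψ z|) t z := by
  rw [dilate, abs_mul, abs_of_pos (by positivity), dilate]

lemma dilate_eq_zero (h0 : ∀ z, 1 ≤ ‖z‖ → ψ z = 0) (ht : 0 < t) {z : EuclideanSpace ℝ (Fin n)}
    (hz : t ≤ ‖z‖) : dilate ψ t z = 0 := by
  rw [dilate, h0, mul_zero]
  rw [norm_smul, norm_inv, Real.norm_eq_abs, abs_of_pos ht]
  rwa [inv_mul_eq_div, one_le_div₀ ht]

lemma continuous_dilate (hψ : Continuous ψ) (t : ℝ) : Continuous (dilate ψ t) := by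
  unfold dilate; fun_prop

lemma hasCompactSupport_of_eq_zero (h0 : ∀ z, 1 ≤ ‖z‖ → ψ z = 0) : HasCompactSupport ψ :=
  HasCompactSupport.intro (isCompact_closedBall 0 1) fun z hz => h0 z <| by
    simp only [Metric.mem_closedBall, dist_zero_right, not_le] at hz; exact hz.le

lemma hasCompactSupport_dilate_sub (h0 : ∀ z, 1 ≤ ‖z‖ → ψ z = 0) (ht : 0 < t)
    (x : EuclideanSpace ℝ (Fin n)) : HasCompactSupport fun y => dilate ψ t (x - y) :=
  HasCompactSupport.intro (isCompact_closedBall x t) fun y hy => by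
    refine dilate_eq_zero h0 ht ?_
    rw [Metric.mem_closedBall, not_le, dist_comm, dist_eq_norm] at hy; exact hy.le

/-- Almost orthogonality of dilations of a function with mean zero. -/
lemma abs_integral_dilate_mul_le {Λ : ℝ≥0} (hψ : LipschitzWith Λ ψ)
    (h0 : ∀ z, 1 ≤ ‖z‖ → ψ z = 0) (hm : ∫ z, ψ z = 0) (hs : 0 < s) (hst : s ≤ t)
    (x x' : EuclideanSpace ℝ (Fin n)) :
    |∫ y, dilate ψ t (x - y) * dilate ψ s (x' - y)| ≤
      Λ * (∫ z, |ψ z|) * ((s / t) * (t ^ n)⁻¹) := by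
  have ht : 0 < t := hs.trans_le hst
  have hc : ∀ (t : ℝ) (x : EuclideanSpace ℝ (Fin n)), Continuous fun y => dilate ψ t (x - y) :=
    fun t x => (continuous_dilate hψ.continuous t).comp (by fun_prop)
  have hsupp := hasCompactSupport_dilate_sub h0 hs x'
  have i1 : Integrable fun y => dilate ψ s (x' - y) := (hc s x').integrable_of_hasCompactSupport hsupp
  -- The factor at the smaller scale s has mean zero, so the other may be replaced by its increment
  -- from x'. On the support |x' - y| < s, the Lipschitz bound makes this increment O(s/t) t⁻ⁿ.
  have e1 : ∫ y, dilate ψ t (x - y) * dilate ψ s (x' - y) =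
      ∫ y, (dilate ψ t (x - y) - dilate ψ t (x - x')) * dilate ψ s (x' - y) := by
    simp only [sub_mul]
    rw [integral_sub, integral_const_mul, integral_dilate_sub ψ hs, hm, mul_zero, sub_zero]
    · exact ((hc t x).mul (hc s x')).integrable_of_hasCompactSupport hsupp.mul_left
    · exact i1.const_mul _
  rw [e1, ← Real.norm_eq_abs]
  have hpt : ∀ y, ‖(dilate ψ t (x - y) - dilate ψ t (x - x')) * dilate ψ s (x' - y)‖ ≤
      (Λ * ((s / t) * (t ^ n)⁻¹)) * dilate (fun z => |ψ z|) s (x' - y) := fun y => by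
    rw [norm_mul, Real.norm_eq_abs, Real.norm_eq_abs, abs_dilate hs]
    rcases le_or_gt s ‖x' - y‖ with h | h
    · rw [dilate_eq_zero (fun z hz => by simp [h0 z hz]) hs h]; simp
    · refine mul_le_mul_of_nonneg_right ?_ (mul_nonneg (by positivity) (abs_nonneg _))
      rw [dilate, dilate, ← mul_sub, abs_mul, abs_of_pos (by positivity)]
      have h1 := hψ.dist_le_mul (t⁻¹ • (x - y)) (t⁻¹ • (x - x'))
      rw [dist_eq_norm, dist_eq_norm, ← smul_sub, norm_smul, sub_sub_sub_cancel_left, norm_inv,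
        Real.norm_eq_abs, Real.norm_eq_abs, abs_of_pos ht] at h1
      calc _ ≤ (t ^ n)⁻¹ * (Λ * (t⁻¹ * s)) := by
            refine mul_le_mul_of_nonneg_left (h1.trans ?_) (by positivity)
            gcongr
        _ = _ := by ring
  refine (norm_integral_le_of_norm_le (Integrable.const_mul ?_ _)
    (Filter.Eventually.of_forall hpt)).trans (le_of_eq ?_)
  · simp only [← abs_dilate hs]; exact i1.abs
  · rw [integral_const_mul, integral_dilate_sub _ hs]; ring

lemma integral_dilate_mul_eq_zero (h0 : ∀ z, 1 ≤ ‖z‖ → ψ z = 0) (hs : 0 < s) (hst : s ≤ t)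
    {x x' : EuclideanSpace ℝ (Fin n)} (h : 2 * t < dist x x') :
    ∫ y, dilate ψ t (x - y) * dilate ψ s (x' - y) = 0 := by
  have ht : 0 < t := hs.trans_le hst
  rw [← integral_zero]
  · refine integral_congr_ae (Filter.Eventually.of_forall fun y => ?_)
    show dilate ψ t (x - y) * dilate ψ s (x' - y) = 0
    rcases le_or_gt t ‖x - y‖ with h1 | h1
    · rw [dilate_eq_zero h0 ht h1, zero_mul]
    · rw [dilate_eq_zero h0 hs, mul_zero]
      by_contra! h2
      have := dist_triangle x y x'
      rw [dist_eq_norm x y, dist_comm y x', dist_eq_norm x' y] at this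
      linarith

/-- `∫ min (s/t) (t/s) ds/s ≤ 2`. -/
lemma lintegral_min_div_max_le (ht : 0 < t) :
    ∫⁻ s in Ioi 0, ENNReal.ofReal s⁻¹ * ENNReal.ofReal (min s t / max s t) ≤ 2 := by
  rw [← Ioc_union_Ioi_eq_Ioi ht.le]
  refine (lintegral_union_le _ _ _).trans ?_
  rw [← one_add_one_eq_two]
  refine add_le_add ?_ ?_
  · calc _ ≤ ∫⁻ s in Ioc 0 t, ENNReal.ofReal t⁻¹ := by
          refine setLIntegral_mono' measurableSet_Ioc fun s hs => ?_
          have h0 := hs.1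
          rw [min_eq_left hs.2, max_eq_right hs.2, ← ENNReal.ofReal_mul (by positivity)]
          refine ENNReal.ofReal_le_ofReal (le_of_eq ?_)
          field_simp
      _ ≤ 1 := by
          rw [setLIntegral_const, Real.volume_Ioc, ← ENNReal.ofReal_mul (by positivity)]
          rw [sub_zero, inv_mul_cancel₀ ht.ne', ENNReal.ofReal_one]
  · calc _ = ∫⁻ s in Ioi t, ENNReal.ofReal (t * s ^ (-2 : ℝ)) := by
          refine setLIntegral_congr_fun measurableSet_Ioi fun s hs => ?_
          have hs' : t < s := hs
          have h0 := ht.trans hs'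
          rw [min_eq_right hs'.le, max_eq_left hs'.le, ← ENNReal.ofReal_mul (by positivity),
            Real.rpow_neg h0.le, Real.rpow_two]
          congr 1
          field_simp
      _ ≤ 1 := by
          rw [← ofReal_integral_eq_lintegral_ofReal, integral_const_mul,
            integral_Ioi_rpow_of_lt (by norm_num) ht]
          · norm_num
            rw [Real.rpow_neg_one, mul_inv_cancel₀ ht.ne']
          · exact (integrableOn_Ioi_rpow_of_lt (by norm_num) ht).const_mul t
          · filter_upwards [ae_restrict_mem measurableSet_Ioi] with s hs
            have : 0 < s := ht.trans hs
            simp only [Pi.zero_apply]; positivity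

end SquareFunction

end AdaptedDistance

end

/-! ### The local square function estimate. -/

noncomputable section

open MeasureTheory Set
open scoped NNReal ENNReal

namespace AdaptedDistance

section SquareFunction

variable {n : ℕ} {ψ : EuclideanSpace ℝ (Fin n) → ℝ} {s t : ℝ} {Λ : ℝ≥0}

/-- With m = max(s, t), the integrand is O((min/max) m⁻ⁿ) and vanishes unless |x - x'| ≤ 2m; the
volume of that ball cancels m⁻ⁿ. -/
lemma lintegral_abs_integral_dilate_mul_le (hψ : LipschitzWith Λ ψ)
    (h0 : ∀ z, 1 ≤ ‖z‖ → ψ z = 0) (hm : ∫ z, ψ z = 0) (hs : 0 < s) (ht : 0 < t)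
    (x : EuclideanSpace ℝ (Fin n)) :
    ∫⁻ x', ENNReal.ofReal |∫ y, dilate ψ t (x - y) * dilate ψ s (x' - y)| ≤
      ENNReal.ofReal (Λ * (∫ z, |ψ z|) *
        volume.real (Metric.closedBall (0 : EuclideanSpace ℝ (Fin n)) 2)) *
        ENNReal.ofReal (min s t / max s t) := by
  set m := max s t with hmdef
  have hm0 : 0 < m := hs.trans_le (le_max_left _ _)
  have hN : 0 ≤ ∫ z, |ψ z| := integral_nonneg fun z => abs_nonneg _
  set D := Λ * (∫ z, |ψ z|) * (min s t / m * (m ^ n)⁻¹) with hD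
  have hmin : 0 ≤ min s t := le_min hs.le ht.le
  have hD0 : 0 ≤ D := by positivity
  have hpt : ∀ x', ENNReal.ofReal |∫ y, dilate ψ t (x - y) * dilate ψ s (x' - y)| ≤
      (Metric.closedBall x (2 * m)).indicator (fun _ => ENNReal.ofReal D) x' := fun x' => by
    by_cases hx : x' ∈ Metric.closedBall x (2 * m)
    · rw [indicator_of_mem hx]
      refine ENNReal.ofReal_le_ofReal ?_
      rcases le_total s t with h | h
      · have := abs_integral_dilate_mul_le hψ h0 hm hs h x x'
        rwa [hD, hmdef, min_eq_left h, max_eq_right h]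
      · have := abs_integral_dilate_mul_le hψ h0 hm ht h x' x
        rw [hD, hmdef, min_eq_right h, max_eq_left h]
        simpa only [mul_comm (dilate ψ t _)] using this
    · rw [indicator_of_notMem hx]
      rw [Metric.mem_closedBall, not_le] at hx
      rcases le_total s t with h | h
      · rw [integral_dilate_mul_eq_zero h0 hs h]
        · simp
        · rw [hmdef, max_eq_right h, dist_comm] at hx; exact hx
      · have := integral_dilate_mul_eq_zero (ψ := ψ) h0 ht h (x := x') (x' := x)
          (by rw [hmdef, max_eq_left h] at hx; exact hx)
        simp only [mul_comm (dilate ψ s _)] at this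
        simp [this]
  refine (lintegral_mono hpt).trans ?_
  rw [lintegral_indicator_const Metric.isClosed_closedBall.measurableSet, mul_comm 2 m,
    Measure.addHaar_closedBall_mul _ _ hm0.le (by norm_num), finrank_euclideanSpace_fin,
    ← ofReal_measureReal measure_closedBall_lt_top.ne, ← ENNReal.ofReal_mul (by positivity), ← ENNReal.ofReal_mul (by positivity),
    ← ENNReal.ofReal_mul (by positivity)]
  refine ENNReal.ofReal_le_ofReal (le_of_eq ?_)
  rw [hD]; field_simp

/-- The constant in the square function estimate. -/
def squareConst (ψ : EuclideanSpace ℝ (Fin n) → ℝ) (Λ : ℝ≥0) : ℝ :=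
  Λ * (∫ z, |ψ z|) * volume.real (Metric.closedBall (0 : EuclideanSpace ℝ (Fin n)) 2) * 2 + 1

/-- The summand 1 in the constant guarantees positivity even for ψ = 0, as Schur's test requires. -/
lemma squareConst_pos : 0 < squareConst ψ Λ := by
  have hN : 0 ≤ ∫ z, |ψ z| := integral_nonneg fun z => abs_nonneg _
  unfold squareConst; positivity

/-- Schur's test on L² of dx dt/t. Truncating at t > ε makes the measures finite and the kernel
bounded, so all Fubini steps are legitimate; the bound does not depend on ε. -/
lemma lintegral_square_aux (hψ : LipschitzWith Λ ψ)
    (h0 : ∀ z, 1 ≤ ‖z‖ → ψ z = 0) (hm : ∫ z, ψ z = 0) {b : EuclideanSpace ℝ (Fin n) → ℝ}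
    (hb : Measurable b) {B : ℝ} (hB : ∀ y, |b y| ≤ B) (x₀ : EuclideanSpace ℝ (Fin n))
    {R₀ T ε : ℝ} (hε : 0 < ε) :
    ∫⁻ p in Metric.closedBall x₀ R₀ ×ˢ Ioc ε T,
      ENNReal.ofReal p.2⁻¹ * ENNReal.ofReal ((∫ y, dilate ψ p.2 (p.1 - y) * b y) ^ 2)
        ∂(volume.prod volume) ≤
      ENNReal.ofReal (squareConst ψ Λ * B ^ 2) * volume (Metric.closedBall x₀ (R₀ + T)) := by
  set S : Set (EuclideanSpace ℝ (Fin n) × ℝ) := Metric.closedBall x₀ R₀ ×ˢ Ioc ε T with hS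
  have hSm : MeasurableSet S := Metric.isClosed_closedBall.measurableSet.prod measurableSet_Ioc
  set w : EuclideanSpace ℝ (Fin n) × ℝ → ℝ≥0∞ := fun p => ENNReal.ofReal p.2⁻¹ with hw
  have hwm : Measurable w := by fun_prop
  set μ : Measure (EuclideanSpace ℝ (Fin n) × ℝ) :=
    ((volume.prod volume).restrict S).withDensity w with hμ
  set ν : Measure (EuclideanSpace ℝ (Fin n)) :=
    volume.restrict (Metric.closedBall x₀ (R₀ + T)) with hν
  have hSfin : (volume.prod volume) S < ∞ := by
    rw [hS, Measure.prod_prod]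
    exact ENNReal.mul_lt_top measure_closedBall_lt_top (by rw [Real.volume_Ioc]; finiteness)
  have : IsFiniteMeasure μ := by
    refine isFiniteMeasure_withDensity (ne_of_lt ?_)
    calc _ ≤ ∫⁻ p in S, ENNReal.ofReal ε⁻¹ ∂(volume.prod volume) := by
          refine setLIntegral_mono' hSm fun p hp => ENNReal.ofReal_le_ofReal ?_
          exact inv_anti₀ hε hp.2.1.le
      _ < ∞ := by
          rw [setLIntegral_const]; exact ENNReal.mul_lt_top (by finiteness) hSfin
  have : IsFiniteMeasure ν := ⟨by rw [hν, Measure.restrict_apply_univ]; exact measure_closedBall_lt_top⟩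
  have hSae : ∀ᵐ p ∂μ, p ∈ S :=
    (withDensity_absolutelyContinuous _ _).ae_le (ae_restrict_mem hSm)
  obtain ⟨Bψ, hBψ⟩ := (hasCompactSupport_of_eq_zero h0).exists_bound_of_continuous hψ.continuous
  -- Replacing t by max(t, ε) changes nothing on S, and makes the kernel continuous and bounded
  -- everywhere.
  set k : EuclideanSpace ℝ (Fin n) × ℝ → EuclideanSpace ℝ (Fin n) → ℝ := fun p y =>
    dilate ψ (max p.2 ε) (p.1 - y) with hk
  have hmax : ∀ r : ℝ, 0 < max r ε := fun r => hε.trans_le (le_max_right _ _)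
  have hkc : Continuous (Function.uncurry k) := by
    simp only [hk, dilate, Function.uncurry_def]
    have hψc := hψ.continuous
    have h1 : Continuous fun p : (EuclideanSpace ℝ (Fin n) × ℝ) × EuclideanSpace ℝ (Fin n) =>
      max p.1.2 ε := by fun_prop
    refine ((h1.pow n).inv₀ fun p => (pow_pos (hmax _) n).ne').mul (hψc.comp ?_)
    exact (h1.inv₀ fun p => (hmax _).ne').smul (by fun_prop)
  have hkB : ∀ p y, |k p y| ≤ (ε ^ n)⁻¹ * Bψ := fun p y => by
    simp only [hk, dilate]
    rw [abs_mul, abs_of_pos (inv_pos.2 (pow_pos (hmax _) n))]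
    refine mul_le_mul ?_ (hBψ _) (abs_nonneg _) (by positivity)
    exact inv_anti₀ (by positivity) (pow_le_pow_left₀ hε.le (le_max_right _ _) n)
  -- on the support of `μ`, integrals against `ν` are integrals over the whole space
  have hfull : ∀ p ∈ S, ∀ f : EuclideanSpace ℝ (Fin n) → ℝ,
      ∫ y, k p y * f y ∂ν = ∫ y, dilate ψ p.2 (p.1 - y) * f y := fun p hp f => by
    have h2 : max p.2 ε = p.2 := max_eq_left hp.2.1.le
    simp only [hk, h2]
    refine setIntegral_eq_integral_of_forall_compl_eq_zero fun y hy => ?_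
    rw [dilate_eq_zero h0 (hε.trans hp.2.1), zero_mul]
    by_contra! h3
    refine hy (Metric.mem_closedBall.2 ?_)
    have h4 := dist_triangle_left y x₀ p.1
    have h5 := Metric.mem_closedBall.1 hp.1
    have h6 : p.2 ≤ T := hp.2.2
    rw [dist_eq_norm p.1 y] at h4
    linarith
  have hC := squareConst_pos (ψ := ψ) (Λ := Λ)
  -- Integrating in x' leaves min(s,t)/max(s,t), whose integral in ds/s is at most 2: the
  -- orthogonality gain makes the row sums converge at both small and large scales.
  have hschur : ∀ᵐ p ∂μ, ∫ p', |∫ y, k p y * k p' y ∂ν| ∂μ ≤ squareConst ψ Λ := by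
    filter_upwards [hSae] with p hp
    have htp : 0 < p.2 := hε.trans hp.2.1
    have hcont : Continuous (Function.uncurry fun (p' : EuclideanSpace ℝ (Fin n) × ℝ) y =>
        k p y * k p' y) :=
      (hkc.comp (continuous_const.prodMk continuous_snd)).mul hkc
    have hKm : Measurable fun p' => |∫ y, k p y * k p' y ∂ν| :=
      hcont.stronglyMeasurable.integral_prod_right.measurable.abs
    rw [integral_eq_lintegral_of_nonneg_ae (Filter.Eventually.of_forall fun _ => abs_nonneg _)
      hKm.aestronglyMeasurable]
    refine ENNReal.toReal_le_of_le_ofReal hC.le ?_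
    rw [hμ, lintegral_withDensity_eq_lintegral_mul _ hwm (by fun_prop)]
    set F : EuclideanSpace ℝ (Fin n) × ℝ → ℝ≥0∞ := fun p' =>
      w p' * ENNReal.ofReal |∫ y, k p y * k p' y ∂ν| with hF
    have hFm : Measurable F := hwm.mul hKm.ennreal_ofReal
    calc _ = ∫⁻ p' in S, F p' ∂(volume.prod volume) := rfl
      _ = ∫⁻ s in Ioc ε T, ∫⁻ x' in Metric.closedBall x₀ R₀, F (x', s) := by
          rw [hS, ← Measure.prod_restrict, lintegral_prod_symm' _ hFm]
      _ ≤ ∫⁻ s in Ioc ε T, ENNReal.ofReal (Λ * (∫ z, |ψ z|) *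
            volume.real (Metric.closedBall (0 : EuclideanSpace ℝ (Fin n)) 2)) *
            (ENNReal.ofReal s⁻¹ * ENNReal.ofReal (min s p.2 / max s p.2)) := by
          refine setLIntegral_mono' measurableSet_Ioc fun s hs => ?_
          have hs0 : 0 < s := hε.trans hs.1
          simp only [hF, hw]
          rw [lintegral_const_mul' _ _ (by finiteness), mul_left_comm]
          refine mul_le_mul_right ?_ _
          refine le_trans ?_ (lintegral_abs_integral_dilate_mul_le hψ h0 hm hs0 htp p.1)
          refine le_trans (le_of_eq ?_) (setLIntegral_le_lintegral (Metric.closedBall x₀ R₀) _)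
          refine setLIntegral_congr_fun Metric.isClosed_closedBall.measurableSet fun x' hx' => ?_
          rw [hfull p hp]
          simp only [hk, max_eq_left hs.1.le]
      _ ≤ ENNReal.ofReal (Λ * (∫ z, |ψ z|) *
            volume.real (Metric.closedBall (0 : EuclideanSpace ℝ (Fin n)) 2)) * 2 := by
          rw [lintegral_const_mul' _ _ (by finiteness)]
          refine mul_le_mul_right ?_ _
          refine le_trans ?_ (lintegral_min_div_max_le htp)
          exact lintegral_mono_set fun s hs => hε.trans hs.1
      _ ≤ ENNReal.ofReal (squareConst ψ Λ) := by
          have hN : 0 ≤ ∫ z, |ψ z| := integral_nonneg fun z => abs_nonneg _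
          refine le_of_eq_of_le (congrArg _ (ENNReal.ofReal_ofNat 2).symm) ?_
          rw [← ENNReal.ofReal_mul (by positivity)]
          exact ENNReal.ofReal_le_ofReal (by unfold squareConst; linarith)
  have hmain := integral_sq_le_of_schur hkc.measurable hb hkB hB hC hschur
  have hHm : Measurable fun p => ∫ y, k p y * b y ∂ν := by
    have h1 : Measurable (Function.uncurry fun p y => k p y * b y) :=
      hkc.measurable.mul (hb.comp measurable_snd)
    exact h1.stronglyMeasurable.integral_prod_right.measurable
  have hB0 : 0 ≤ B := (abs_nonneg _).trans (hB 0)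
  have hrhs : ∫ y, b y ^ 2 ∂ν ≤ B ^ 2 * ν.real univ := by
    refine (le_abs_self _).trans (abs_integral_le fun y => ?_)
    rw [abs_pow]; exact pow_le_pow_left₀ (abs_nonneg _) (hB y) 2
  have hfinal : ∫ p, (∫ y, k p y * b y ∂ν) ^ 2 ∂μ ≤
      squareConst ψ Λ * B ^ 2 * ν.real univ := by
    rw [mul_assoc]; exact hmain.trans (mul_le_mul_of_nonneg_left hrhs hC.le)
  have hint : Integrable (fun p => (∫ y, k p y * b y ∂ν) ^ 2) μ := by
    refine integrable_of_abs_le (hHm.pow_const 2)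
      (D := ((ε ^ n)⁻¹ * Bψ * B * ν.real univ) ^ 2) fun p => ?_
    rw [abs_pow]
    refine pow_le_pow_left₀ (abs_nonneg _) (abs_integral_le fun y => ?_) 2
    rw [abs_mul]
    exact mul_le_mul (hkB p y) (hB y) (abs_nonneg _) ((abs_nonneg _).trans (hkB p y))
  calc _ = ∫⁻ p, ENNReal.ofReal ((∫ y, k p y * b y ∂ν) ^ 2) ∂μ := by
        rw [hμ, lintegral_withDensity_eq_lintegral_mul _ hwm (by fun_prop)]
        refine setLIntegral_congr_fun hSm fun p hp => ?_
        simp only [Pi.mul_apply]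
        rw [hfull p hp]
    _ = ENNReal.ofReal (∫ p, (∫ y, k p y * b y ∂ν) ^ 2 ∂μ) :=
        (ofReal_integral_eq_lintegral_ofReal hint
          (Filter.Eventually.of_forall fun p => sq_nonneg _)).symm
    _ ≤ ENNReal.ofReal (squareConst ψ Λ * B ^ 2 * ν.real univ) := ENNReal.ofReal_le_ofReal hfinal
    _ = _ := by
        rw [ENNReal.ofReal_mul (by positivity), ofReal_measureReal, hν,
          Measure.restrict_apply_univ]

/-- The square function estimate for a Lipschitz function `ψ` of mean zero supported in the
unit ball. -/
lemma lintegral_square_le (hψ : LipschitzWith Λ ψ)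
    (h0 : ∀ z, 1 ≤ ‖z‖ → ψ z = 0) (hm : ∫ z, ψ z = 0) {b : EuclideanSpace ℝ (Fin n) → ℝ}
    (hb : Measurable b) {B : ℝ} (hB : ∀ y, |b y| ≤ B) (x₀ : EuclideanSpace ℝ (Fin n))
    (R₀ T : ℝ) :
    ∫⁻ p in Metric.closedBall x₀ R₀ ×ˢ Ioc 0 T,
      ENNReal.ofReal p.2⁻¹ * ENNReal.ofReal ((∫ y, dilate ψ p.2 (p.1 - y) * b y) ^ 2)
        ∂(volume.prod volume) ≤
      ENNReal.ofReal (squareConst ψ Λ * B ^ 2) * volume (Metric.closedBall x₀ (R₀ + T)) := by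
  have h1 : (Metric.closedBall x₀ R₀ ×ˢ Ioc 0 T : Set (EuclideanSpace ℝ (Fin n) × ℝ)) =
      ⋃ j : ℕ, Metric.closedBall x₀ R₀ ×ˢ Ioc (1 / ((j : ℝ) + 1)) T := by
    rw [← prod_iUnion]
    congr 1
    ext t
    simp only [mem_iUnion, mem_Ioc]
    constructor
    · rintro ⟨h1, h2⟩
      obtain ⟨j, hj⟩ := exists_nat_one_div_lt h1
      exact ⟨j, hj, h2⟩
    · rintro ⟨j, h1, h2⟩
      exact ⟨lt_trans (by positivity) h1, h2⟩
  -- Monotone exhaustion removes the truncation, as the bound is uniform.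
  rw [h1, setLIntegral_iUnion_of_directed]
  · exact iSup_le fun j => lintegral_square_aux hψ h0 hm hb hB x₀ (by positivity)
  · refine Monotone.directed_le fun i j hij => prod_mono_right (Ioc_subset_Ioc_left ?_)
    exact one_div_le_one_div_of_le (by positivity) (by gcongr)

end SquareFunction

end AdaptedDistance

end

/-! ### Averages at scale t and their derivatives. -/

noncomputable section

open MeasureTheory Set
open scoped NNReal ENNReal ContDiff

namespace AdaptedDistance

section Smoothing

variable {n : ℕ} {ψ : EuclideanSpace ℝ (Fin n) → ℝ} {f : EuclideanSpace ℝ (Fin n) → ℝ} {t : ℝ}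

/-- A smooth function supported in the open unit ball. -/
structure IsKernel (ψ : EuclideanSpace ℝ (Fin n) → ℝ) : Prop where
  contDiff : ContDiff ℝ ∞ ψ
  tsupport_subset : tsupport ψ ⊆ Metric.ball 0 1

namespace IsKernel

lemma eq_zero (h : IsKernel ψ) (z : EuclideanSpace ℝ (Fin n)) (hz : 1 ≤ ‖z‖) : ψ z = 0 := by
  refine image_eq_zero_of_notMem_tsupport fun hmem => ?_
  have := h.tsupport_subset hmem
  rw [mem_ball_zero_iff] at this
  linarith

lemma hasCompactSupport (h : IsKernel ψ) : HasCompactSupport ψ := hasCompactSupport_of_eq_zero h.eq_zero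

lemma differentiable (h : IsKernel ψ) : Differentiable ℝ ψ := h.contDiff.differentiable (by simp)

lemma continuous (h : IsKernel ψ) : Continuous ψ := h.contDiff.continuous

lemma exists_lipschitzWith (h : IsKernel ψ) : ∃ Λ, LipschitzWith Λ ψ :=
  (h.contDiff.of_le (by simp)).lipschitzWith_of_hasCompactSupport h.hasCompactSupport one_ne_zero

lemma mul (h : IsKernel ψ) {g : EuclideanSpace ℝ (Fin n) → ℝ} (hg : ContDiff ℝ ∞ g) :
    IsKernel fun z => ψ z * g z :=
  ⟨h.contDiff.mul hg, (tsupport_mul_subset_left (f := ψ) (g := g)).trans h.tsupport_subset⟩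

lemma fderiv_apply (h : IsKernel ψ) {v : EuclideanSpace ℝ (Fin n) → EuclideanSpace ℝ (Fin n)}
    (hv : ContDiff ℝ ∞ v) : IsKernel fun z => fderiv ℝ ψ z (v z) := by
  refine ⟨(h.contDiff.fderiv_right (by simp)).clm_apply hv, ?_⟩
  refine Subset.trans ?_ ((tsupport_fderiv_subset ℝ (f := ψ)).trans h.tsupport_subset)
  refine closure_mono fun z hz hz' => hz ?_
  simp [hz']

lemma sub (h : IsKernel ψ) {χ : EuclideanSpace ℝ (Fin n) → ℝ} (h' : IsKernel χ) :
    IsKernel fun z => ψ z - χ z :=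
  ⟨h.contDiff.sub h'.contDiff,
    (tsupport_sub (f := ψ) (g := χ)).trans (union_subset h.tsupport_subset h'.tsupport_subset)⟩

end IsKernel

/-- The averages `∫ f(y) t⁻ⁿ ψ((x - y) / t) dy` as a function of `X = (x, t)`. -/
def average (ψ f : EuclideanSpace ℝ (Fin n) → ℝ) (X : Space n) : ℝ :=
  ∫ y, dilate ψ (height X) (horiz X - y) * f y

/-- The kernel for the derivative of `average ψ f` in the direction `ξ`. -/
def kernelDeriv (ξ : Space n) (ψ : EuclideanSpace ℝ (Fin n) → ℝ) (z : EuclideanSpace ℝ (Fin n)) :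
    ℝ :=
  fderiv ℝ ψ z (horiz ξ - height ξ • z) - ψ z * (n * height ξ)

lemma IsKernel.kernelDeriv (h : IsKernel ψ) (ξ : Space n) : IsKernel (kernelDeriv ξ ψ) :=
  (h.fderiv_apply (by fun_prop)).sub (h.mul (by fun_prop))

/-- By homogeneity a derivative in (x, t) costs t⁻¹ and gives back a dilated kernel. So the class of
averages is stable under differentiation, which can then be iterated. -/
lemma fderiv_dilate (h : IsKernel ψ) (ht : 0 < t) (z : EuclideanSpace ℝ (Fin n)) (ξ : Space n) :
    fderiv ℝ (fun p : ℝ × EuclideanSpace ℝ (Fin n) => dilate ψ p.1 p.2) (t, z)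
      (height ξ, horiz ξ) = t⁻¹ * dilate (kernelDeriv ξ ψ) t z := by
  have hd : DifferentiableAt ℝ
      (fun p : ℝ × EuclideanSpace ℝ (Fin n) => dilate ψ p.1 p.2) (t, z) := by
    unfold dilate
    have h1 : DifferentiableAt ℝ (fun p : ℝ × EuclideanSpace ℝ (Fin n) => p.1⁻¹) (t, z) :=
      differentiableAt_fst.inv ht.ne'
    have h2 : DifferentiableAt ℝ (fun p : ℝ × EuclideanSpace ℝ (Fin n) => (p.1 ^ n)⁻¹) (t, z) :=
      (differentiableAt_fst.pow n).inv (pow_pos ht n).ne'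
    exact h2.mul ((h.differentiable _).comp _ (h1.smul differentiableAt_snd))
  have e1 : HasDerivAt (fun s : ℝ => t + s * height ξ) (height ξ) 0 := by
    simpa using ((hasDerivAt_id (0 : ℝ)).mul_const (height ξ)).const_add t
  have e2 : HasDerivAt (fun s : ℝ => z + s • horiz ξ) (horiz ξ) 0 := by
    simpa using ((hasDerivAt_id (0 : ℝ)).smul_const (horiz ξ)).const_add z
  have e3 : HasDerivAt (fun s : ℝ => (t + s * height ξ, z + s • horiz ξ)) (height ξ, horiz ξ) 0 :=
    e1.prodMk e2
  have e4 := HasFDerivAt.comp_hasDerivAt_of_eq (0 : ℝ) hd.hasFDerivAt e3 (by simp)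
  have e5 := ((e1.fun_pow n).fun_inv (by simp [ht.ne'])).fun_mul
    (HasFDerivAt.comp_hasDerivAt_of_eq (0 : ℝ) (h.differentiable (t⁻¹ • z)).hasFDerivAt
      ((e1.fun_inv (by simp [ht.ne'])).fun_smul e2) (by simp))
  have e6 := e4.unique e5
  rw [e6]
  -- The exponent n - 1 is truncated; for n = 0 the factor n vanishes.
  have hn : (n : ℝ) * t ^ (n - 1) = n * t ^ n * t⁻¹ := by
    rcases Nat.eq_zero_or_pos n with h | h
    · simp [h]
    · obtain ⟨m, rfl⟩ := Nat.exists_eq_succ_of_ne_zero h.ne'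
      simp only [Nat.succ_eq_add_one, Nat.add_sub_cancel]; field_simp; rw [pow_succ]
  simp only [zero_mul, add_zero, zero_smul, hn, dilate, kernelDeriv, map_add, map_smul, map_sub,
    smul_eq_mul, Function.comp_apply]
  field_simp
  ring

lemma contDiffOn_dilate (h : IsKernel ψ) (s : Set ℝ) (hs : s ⊆ Ioi 0) :
    ContDiffOn ℝ ∞ (fun p : ℝ × EuclideanSpace ℝ (Fin n) => dilate ψ p.1 p.2) (s ×ˢ univ) := by
  unfold dilate
  have h0 : ∀ p ∈ s ×ˢ (univ : Set (EuclideanSpace ℝ (Fin n))), p.1 ≠ 0 := fun p hp =>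
    (hs hp.1).ne'
  have h1 : ContDiffOn ℝ ∞ (fun p : ℝ × EuclideanSpace ℝ (Fin n) => p.1⁻¹) (s ×ˢ univ) :=
    contDiffOn_fst.inv h0
  have h2 : ContDiffOn ℝ ∞ (fun p : ℝ × EuclideanSpace ℝ (Fin n) => (p.1 ^ n)⁻¹) (s ×ˢ univ) :=
    (contDiffOn_fst.pow n).inv fun p hp => pow_ne_zero n (h0 p hp)
  exact h2.mul (h.contDiff.comp_contDiffOn (h1.smul contDiffOn_snd))

lemma average_eq_convolution (ψ f : EuclideanSpace ℝ (Fin n) → ℝ) :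
    average ψ f = (fun q : ℝ × EuclideanSpace ℝ (Fin n) =>
      (convolution f (dilate ψ q.1) (ContinuousLinearMap.mul ℝ ℝ) volume) q.2) ∘
        fun X => (height X, horiz X) := by
  funext X
  simp only [average, Function.comp_apply, convolution, ContinuousLinearMap.mul_apply']
  exact integral_congr_ae (Filter.Eventually.of_forall fun y => mul_comm _ _)

lemma dilate_eq_zero_of_notMem_closedBall (h : IsKernel ψ) (T : ℝ) :
    ∀ p, ∀ x, p ∈ Ioo 0 T → x ∉ Metric.closedBall (0 : EuclideanSpace ℝ (Fin n)) T →
      dilate ψ p x = 0 := by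
  intro p x hp hx
  rw [Metric.mem_closedBall, dist_zero_right, not_le] at hx
  exact dilate_eq_zero h.eq_zero hp.1 (hp.2.le.trans hx.le)

/-- An average is a convolution whose kernel depends smoothly on the parameter t, with support in a
fixed ball for t in a bounded interval. Regularity is thus joint in (x, t) and f need only be
locally integrable. -/
lemma contDiffAt_average (h : IsKernel ψ) (hf : LocallyIntegrable f) {X : Space n}
    (hX : 0 < height X) : ContDiffAt ℝ ∞ (average ψ f) X := by
  rw [average_eq_convolution]
  have h1 := contDiffOn_convolution_right_with_param (n := ⊤) (ContinuousLinearMap.mul ℝ ℝ)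
    (g := fun t : ℝ => dilate ψ t)
    (isOpen_Ioo (a := (0 : ℝ)) (b := height X + 1)) (isCompact_closedBall 0 (height X + 1))
    (dilate_eq_zero_of_notMem_closedBall h _) hf (contDiffOn_dilate h _ fun _ h => h.1)
  refine ContDiffAt.comp X (h1.contDiffAt (x := (height X, horiz X)) ?_)
    ((heightL n).contDiff.prodMk (horizL n).contDiff).contDiffAt
  exact (isOpen_Ioo.prod isOpen_univ).mem_nhds ⟨⟨hX, by simp⟩, mem_univ _⟩

lemma fderiv_average (h : IsKernel ψ) (hf : LocallyIntegrable f) {X : Space n}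
    (hX : 0 < height X) (ξ : Space n) :
    fderiv ℝ (average ψ f) X ξ = (height X)⁻¹ * average (kernelDeriv ξ ψ) f X := by
  have hk : IsCompact (Metric.closedBall (0 : EuclideanSpace ℝ (Fin n)) (height X + 1)) :=
    isCompact_closedBall 0 (height X + 1)
  have hcd := (contDiffOn_dilate h (Ioo 0 (height X + 1)) fun _ h => h.1)
  have hmem : height X ∈ Ioo 0 (height X + 1) := ⟨hX, by simp⟩
  have h1 := hasFDerivAt_convolution_right_with_param (ContinuousLinearMap.mul ℝ ℝ)
    (g := fun t : ℝ => dilate ψ t) (μ := volume) isOpen_Ioo hk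
    (dilate_eq_zero_of_notMem_closedBall h _) hf (hcd.of_le (by simp))
    (height X, horiz X) hmem
  have h2 : HasFDerivAt (fun X : Space n => (height X, horiz X))
      ((heightL n).prod (horizL n)) X := ((heightL n).prod (horizL n)).hasFDerivAt
  have h3 := h1.comp X h2
  rw [← average_eq_convolution] at h3
  rw [h3.fderiv]
  simp only [ContinuousLinearMap.comp_apply, ContinuousLinearMap.prod_apply, heightL_apply,
    horizL_apply]
  set g' := fun z => fderiv ℝ (fun p : ℝ × EuclideanSpace ℝ (Fin n) => dilate ψ p.1 p.2)
    (height X, z) with hg'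
  have hopen : IsOpen (Ioo 0 (height X + 1) ×ˢ (univ : Set (EuclideanSpace ℝ (Fin n)))) :=
    isOpen_Ioo.prod isOpen_univ
  have hc : Continuous g' :=
    (hcd.continuousOn_fderiv_of_isOpen hopen (by simp)).comp_continuous (by fun_prop)
      fun z => ⟨hmem, mem_univ _⟩
  have hsupp : HasCompactSupport g' := by
    refine HasCompactSupport.intro hk fun z hz => ?_
    refine (hasFDerivAt_zero_of_eventually_const 0 ?_).fderiv
    filter_upwards [prod_mem_nhds (isOpen_Ioo.mem_nhds hmem)
      (hk.isClosed.isOpen_compl.mem_nhds hz)] with p hp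
    exact dilate_eq_zero_of_notMem_closedBall h _ _ _ hp.1 hp.2
  have h4 := convolution_precompR_apply (ContinuousLinearMap.mul ℝ ℝ) hf hsupp hc (horiz X)
    (height ξ, horiz ξ)
  refine Eq.trans h4 ?_
  rw [convolution_def, average, ← integral_const_mul]
  refine integral_congr_ae (Filter.Eventually.of_forall fun y => ?_)
  simp only [hg', ContinuousLinearMap.mul_apply', fderiv_dilate h hX]
  ring

end Smoothing

end AdaptedDistance

end

/-! ### Regularization of a Lipschitz function. -/

noncomputable section

open MeasureTheory Set
open scoped NNReal ENNReal ContDiff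

namespace AdaptedDistance

section Smoothing

variable {n : ℕ} {ψ : EuclideanSpace ℝ (Fin n) → ℝ} {f φ : EuclideanSpace ℝ (Fin n) → ℝ}
  {L : ℝ≥0} {X : Space n}

lemma isOpen_height_pos : IsOpen {X : Space n | 0 < height X} :=
  isOpen_lt continuous_const continuous_height

lemma integrable_dilate_mul (h : IsKernel ψ) (hf : LocallyIntegrable f) (hX : 0 < height X) :
    Integrable fun y => dilate ψ (height X) (horiz X - y) * f y :=
  hf.integrable_smul_left_of_hasCompactSupport
    ((continuous_dilate h.continuous _).comp (by fun_prop))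
    (hasCompactSupport_dilate_sub h.eq_zero hX _)

lemma average_sum {ι : Type*} (s : Finset ι) {ψ : ι → EuclideanSpace ℝ (Fin n) → ℝ}
    (h : ∀ i ∈ s, IsKernel (ψ i)) (hf : LocallyIntegrable f) (hX : 0 < height X) :
    average (fun z => ∑ i ∈ s, ψ i z) f X = ∑ i ∈ s, average (ψ i) f X := by
  unfold average
  rw [← integral_finsetSum _ fun i hi => integrable_dilate_mul (h i hi) hf hX]
  refine integral_congr_ae (Filter.Eventually.of_forall fun y => ?_)
  simp only [dilate, Finset.mul_sum, Finset.sum_mul]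

/-- The kernels of the derivatives of averages have mean zero. -/
lemma integral_kernelDeriv (h : IsKernel ψ) (ξ : Space n) : ∫ z, kernelDeriv ξ ψ z = 0 := by
  have h1 : ∀ (ψ : EuclideanSpace ℝ (Fin n) → ℝ) (X : Space n), 0 < height X →
      average ψ (fun _ => 1) X = ∫ z, ψ z := fun ψ X hX => by
    simp only [average, mul_one]
    exact integral_dilate_sub ψ hX _
  -- Averages of the constant 1 equal ∫ψ at every positive scale, so their derivative vanishes; at t
  -- = 1 that derivative is the integral of the new kernel.
  have h2 := fderiv_average h (locallyIntegrable_const (1 : ℝ)) (X := pt 0 1) (by simp) ξ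
  rw [h1 _ _ (by simp), height_pt, inv_one, one_mul] at h2
  rw [← h2]
  have : HasFDerivAt (average ψ fun _ => 1) (0 : Space n →L[ℝ] ℝ) (pt 0 1) := by
    refine hasFDerivAt_zero_of_eventually_const (∫ z, ψ z) ?_
    filter_upwards [isOpen_height_pos.mem_nhds (show 0 < height (pt (0 : EuclideanSpace ℝ (Fin n)) 1)
      by simp)] with X hX
    exact h1 ψ X hX
  rw [this.fderiv, zero_apply]

/-- Integration by parts, moving a derivative from the kernel to the Lipschitz function. -/
lemma average_fderiv (h : IsKernel ψ) (hφ : LipschitzWith L φ) (hX : 0 < height X)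
    (e : EuclideanSpace ℝ (Fin n)) :
    (height X)⁻¹ * average (fun z => fderiv ℝ ψ z e) φ X =
      average ψ (fun y => lineDeriv ℝ φ y e) X := by
  set t := height X
  set g : EuclideanSpace ℝ (Fin n) → ℝ := fun y => dilate ψ t (horiz X - y) with hg
  have hgs : ContDiff ℝ ∞ g := by
    simp only [hg, dilate]
    exact contDiff_const.mul (h.contDiff.comp (by fun_prop))
  have hgc : HasCompactSupport g := hasCompactSupport_dilate_sub h.eq_zero hX _
  obtain ⟨D, hD⟩ := (hgs.of_le (by simp)).lipschitzWith_of_hasCompactSupport hgc one_ne_zero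
  have h1 := hφ.integral_lineDeriv_mul_eq (μ := volume) hD hgc e
  have h2 : ∀ y, lineDeriv ℝ g y (-e) = t⁻¹ * dilate (fun z => fderiv ℝ ψ z e) t (horiz X - y) := by
    intro y
    have h3 : HasFDerivAt (fun y => t⁻¹ • (horiz X - y))
        (t⁻¹ • -(ContinuousLinearMap.id ℝ (EuclideanSpace ℝ (Fin n)))) y :=
      ((hasFDerivAt_id y).const_sub _).fun_const_smul _
    have h4 := ((h.differentiable (t⁻¹ • (horiz X - y))).hasFDerivAt.comp y h3).const_mul (t ^ n)⁻¹
    have h5 := h4.hasLineDerivAt (-e)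
    rw [show lineDeriv ℝ g y (-e) = _ from h5.lineDeriv]
    simp only [dilate, smul_apply, ContinuousLinearMap.comp_apply, neg_apply,
      ContinuousLinearMap.id_apply, neg_neg, map_smul, smul_eq_mul]
    ring
  simp only [h2] at h1
  rw [average, average, ← integral_const_mul]
  simp only [mul_assoc] at h1
  rw [← h1]
  exact integral_congr_ae (Filter.Eventually.of_forall fun y => mul_comm _ _)

variable (n) in
/-- A standard mollifier on `ℝⁿ`. -/
def mollifier : EuclideanSpace ℝ (Fin n) → ℝ :=
  (⟨1 / 4, 1 / 2, by norm_num, by norm_num⟩ :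
    ContDiffBump (0 : EuclideanSpace ℝ (Fin n))).normed volume

lemma isKernel_mollifier : IsKernel (mollifier n) := by
  refine ⟨ContDiffBump.contDiff_normed _, ?_⟩
  rw [mollifier, ContDiffBump.tsupport_normed_eq]
  exact Metric.closedBall_subset_ball (by norm_num)

lemma mollifier_nonneg (z : EuclideanSpace ℝ (Fin n)) : 0 ≤ mollifier n z :=
  ContDiffBump.nonneg_normed _ _

lemma integral_mollifier : ∫ z, mollifier n z = 1 := ContDiffBump.integral_normed _

/-- The regularization of `φ` at scale `t` at the point `x`, as a function of `(x, t)`. -/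
def smoothing (φ : EuclideanSpace ℝ (Fin n) → ℝ) (X : Space n) : ℝ :=
  ∫ z, mollifier n z * φ (horiz X - height X • z)

/-- The form of `smoothing` makes sense and is Lipschitz for all real t, including t ≤ 0, so the
graph needs no separate treatment; the form as an average is available for t > 0 and is the one that
can be differentiated. -/
lemma smoothing_eq_average (hX : 0 < height X) : smoothing φ X = average (mollifier n) φ X := by
  have h1 := Measure.integral_comp_inv_smul volume
    (fun z => mollifier n z * φ (horiz X - height X • z)) (height X)
  have h2 := integral_sub_left_eq_self
    (fun z => dilate (mollifier n) (height X) z * φ (horiz X - z)) volume (horiz X)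
  simp only [sub_sub_cancel] at h2
  rw [average, h2]
  simp only [dilate, mul_assoc]
  rw [integral_const_mul, smoothing]
  simp only [smul_smul, mul_inv_cancel₀ hX.ne', one_smul, finrank_euclideanSpace_fin,
    abs_of_pos (pow_pos hX n), smul_eq_mul] at h1
  rw [h1, ← mul_assoc, inv_mul_cancel₀ (pow_pos hX n).ne', one_mul]

lemma smoothing_pt_zero (x : EuclideanSpace ℝ (Fin n)) : smoothing φ (pt x 0) = φ x := by
  simp only [smoothing, horiz_pt, height_pt, zero_smul, sub_zero]
  rw [integral_mul_const, integral_mollifier, one_mul]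

/-- The mollifier is a probability density supported in |z| < 1, so the points where φ is evaluated
move by at most |Δx| + |Δt|. In particular the t-slope is at most L. -/
lemma abs_smoothing_sub_le (hφ : LipschitzWith L φ) (X X' : Space n) :
    |smoothing φ X - smoothing φ X'| ≤ L * (‖horiz (X - X')‖ + |height (X - X')|) := by
  have hint : ∀ X : Space n, Integrable fun z => mollifier n z * φ (horiz X - height X • z) :=
    fun X => (isKernel_mollifier.continuous.mul
      (hφ.continuous.comp (by fun_prop))).integrable_of_hasCompactSupport
      isKernel_mollifier.hasCompactSupport.mul_right
  have hm : Integrable (mollifier n) :=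
    isKernel_mollifier.continuous.integrable_of_hasCompactSupport
      isKernel_mollifier.hasCompactSupport
  rw [smoothing, smoothing, ← integral_sub (hint X) (hint X'), ← Real.norm_eq_abs]
  refine (norm_integral_le_of_norm_le (hm.mul_const
    (L * (‖horiz (X - X')‖ + |height (X - X')|))) (Filter.Eventually.of_forall fun z => ?_)).trans
    (le_of_eq ?_)
  · rw [← mul_sub, norm_mul, Real.norm_of_nonneg (mollifier_nonneg z)]
    rcases le_or_gt 1 ‖z‖ with hz | hz
    · rw [isKernel_mollifier.eq_zero z hz]; simp
    refine mul_le_mul_of_nonneg_left ?_ (mollifier_nonneg z)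
    have h1 := hφ.dist_le_mul (horiz X - height X • z) (horiz X' - height X' • z)
    rw [dist_eq_norm, dist_eq_norm] at h1
    refine h1.trans (mul_le_mul_of_nonneg_left ?_ L.2)
    have h2 : horiz X - height X • z - (horiz X' - height X' • z) =
        horiz (X - X') - height (X - X') • z := by
      rw [horiz_sub, height_sub, sub_smul]; abel
    rw [h2]
    refine (norm_sub_le _ _).trans ?_
    rw [norm_smul, Real.norm_eq_abs]
    have := mul_le_mul_of_nonneg_left hz.le (abs_nonneg (height (X - X')))
    linarith
  · rw [integral_mul_const, integral_mollifier, one_mul]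

lemma contDiffOn_smoothing (hφ : LipschitzWith L φ) :
    ContDiffOn ℝ ∞ (smoothing φ) {X | 0 < height X} := fun X hX => by
  refine ((contDiffAt_average isKernel_mollifier hφ.continuous.locallyIntegrable
    hX).congr_of_eventuallyEq ?_).contDiffWithinAt
  filter_upwards [isOpen_height_pos.mem_nhds hX] with Y hY using smoothing_eq_average hY

/-- The kernels expressing the gradient of `smoothing φ` through the gradient of `φ`. -/
def gradKernel (ξ : Space n) (j : Fin n) (z : EuclideanSpace ℝ (Fin n)) : ℝ :=
  mollifier n z * (horiz ξ j - height ξ * z j)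

lemma isKernel_gradKernel (ξ : Space n) (j : Fin n) : IsKernel (gradKernel ξ j) :=
  isKernel_mollifier.mul (by fun_prop)

/-- For ξ = (v, τ) and mollifier η, ∇η · (v - τz) - nτη is the divergence of η (v - τz). Being a
divergence, it allows the derivative to be moved onto φ, without the loss of t⁻¹. -/
lemma kernelDeriv_mollifier (ξ : Space n) (z : EuclideanSpace ℝ (Fin n)) :
    kernelDeriv ξ (mollifier n) z =
      ∑ j, fderiv ℝ (gradKernel ξ j) z (EuclideanSpace.single j 1) := by
  have h1 : ∀ j, fderiv ℝ (gradKernel ξ j) z (EuclideanSpace.single j 1) =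
      (horiz ξ j - height ξ * z j) * fderiv ℝ (mollifier n) z (EuclideanSpace.single j 1) -
        mollifier n z * height ξ := fun j => by
    have h2 : HasFDerivAt (fun z : EuclideanSpace ℝ (Fin n) => horiz ξ j - height ξ * z j)
        (-(height ξ • (EuclideanSpace.proj j : EuclideanSpace ℝ (Fin n) →L[ℝ] ℝ))) z :=
      (((EuclideanSpace.proj j : EuclideanSpace ℝ (Fin n) →L[ℝ] ℝ).hasFDerivAt).const_mul
        _).const_sub _
    have h3 := (isKernel_mollifier.differentiable z).hasFDerivAt.mul h2
    rw [show fderiv ℝ (gradKernel ξ j) z = _ from h3.fderiv]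
    have h4 : (EuclideanSpace.proj j : EuclideanSpace ℝ (Fin n) →L[ℝ] ℝ)
        (EuclideanSpace.single j 1) = 1 := by simp
    simp only [add_apply, smul_apply, neg_apply, smul_eq_mul, h4]
    ring
  simp only [h1, Finset.sum_sub_distrib, Finset.sum_const, Finset.card_univ, Fintype.card_fin,
    nsmul_eq_mul]
  rw [kernelDeriv]
  congr 1
  · have h4 : horiz ξ - height ξ • z =
        ∑ j, (horiz ξ j - height ξ * z j) • EuclideanSpace.single j (1 : ℝ) := by
      ext i
      simp [Finset.sum_apply, Pi.single_apply]
    rw [h4, map_sum]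
    simp only [map_smul, smul_eq_mul]
  · ring

lemma fderiv_smoothing (hφ : LipschitzWith L φ) (hX : 0 < height X) (ξ : Space n) :
    fderiv ℝ (smoothing φ) X ξ = ∑ j, average (gradKernel ξ j)
      (fun y => lineDeriv ℝ φ y (EuclideanSpace.single j 1)) X := by
  have h1 : smoothing φ =ᶠ[nhds X] average (mollifier n) φ := by
    filter_upwards [isOpen_height_pos.mem_nhds hX] with Y hY using smoothing_eq_average hY
  rw [h1.fderiv_eq, fderiv_average isKernel_mollifier hφ.continuous.locallyIntegrable hX]
  simp only [← average_fderiv (isKernel_gradKernel ξ _) hφ hX, ← Finset.mul_sum]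
  congr 1
  rw [← average_sum _ _ hφ.continuous.locallyIntegrable hX]
  · congr 1
    funext z
    exact kernelDeriv_mollifier ξ z
  · exact fun j _ => (isKernel_gradKernel ξ j).fderiv_apply contDiff_const

/-- The first derivative has been moved onto φ; the second stays on the kernel. This costs t⁻¹ but
produces kernels of mean zero acting on the bounded function ∇φ, as the square function estimate
demands. -/
lemma pd_pd_smoothing (hφ : LipschitzWith L φ) (hX : 0 < height X) (i k : Fin (n + 1)) :
    pd k (pd i (smoothing φ)) X = ∑ j, (height X)⁻¹ *
      average (kernelDeriv (dir k) (gradKernel (dir i) j))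
        (fun y => lineDeriv ℝ φ y (EuclideanSpace.single j 1)) X := by
  have h1 : pd i (smoothing φ) =ᶠ[nhds X] fun Y => ∑ j, average (gradKernel (dir i) j)
      (fun y => lineDeriv ℝ φ y (EuclideanSpace.single j 1)) Y := by
    filter_upwards [isOpen_height_pos.mem_nhds hX] with Y hY using fderiv_smoothing hφ hY (dir i)
  have h2 : ∀ j : Fin n, LocallyIntegrable
      (fun y => lineDeriv ℝ φ y (EuclideanSpace.single j 1)) := fun j =>
    hφ.locallyIntegrable_lineDeriv _
  rw [pd, h1.fderiv_eq, fderiv_fun_sum fun j _ =>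
    (contDiffAt_average (isKernel_gradKernel (dir i) j) (h2 j) hX).differentiableAt (by simp)]
  rw [sum_apply]
  exact Finset.sum_congr rfl fun j _ => fderiv_average (isKernel_gradKernel (dir i) j) (h2 j) hX _

end Smoothing

end AdaptedDistance

end

/-! ### The Carleson estimate for the Hessian of the regularization. -/

noncomputable section

open MeasureTheory Set
open scoped NNReal ENNReal ContDiff

namespace AdaptedDistance

section SmoothingHessian

variable {n : ℕ} {φ : EuclideanSpace ℝ (Fin n) → ℝ} {L : ℝ≥0} {X : Space n}

lemma abs_coord_le (Y : Space n) (i : Fin (n + 1)) : |Y i| ≤ ‖Y‖ := by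
  rw [← Real.norm_eq_abs]; exact PiLp.norm_apply_le Y i

lemma sum_smul_dir (Y : Space n) : Y = ∑ i, Y i • dir i := by
  ext i
  simp [dir, Finset.sum_apply, Pi.single_apply]

lemma norm_iteratedFDeriv_two_le {f : Space n → ℝ} (hf : ContDiffAt ℝ 2 f X) :
    ‖iteratedFDeriv ℝ 2 f X‖ ≤ ∑ i, ∑ k, |pd k (pd i f) X| := by
  refine ContinuousMultilinearMap.opNorm_le_bound
    (Finset.sum_nonneg fun i _ => Finset.sum_nonneg fun k _ => abs_nonneg _) fun m => ?_
  rw [Fin.prod_univ_two]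
  have h1 : iteratedFDeriv ℝ 2 f X m = ∑ i, ∑ k, m 0 k * m 1 i * pd k (pd i f) X := by
    simp only [pd_pd hf, iteratedFDeriv_two_apply, Matrix.cons_val_zero, Matrix.cons_val_one]
    conv_lhs => rw [sum_smul_dir (m 0), sum_smul_dir (m 1)]
    simp only [map_sum, map_smul, sum_apply, smul_apply, smul_eq_mul, Finset.mul_sum]
    refine Finset.sum_congr rfl fun i _ => Finset.sum_congr rfl fun k _ => by ring
  rw [h1, Finset.sum_mul]
  refine (norm_sum_le _ _).trans (Finset.sum_le_sum fun i _ => ?_)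
  rw [Finset.sum_mul]
  refine (norm_sum_le _ _).trans (Finset.sum_le_sum fun k _ => ?_)
  rw [norm_mul, norm_mul, Real.norm_eq_abs, Real.norm_eq_abs, Real.norm_eq_abs, mul_comm]
  gcongr
  · exact abs_coord_le _ _
  · exact abs_coord_le _ _

/-- The kernels expressing the Hessian of `smoothing φ` through the gradient of `φ`. -/
def hessKernel (a : Fin (n + 1) × Fin (n + 1) × Fin n) : EuclideanSpace ℝ (Fin n) → ℝ :=
  kernelDeriv (dir a.2.1) (gradKernel (dir a.1) a.2.2)

lemma isKernel_hessKernel (a : Fin (n + 1) × Fin (n + 1) × Fin n) : IsKernel (hessKernel a) :=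
  (isKernel_gradKernel _ _).kernelDeriv _

/-- The partial derivatives of a function. -/
def lineGrad (φ : EuclideanSpace ℝ (Fin n) → ℝ) (j : Fin n) (y : EuclideanSpace ℝ (Fin n)) : ℝ :=
  lineDeriv ℝ φ y (EuclideanSpace.single j 1)

lemma abs_lineGrad_le (hφ : LipschitzWith L φ) (j : Fin n) (y : EuclideanSpace ℝ (Fin n)) :
    |lineGrad φ j y| ≤ L := by
  have := norm_lineDeriv_le_of_lipschitz ℝ hφ (x₀ := y) (v := EuclideanSpace.single j (1 : ℝ))
  simpa [lineGrad] using this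

lemma measurable_lineGrad (hφ : LipschitzWith L φ) (j : Fin n) : Measurable (lineGrad φ j) :=
  measurable_lineDeriv hφ.continuous

lemma two_le_smooth : (2 : WithTop ℕ∞) ≤ ((⊤ : ℕ∞) : WithTop ℕ∞) :=
  WithTop.coe_le_coe.2 (le_top : (2 : ℕ∞) ≤ ⊤)

lemma contDiffAt_smoothing (hφ : LipschitzWith L φ) (hX : 0 < height X) :
    ContDiffAt ℝ 2 (smoothing φ) X :=
  ((contDiffOn_smoothing hφ).contDiffAt (isOpen_height_pos.mem_nhds hX)).of_le two_le_smooth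

/-- Two factors t⁻¹ from the square of the Hessian against the weight t leave t⁻¹, the density of
dt/t in the square function; Cauchy–Schwarz over the finitely many kernels separates them. -/
lemma height_mul_hessian_sq_le (hφ : LipschitzWith L φ) (hX : 0 < height X) :
    height X * ‖iteratedFDeriv ℝ 2 (smoothing φ) X‖ ^ 2 ≤
      ∑ a : Fin (n + 1) × Fin (n + 1) × Fin n,
        Fintype.card (Fin (n + 1) × Fin (n + 1) × Fin n) *
          ((height X)⁻¹ * average (hessKernel a) (lineGrad φ a.2.2) X ^ 2) := by
  set t := height X
  set A : Fin (n + 1) × Fin (n + 1) × Fin n → ℝ := fun a =>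
    average (hessKernel a) (lineGrad φ a.2.2) X with hA
  have h1 : ‖iteratedFDeriv ℝ 2 (smoothing φ) X‖ ≤ t⁻¹ * ∑ a, |A a| := by
    refine (norm_iteratedFDeriv_two_le (contDiffAt_smoothing hφ hX)).trans ?_
    rw [Fintype.sum_prod_type, Finset.mul_sum]
    refine Finset.sum_le_sum fun i _ => ?_
    rw [Fintype.sum_prod_type, Finset.mul_sum]
    refine Finset.sum_le_sum fun k _ => ?_
    rw [pd_pd_smoothing hφ hX, ← Finset.mul_sum, abs_mul, abs_of_pos (inv_pos.2 hX)]
    exact mul_le_mul_of_nonneg_left (Finset.abs_sum_le_sum_abs _ _) (inv_pos.2 hX).le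
  have h2 : (∑ a, |A a|) ^ 2 ≤ Fintype.card (Fin (n + 1) × Fin (n + 1) × Fin n) *
      ∑ a, A a ^ 2 := by
    have := sq_sum_le_card_mul_sum_sq (s := Finset.univ) (f := fun a => |A a|)
    simpa only [sq_abs, Finset.card_univ] using this
  calc t * ‖iteratedFDeriv ℝ 2 (smoothing φ) X‖ ^ 2
      ≤ t * (t⁻¹ * ∑ a, |A a|) ^ 2 := by
        have : 0 < t := hX
        gcongr
    _ = t⁻¹ * (∑ a, |A a|) ^ 2 := by
        have : t ≠ 0 := hX.ne'
        field_simp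
    _ ≤ t⁻¹ * (Fintype.card (Fin (n + 1) × Fin (n + 1) × Fin n) * ∑ a, A a ^ 2) :=
        mul_le_mul_of_nonneg_left h2 (inv_pos.2 hX).le
    _ = _ := by
        rw [Finset.mul_sum, Finset.mul_sum]
        exact Finset.sum_congr rfl fun a _ => by ring

lemma measurable_average_pt {ψ f : EuclideanSpace ℝ (Fin n) → ℝ} (hψ : Continuous ψ)
    (hf : Measurable f) :
    Measurable fun p : EuclideanSpace ℝ (Fin n) × ℝ => average ψ f (pt p.1 p.2) := by
  simp only [average, horiz_pt, height_pt]
  have hψ' := hψ.measurable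
  have h1 : Measurable (Function.uncurry fun (p : EuclideanSpace ℝ (Fin n) × ℝ) y =>
      dilate ψ p.2 (p.1 - y) * f y) := by
    unfold dilate Function.uncurry
    fun_prop
  exact h1.stronglyMeasurable.integral_prod_right.measurable

/-- The Hessian of `smoothing φ` satisfies a Carleson measure estimate. -/
lemma exists_smoothing_carleson (n : ℕ) (L : ℝ≥0) : ∃ C : ℝ, 0 ≤ C ∧
    ∀ φ : EuclideanSpace ℝ (Fin n) → ℝ, LipschitzWith L φ →
    ∀ (x₀ : EuclideanSpace ℝ (Fin n)) (R₀ T : ℝ),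
      ∫⁻ p in Metric.closedBall x₀ R₀ ×ˢ Ioc 0 T, ENNReal.ofReal
        (p.2 * ‖iteratedFDeriv ℝ 2 (smoothing φ) (pt p.1 p.2)‖ ^ 2) ∂(volume.prod volume) ≤
      ENNReal.ofReal C * volume (Metric.closedBall x₀ (R₀ + T)) := by
  choose Λ hΛ using fun a : Fin (n + 1) × Fin (n + 1) × Fin n =>
    (isKernel_hessKernel a).exists_lipschitzWith
  set N : ℝ := ((Fintype.card (Fin (n + 1) × Fin (n + 1) × Fin n) : ℕ) : ℝ) with hN
  have hN0 : 0 ≤ N := Nat.cast_nonneg _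
  have hsq : ∀ a, 0 ≤ squareConst (hessKernel a) (Λ a) * (L : ℝ) ^ 2 := fun a =>
    mul_nonneg squareConst_pos.le (by positivity)
  refine ⟨∑ a, N * (squareConst (hessKernel a) (Λ a) * (L : ℝ) ^ 2),
    Finset.sum_nonneg fun a _ => mul_nonneg hN0 (hsq a), fun φ hφ x₀ R₀ T => ?_⟩
  have hS : MeasurableSet (Metric.closedBall x₀ R₀ ×ˢ Ioc (0 : ℝ) T) :=
    Metric.isClosed_closedBall.measurableSet.prod measurableSet_Ioc
  have hm : ∀ a : Fin (n + 1) × Fin (n + 1) × Fin n, Measurable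
      fun p : EuclideanSpace ℝ (Fin n) × ℝ =>
        average (hessKernel a) (lineGrad φ a.2.2) (pt p.1 p.2) := fun a =>
    measurable_average_pt (isKernel_hessKernel a).continuous (measurable_lineGrad hφ _)
  calc _ ≤ ∫⁻ p in Metric.closedBall x₀ R₀ ×ˢ Ioc 0 T, ∑ a : Fin (n + 1) × Fin (n + 1) × Fin n,
        ENNReal.ofReal N * (ENNReal.ofReal p.2⁻¹ * ENNReal.ofReal
          (average (hessKernel a) (lineGrad φ a.2.2) (pt p.1 p.2) ^ 2))
          ∂(volume.prod volume) := by
        refine setLIntegral_mono' hS fun p hp => ?_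
        have hp0 : 0 < p.2 := hp.2.1
        have h1 := height_mul_hessian_sq_le hφ (X := pt p.1 p.2) (by simpa using hp0)
        rw [height_pt] at h1
        refine (ENNReal.ofReal_le_ofReal h1).trans (le_of_eq ?_)
        rw [ENNReal.ofReal_sum_of_nonneg fun a _ => by positivity]
        refine Finset.sum_congr rfl fun a _ => ?_
        rw [ENNReal.ofReal_mul hN0, ENNReal.ofReal_mul (by positivity)]
    _ = ∑ a : Fin (n + 1) × Fin (n + 1) × Fin n, ENNReal.ofReal N *
          ∫⁻ p in Metric.closedBall x₀ R₀ ×ˢ Ioc 0 T, ENNReal.ofReal p.2⁻¹ * ENNReal.ofReal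
          (average (hessKernel a) (lineGrad φ a.2.2) (pt p.1 p.2) ^ 2)
          ∂(volume.prod volume) := by
        rw [lintegral_finsetSum]
        · refine Finset.sum_congr rfl fun a _ => ?_
          rw [lintegral_const_mul' _ _ (by finiteness)]
        · intro a _
          have := hm a
          fun_prop
    _ ≤ ∑ a : Fin (n + 1) × Fin (n + 1) × Fin n, ENNReal.ofReal N *
          (ENNReal.ofReal (squareConst (hessKernel a) (Λ a) * (L : ℝ) ^ 2) *
            volume (Metric.closedBall x₀ (R₀ + T))) := by
        refine Finset.sum_le_sum fun a _ => mul_le_mul_right ?_ _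
        have := lintegral_square_le (hΛ a) (isKernel_hessKernel a).eq_zero
          (integral_kernelDeriv (isKernel_gradKernel _ _) _) (measurable_lineGrad hφ a.2.2)
          (abs_lineGrad_le hφ a.2.2) x₀ R₀ T
        simpa only [average, horiz_pt, height_pt] using this
    _ = _ := by
        rw [ENNReal.ofReal_sum_of_nonneg fun a _ => mul_nonneg hN0 (hsq a), Finset.sum_mul]
        refine Finset.sum_congr rfl fun a _ => ?_
        rw [ENNReal.ofReal_mul hN0, mul_assoc]

end SmoothingHessian

end AdaptedDistance

end

/-! ### Construction and regularity of the regularized distance. -/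

noncomputable section

open MeasureTheory Set
open scoped NNReal ENNReal ContDiff

namespace AdaptedDistance

section RegularizedDistance

variable {n : ℕ} {φ : EuclideanSpace ℝ (Fin n) → ℝ} {L : ℝ≥0} {X : Space n}

/-- The function `(x, t) ↦ (L + 1) t + φ_t(x)`, where `φ_t` is the regularization of `φ` at
scale `t`. -/
def lift (φ : EuclideanSpace ℝ (Fin n) → ℝ) (L : ℝ≥0) (X : Space n) : ℝ :=
  (L + 1) * height X + smoothing φ X

/-- The coefficient L + 1 exceeds the maximal t-slope L of the regularization by 1. Hence the slope
lies in [1, 2L + 1], which gives both monotonicity and the bounds on the inverse. -/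
lemma lift_sub_mem (hφ : LipschitzWith L φ) (x : EuclideanSpace ℝ (Fin n)) {t t' : ℝ}
    (h : t ≤ t') : lift φ L (pt x t') - lift φ L (pt x t) ∈ Icc (t' - t) ((2 * L + 1) * (t' - t)) := by
  have h1 := abs_smoothing_sub_le hφ (pt x t') (pt x t)
  rw [← pt_sub, horiz_pt, height_pt, sub_self, norm_zero, zero_add,
    abs_of_nonneg (sub_nonneg.2 h), abs_le] at h1
  simp only [lift, height_pt]
  constructor <;> linarith [h1.1, h1.2]

lemma abs_sub_le_abs_lift_sub (hφ : LipschitzWith L φ) (x : EuclideanSpace ℝ (Fin n)) (t t' : ℝ) :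
    |t' - t| ≤ |lift φ L (pt x t') - lift φ L (pt x t)| := by
  wlog h : t ≤ t' generalizing t t'
  · rw [abs_sub_comm, abs_sub_comm (lift φ L _)]; exact this t' t (le_of_not_ge h)
  rw [abs_of_nonneg (sub_nonneg.2 h)]
  exact (lift_sub_mem hφ x h).1.trans (le_abs_self _)

lemma strictMono_lift (hφ : LipschitzWith L φ) (x : EuclideanSpace ℝ (Fin n)) :
    StrictMono fun t => lift φ L (pt x t) := fun t t' h => by
  have := (lift_sub_mem hφ x h.le).1
  simp only
  linarith

lemma abs_lift_sub_le (hφ : LipschitzWith L φ) (X X' : Space n) :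
    |lift φ L X - lift φ L X'| ≤ (3 * L + 1) * ‖X - X'‖ := by
  have h1 := abs_smoothing_sub_le hφ X X'
  have h2 := norm_horiz_le (X - X')
  have h3 := abs_height_le (X - X')
  have h4 : |lift φ L X - lift φ L X'| ≤
      (L + 1) * |height (X - X')| + |smoothing φ X - smoothing φ X'| := by
    rw [height_sub, ← abs_of_nonneg (show (0 : ℝ) ≤ L + 1 by positivity), ← abs_mul]
    refine le_trans (le_of_eq ?_) (abs_add_le _ _)
    simp only [lift]; congr 1; ring
  have hL : (0 : ℝ) ≤ L := L.2
  nlinarith [mul_le_mul_of_nonneg_left h2 hL, mul_le_mul_of_nonneg_left h3 hL]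

lemma continuous_lift (hφ : LipschitzWith L φ) : Continuous (lift φ L) :=
  (LipschitzWith.of_dist_le_mul (K := 3 * L + 1) fun X X' => by
    rw [Real.dist_eq, dist_eq_norm]
    exact_mod_cast abs_lift_sub_le hφ X X').continuous

lemma surjective_lift (hφ : LipschitzWith L φ) (x : EuclideanSpace ℝ (Fin n)) :
    Function.Surjective fun t => lift φ L (pt x t) := by
  refine Continuous.surjective ?_ ?_ ?_
  · exact (continuous_lift hφ).comp (continuous_pt.comp (f := fun t : ℝ => (x, t)) (by fun_prop))
  · refine Filter.tendsto_atTop_mono' _ ?_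
      (Filter.tendsto_atTop_add_const_right _ (lift φ L (pt x 0)) Filter.tendsto_id)
    filter_upwards [Filter.eventually_ge_atTop 0] with t ht
    have := (lift_sub_mem hφ x ht).1
    simp only [id_eq]; linarith
  · refine Filter.tendsto_atBot_mono' _ ?_
      (Filter.tendsto_atBot_add_const_right _ (lift φ L (pt x 0)) Filter.tendsto_id)
    filter_upwards [Filter.eventually_le_atBot 0] with t ht
    have := (lift_sub_mem hφ x ht).1
    simp only [id_eq]; linarith

/-- The regularized distance: the solution `t` of `(L + 1) t + φ_t(x) = y`, for `X = (x, y)`. -/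
def regDist (φ : EuclideanSpace ℝ (Fin n) → ℝ) (L : ℝ≥0) (X : Space n) : ℝ :=
  Function.invFun (fun t => lift φ L (pt (horiz X) t)) (height X)

lemma lift_regDist (hφ : LipschitzWith L φ) (X : Space n) :
    lift φ L (pt (horiz X) (regDist φ L X)) = height X :=
  Function.rightInverse_invFun (surjective_lift hφ (horiz X)) (height X)

lemma regDist_pt_lift (hφ : LipschitzWith L φ) (x : EuclideanSpace ℝ (Fin n)) (t : ℝ) :
    regDist φ L (pt x (lift φ L (pt x t))) = t := by
  refine (strictMono_lift hφ x).injective ?_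
  have := lift_regDist hφ (pt x (lift φ L (pt x t)))
  rwa [horiz_pt, height_pt] at this

lemma lift_pt_zero (x : EuclideanSpace ℝ (Fin n)) : lift φ L (pt x 0) = φ x := by
  rw [lift, height_pt, smoothing_pt_zero, mul_zero, zero_add]

lemma regDist_graph (hφ : LipschitzWith L φ) (x : EuclideanSpace ℝ (Fin n)) :
    regDist φ L (pt x (φ x)) = 0 := by
  conv_lhs => rw [← lift_pt_zero (φ := φ) (L := L) x]
  exact regDist_pt_lift hφ x 0

lemma regDist_pos (hφ : LipschitzWith L φ) (hX : X ∈ domain φ) : 0 < regDist φ L X := by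
  rw [← (strictMono_lift hφ (horiz X)).lt_iff_lt]
  simp only [lift_pt_zero, lift_regDist hφ]
  exact mem_domain.1 hX

/-- Slope at least 1 in t. Because of this, a Carleson box of height r above the graph lies in
{regDist ≤ r}, with no loss in the scale. -/
lemma regDist_le (hφ : LipschitzWith L φ) (hX : X ∈ domain φ) :
    regDist φ L X ≤ height X - φ (horiz X) := by
  have := (lift_sub_mem hφ (horiz X) (regDist_pos hφ hX).le).1
  rwa [lift_regDist hφ, lift_pt_zero, sub_zero] at this

/-- Over the same base point, the lift expands differences of t. The difference of its values at the
two heights is the change of y plus a horizontal increment of the regularization, of size at most L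
|Δx|. -/
lemma abs_regDist_sub_le (hφ : LipschitzWith L φ) (X X' : Space n) :
    |regDist φ L X - regDist φ L X'| ≤ (1 + L) * ‖X - X'‖ := by
  refine (abs_sub_le_abs_lift_sub hφ (horiz X) _ _).trans ?_
  have h1 := abs_smoothing_sub_le hφ (pt (horiz X') (regDist φ L X'))
    (pt (horiz X) (regDist φ L X'))
  rw [← pt_sub, horiz_pt, height_pt, sub_self, abs_zero, add_zero, ← horiz_sub, ← neg_sub X X',
    ← neg_one_smul ℝ (X - X'), horiz_smul, neg_one_smul, norm_neg] at h1
  have h2 : lift φ L (pt (horiz X) (regDist φ L X)) - lift φ L (pt (horiz X) (regDist φ L X')) =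
      height (X - X') + (smoothing φ (pt (horiz X') (regDist φ L X')) -
        smoothing φ (pt (horiz X) (regDist φ L X'))) := by
    have h3 := lift_regDist hφ X'
    rw [lift_regDist hφ, height_sub, ← h3]
    simp only [lift, height_pt]
    ring
  rw [h2]
  refine (abs_add_le _ _).trans ?_
  have := mul_le_mul_of_nonneg_left (norm_horiz_le (X - X')) L.coe_nonneg
  have := abs_height_le (X - X')
  linarith

lemma lipschitzWith_regDist (hφ : LipschitzWith L φ) : LipschitzWith (1 + L) (regDist φ L) :=
  LipschitzWith.of_dist_le_mul fun X X' => by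
    rw [Real.dist_eq, dist_eq_norm]; exact_mod_cast abs_regDist_sub_le hφ X X'

/-- The inverse of `(x, t) ↦ (x, lift φ L (x, t))`. -/
def unlift (φ : EuclideanSpace ℝ (Fin n) → ℝ) (L : ℝ≥0) (X : Space n) : Space n :=
  pt (horiz X) (regDist φ L X)

lemma height_unlift_pos (hφ : LipschitzWith L φ) (hX : X ∈ domain φ) :
    0 < height (unlift φ L X) := by
  rw [unlift, height_pt]; exact regDist_pos hφ hX

lemma contDiffAt_lift (hφ : LipschitzWith L φ) (hX : 0 < height X) :
    ContDiffAt ℝ 2 (lift φ L) X :=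
  (contDiffAt_const.mul (heightL n).contDiff.contDiffAt).add (contDiffAt_smoothing hφ hX)

lemma fderiv_lift (hφ : LipschitzWith L φ) (hX : 0 < height X) :
    fderiv ℝ (lift φ L) X = ((L : ℝ) + 1) • heightL n + fderiv ℝ (smoothing φ) X :=
  (((heightL n).hasFDerivAt.const_mul _).add
    ((contDiffAt_smoothing hφ hX).differentiableAt (by simp)).hasFDerivAt).fderiv

lemma fderiv_lift_vert_mem (hφ : LipschitzWith L φ) (hX : 0 < height X) :
    fderiv ℝ (lift φ L) X (vert n) ∈ Icc 1 (2 * (L : ℝ) + 1) := by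
  have hd := ((contDiffAt_smoothing hφ hX).differentiableAt (by simp)).hasFDerivAt
  have h1 : HasDerivAt (fun s : ℝ => X + s • vert n) (vert n) 0 := by
    simpa using ((hasDerivAt_id (0 : ℝ)).smul_const (vert n)).const_add X
  have h2 := hd.comp_hasDerivAt_of_eq (0 : ℝ) h1 (by simp)
  have h3 : LipschitzWith L (smoothing φ ∘ fun s : ℝ => X + s • vert n) :=
    LipschitzWith.of_dist_le_mul fun s s' => by
      rw [Real.dist_eq, Real.dist_eq]
      refine (abs_smoothing_sub_le hφ _ _).trans (le_of_eq ?_)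
      rw [add_sub_add_left_eq_sub, ← sub_smul, horiz_smul, height_smul, horiz_vert, height_vert,
        smul_zero, norm_zero, zero_add, mul_one]
  have h4 := norm_deriv_le_of_lipschitz h3 (x₀ := 0)
  rw [h2.deriv, Real.norm_eq_abs, abs_le] at h4
  rw [fderiv_lift hφ hX, add_apply, smul_apply, heightL_apply, height_vert, smul_eq_mul, mul_one]
  constructor <;> linarith [h4.1, h4.2]

/-- The derivative of `(x, t) ↦ (x, f (x, t))`, if `D` is the derivative of `f`. -/
def graphEquiv (D : Space n →L[ℝ] ℝ) (hD : D (vert n) ≠ 0) : Space n ≃L[ℝ] Space n :=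
  ContinuousLinearEquiv.equivOfInverse
    ((ptL n).toContinuousLinearMap.comp ((horizL n).prod D))
    ((ptL n).toContinuousLinearMap.comp ((horizL n).prod
      ((D (vert n))⁻¹ • (heightL n - D.comp ((ptL n).toContinuousLinearMap.comp
        ((horizL n).prod 0))))))
    (fun w => by
      have h1 := pt_eq_add_smul_vert (horiz w) 0 (height w)
      have h2 : D w = D (pt (horiz w) 0) + height w * D (vert n) := by
        conv_lhs => rw [← pt_horiz_height w, h1]
        rw [map_add, map_smul, sub_zero, smul_eq_mul]
      refine ext_horiz_height (by simp) ?_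
      simp [h2]
      field_simp)
    (fun w => by
      refine ext_horiz_height (by simp) ?_
      set s := (D (vert n))⁻¹ * (height w - D (pt (horiz w) 0)) with hs
      have h1 := pt_eq_add_smul_vert (horiz w) 0 s
      have h2 : D (pt (horiz w) s) = D (pt (horiz w) 0) + s * D (vert n) := by
        rw [h1, map_add, map_smul, sub_zero, smul_eq_mul]
      simp [← hs, h2]
      rw [hs]
      field_simp
      ring)

lemma coe_graphEquiv (D : Space n →L[ℝ] ℝ) (hD : D (vert n) ≠ 0) :
    (graphEquiv D hD : Space n →L[ℝ] Space n) =
      (ptL n).toContinuousLinearMap.comp ((horizL n).prod D) := rfl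

/-- The inverse function theorem for (x, t) ↦ (x, lift(x, t)), whose derivative is triangular with
∂_t ≥ 1. The local inverse agrees with the globally defined one because the map is injective. -/
lemma contDiffAt_unlift (hφ : LipschitzWith L φ) (hX : X ∈ domain φ) :
    ContDiffAt ℝ 2 (unlift φ L) X := by
  set a := unlift φ L X with ha
  have ha0 : 0 < height a := height_unlift_pos hφ hX
  set G : Space n → Space n := fun Y => pt (horiz Y) (lift φ L Y) with hG
  have hGinj : Function.Injective G := fun Y Y' h => by
    have h1 : horiz Y = horiz Y' := by simpa [hG] using congrArg horiz h
    have h2 : lift φ L Y = lift φ L Y' := by simpa [hG] using congrArg height h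
    refine ext_horiz_height h1 ((strictMono_lift hφ (horiz Y)).injective ?_)
    rw [pt_horiz_height, h1, pt_horiz_height, h2]
  have hGu : ∀ Y, G (unlift φ L Y) = Y := fun Y =>
    ext_horiz_height (by simp [hG, unlift]) (by simp [hG, unlift, lift_regDist hφ])
  have hGc : ContDiffAt ℝ 2 G a := (ptL n).contDiff.contDiffAt.comp a
    ((horizL n).contDiff.contDiffAt.prodMk (contDiffAt_lift hφ ha0))
  have hD : fderiv ℝ (lift φ L) a (vert n) ≠ 0 :=
    (zero_lt_one.trans_le (fderiv_lift_vert_mem hφ ha0).1).ne'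
  have hGd : HasFDerivAt G (graphEquiv _ hD : Space n →L[ℝ] Space n) a := by
    rw [coe_graphEquiv]
    exact (ptL n).hasFDerivAt.comp a ((horizL n).hasFDerivAt.prodMk
      ((contDiffAt_lift hφ ha0).differentiableAt (by simp)).hasFDerivAt)
  have h1 := hGc.to_localInverse hGd (by simp)
  have hGa : G a = X := hGu X
  have h2 := (hGc.hasStrictFDerivAt' hGd (by simp)).eventually_right_inverse
  rw [hGa] at h1 h2
  refine h1.congr_of_eventuallyEq ?_
  filter_upwards [h2] with Y hY
  exact hGinj ((hGu Y).trans hY.symm)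

lemma contDiffAt_regDist (hφ : LipschitzWith L φ) (hX : X ∈ domain φ) :
    ContDiffAt ℝ 2 (regDist φ L) X := by
  have := (heightL n).contDiff.contDiffAt.comp X (contDiffAt_unlift hφ hX)
  refine this.congr_of_eventuallyEq (Filter.Eventually.of_forall fun Y => ?_)
  simp [unlift]

lemma hasFDerivAt_unlift (hφ : LipschitzWith L φ) (hX : X ∈ domain φ) :
    HasFDerivAt (unlift φ L)
      ((ptL n).toContinuousLinearMap.comp ((horizL n).prod (fderiv ℝ (regDist φ L) X))) X :=
  (ptL n).hasFDerivAt.comp X ((horizL n).hasFDerivAt.prodMk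
    ((contDiffAt_regDist hφ hX).differentiableAt (by simp)).hasFDerivAt)

/-- The chain rule applied to lift(x, ρ(x, y)) = y. It is kept for all w, since differentiating it
once more yields the Hessian of ρ. -/
lemma fderiv_lift_fderiv_unlift (hφ : LipschitzWith L φ) (hX : X ∈ domain φ) (w : Space n) :
    fderiv ℝ (lift φ L) (unlift φ L X) (pt (horiz w) (fderiv ℝ (regDist φ L) X w)) = height w := by
  have h1 := ((contDiffAt_lift hφ (height_unlift_pos hφ hX)).differentiableAt
    (by simp)).hasFDerivAt.comp X (hasFDerivAt_unlift hφ hX)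
  have h2 : HasFDerivAt (lift φ L ∘ unlift φ L) (heightL n) X :=
    (heightL n).hasFDerivAt.congr_of_eventuallyEq
      (Filter.Eventually.of_forall fun Y => lift_regDist hφ Y)
  have := congrArg (fun D : Space n →L[ℝ] ℝ => D w) (h1.unique h2)
  simpa using this

lemma fderiv_regDist_vert (hφ : LipschitzWith L φ) (hX : X ∈ domain φ) :
    fderiv ℝ (regDist φ L) X (vert n) =
      (fderiv ℝ (lift φ L) (unlift φ L X) (vert n))⁻¹ := by
  have h1 := fderiv_lift_fderiv_unlift hφ hX (vert n)
  have h2 : pt (horiz (vert n)) (fderiv ℝ (regDist φ L) X (vert n)) =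
      fderiv ℝ (regDist φ L) X (vert n) • vert n :=
    ext_horiz_height (by simp [horiz_smul]) (by simp [height_smul])
  rw [h2, map_smul, height_vert, smul_eq_mul] at h1
  exact eq_inv_of_mul_eq_one_left h1

end RegularizedDistance

end AdaptedDistance

end

/-! ### The Carleson estimate for the regularized distance. -/

noncomputable section

open MeasureTheory Set
open scoped NNReal ENNReal

namespace AdaptedDistance

section RegularizedDistance

variable {n : ℕ} {φ : EuclideanSpace ℝ (Fin n) → ℝ} {L : ℝ≥0} {X : Space n}

lemma norm_iteratedFDeriv_two_eq (f : Space n → ℝ) (X : Space n) :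
    ‖iteratedFDeriv ℝ 2 f X‖ = ‖fderiv ℝ (fderiv ℝ f) X‖ := by
  rw [← norm_iteratedFDeriv_fderiv (n := 1), norm_iteratedFDeriv_one]

lemma fderiv_fderiv_lift (hφ : LipschitzWith L φ) (hX : 0 < height X) :
    fderiv ℝ (fderiv ℝ (lift φ L)) X = fderiv ℝ (fderiv ℝ (smoothing φ)) X := by
  have h1 : fderiv ℝ (lift φ L) =ᶠ[nhds X] fun Y =>
      ((L : ℝ) + 1) • heightL n + fderiv ℝ (smoothing φ) Y := by
    filter_upwards [isOpen_height_pos.mem_nhds hX] with Y hY using fderiv_lift hφ hY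
  rw [h1.fderiv_eq, fderiv_const_add]

lemma norm_fderiv_regDist_le (hφ : LipschitzWith L φ) (X : Space n) :
    ‖fderiv ℝ (regDist φ L) X‖ ≤ 1 + L := by
  exact_mod_cast norm_fderiv_le_of_lipschitz ℝ (lipschitzWith_regDist hφ)

/-- Differentiating lift(x, ρ) = y twice gives D²φ_t(Dv, Dw) + D²ρ(v, w) ∂_t lift = 0, where D is
the derivative of the inverse map; the linear part of the lift has no Hessian. Now ∂_t lift ≥ 1 and
|Dw| ≤ (2 + L) |w|. -/
lemma norm_hessian_regDist_le (hφ : LipschitzWith L φ) (hX : X ∈ domain φ) :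
    ‖iteratedFDeriv ℝ 2 (regDist φ L) X‖ ≤
      (2 + L) ^ 2 * ‖fderiv ℝ (fderiv ℝ (smoothing φ)) (unlift φ L X)‖ := by
  have hL := L.coe_nonneg
  rw [norm_iteratedFDeriv_two_eq]
  have hpos := height_unlift_pos hφ hX
  set D : Space n → Space n →L[ℝ] Space n := fun Y =>
    (ptL n).toContinuousLinearMap.comp ((horizL n).prod (fderiv ℝ (regDist φ L) Y)) with hD
  have hDle : ∀ w, ‖D X w‖ ≤ (2 + L) * ‖w‖ := fun w => by
    refine (norm_le_add _).trans ?_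
    have h1 : horiz (D X w) = horiz w := by simp [hD]
    have h2 : height (D X w) = fderiv ℝ (regDist φ L) X w := by simp [hD]
    rw [h1, h2]
    have h3 := (fderiv ℝ (regDist φ L) X).le_of_opNorm_le (norm_fderiv_regDist_le hφ X) w
    rw [Real.norm_eq_abs] at h3
    linarith [norm_horiz_le w]
  have hρ2 : HasFDerivAt (fderiv ℝ (regDist φ L)) (fderiv ℝ (fderiv ℝ (regDist φ L)) X) X :=
    (((contDiffAt_regDist hφ hX).fderiv_right (m := 1) (by norm_num)).differentiableAt
      one_ne_zero).hasFDerivAt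
  have hΨ2 : HasFDerivAt (fderiv ℝ (lift φ L)) (fderiv ℝ (fderiv ℝ (lift φ L)) (unlift φ L X))
      (unlift φ L X) :=
    (((contDiffAt_lift hφ hpos).fderiv_right (m := 1) (by norm_num)).differentiableAt
      one_ne_zero).hasFDerivAt
  have hopen := isOpen_domain hφ.continuous
  -- differentiate the identity for the gradient
  have key : ∀ v w, fderiv ℝ (fderiv ℝ (smoothing φ)) (unlift φ L X) (D X v) (D X w) +
      fderiv ℝ (fderiv ℝ (regDist φ L)) X v w *
        fderiv ℝ (lift φ L) (unlift φ L X) (vert n) = 0 := fun v w => by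
    have h1 : HasFDerivAt (fun Y => pt (horiz w) (fderiv ℝ (regDist φ L) Y w)) _ X :=
      (ptL n).hasFDerivAt.comp X ((hasFDerivAt_const (horiz w) X).prodMk
        (hρ2.clm_apply (hasFDerivAt_const w X)))
    have h2 := (hΨ2.comp X (hasFDerivAt_unlift hφ hX)).clm_apply h1
    have h3 : HasFDerivAt (fun Y => fderiv ℝ (lift φ L) (unlift φ L Y)
        (pt (horiz w) (fderiv ℝ (regDist φ L) Y w))) (0 : Space n →L[ℝ] ℝ) X := by
      refine hasFDerivAt_zero_of_eventually_const (height w) ?_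
      filter_upwards [hopen.mem_nhds hX] with Y hY using fderiv_lift_fderiv_unlift hφ hY w
    have h4 := congrArg (fun D : Space n →L[ℝ] ℝ => D v) (h2.unique h3)
    have h5 : ∀ s : ℝ, pt (0 : EuclideanSpace ℝ (Fin n)) s = s • vert n := fun s =>
      ext_horiz_height (by simp [horiz_smul]) (by simp [height_smul])
    simp [h5, fderiv_fderiv_lift hφ hpos] at h4
    simp only [hD]
    simp
    linarith
  refine ContinuousLinearMap.opNorm_le_bound _ (by positivity) fun v =>
    ContinuousLinearMap.opNorm_le_bound _ (by positivity) fun w => ?_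
  set H := fderiv ℝ (fderiv ℝ (smoothing φ)) (unlift φ L X)
  have h1 := (fderiv_lift_vert_mem hφ hpos).1
  set A := fderiv ℝ (lift φ L) (unlift φ L X) (vert n)
  have h2 : ‖H (D X v) (D X w)‖ ≤ ‖H‖ * ((2 + L) * ‖v‖) * ((2 + L) * ‖w‖) :=
    (H.le_opNorm₂ _ _).trans (by gcongr <;> exact hDle _)
  have h3 := key v w
  have h4 : ‖H (D X v) (D X w)‖ = ‖fderiv ℝ (fderiv ℝ (regDist φ L)) X v w‖ * A := by
    rw [eq_neg_of_add_eq_zero_left h3, norm_neg, norm_mul, Real.norm_of_nonneg (zero_le_one.trans h1)]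
  have h5 : ‖fderiv ℝ (fderiv ℝ (regDist φ L)) X v w‖ ≤
      ‖fderiv ℝ (fderiv ℝ (regDist φ L)) X v w‖ * A := le_mul_of_one_le_right (norm_nonneg _) h1
  calc _ ≤ ‖H‖ * ((2 + L) * ‖v‖) * ((2 + L) * ‖w‖) := by linarith
    _ = _ := by ring

lemma cube_subset_closedBall (a : EuclideanSpace ℝ (Fin n)) {r : ℝ} (hr : 0 ≤ r) :
    cube a r ⊆ Metric.closedBall a (n * r) := fun x hx => by
  rw [Metric.mem_closedBall, dist_eq_norm]
  refine le_of_sq_le_sq ?_ (by positivity)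
  rw [EuclideanSpace.norm_sq_eq]
  calc _ ≤ ∑ _i : Fin n, r ^ 2 := Finset.sum_le_sum fun i _ => by
        have h1 := (hx i).1
        have h2 := (hx i).2
        rw [Real.norm_eq_abs, sq_abs, PiLp.sub_apply]
        nlinarith
    _ = n * r ^ 2 := by simp
    _ ≤ (n * r) ^ 2 := by
        rw [mul_pow]
        refine mul_le_mul_of_nonneg_right ?_ (sq_nonneg r)
        exact_mod_cast Nat.le_self_pow two_ne_zero n

/-- Change of variables `(x, y) = (x, lift φ L (x, t))`. -/
lemma lintegral_unlift_le (hφ : LipschitzWith L φ) {h : Space n → ℝ≥0∞} (hh : Measurable h)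
    {Q : Set (EuclideanSpace ℝ (Fin n))} (hQ : MeasurableSet Q) (r : ℝ) :
    ∫⁻ X in {X | horiz X ∈ Q ∧ regDist φ L X ∈ Ioc 0 r}, h (unlift φ L X) ≤
      ENNReal.ofReal (2 * L + 1) *
        ∫⁻ x in Q, ∫⁻ t in Ioc 0 r, h (pt x t) := by
  have hρc : Continuous (regDist φ L) := (lipschitzWith_regDist hφ).continuous
  have hS : MeasurableSet {X : Space n | horiz X ∈ Q ∧ regDist φ L X ∈ Ioc 0 r} :=
    (continuous_horiz.measurable hQ).inter (hρc.measurable measurableSet_Ioc)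
  have huc : Continuous (unlift φ L) :=
    continuous_pt.comp (f := fun X => (horiz X, regDist φ L X)) (continuous_horiz.prodMk hρc)
  have hm : Measurable fun X => h (unlift φ L X) := hh.comp huc.measurable
  rw [← lintegral_indicator hS, lintegral_space (hm.indicator hS),
    ← lintegral_const_mul' _ _ (by finiteness), ← lintegral_indicator hQ]
  refine lintegral_mono fun x => ?_
  by_cases hx : x ∈ Q
  swap
  · rw [indicator_of_notMem hx, nonpos_iff_eq_zero, lintegral_eq_zero_iff']
    · refine Filter.Eventually.of_forall fun y => indicator_of_notMem ?_ _
      exact fun h => hx (by simpa using h.1)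
    · exact ((hm.indicator hS).comp
        (continuous_pt.comp (f := fun t : ℝ => (x, t)) (by fun_prop)).measurable).aemeasurable
  rw [indicator_of_mem hx]
  set g : ℝ → ℝ := fun t => lift φ L (pt x t) with hg
  -- The change of variables is made on each vertical line separately, so only the one-dimensional
  -- Jacobian ∂_t lift ≤ 2L + 1 enters.
  have himg : {y | regDist φ L (pt x y) ∈ Ioc 0 r} = g '' Ioc 0 r := by
    ext y
    constructor
    · intro hy
      exact ⟨_, hy, by simpa using lift_regDist hφ (pt x y)⟩
    · rintro ⟨t, ht, rfl⟩
      show regDist φ L (pt x (g t)) ∈ Ioc 0 r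
      rwa [hg, regDist_pt_lift hφ]
  have hder : ∀ t ∈ Ioc 0 r, HasDerivWithinAt g (fderiv ℝ (lift φ L) (pt x t) (vert n))
      (Ioc 0 r) t := fun t ht => by
    have h1 : HasDerivAt (fun t : ℝ => pt x t) (vert n) t := by
      have h2 : (fun t : ℝ => pt x t) = fun t => pt x 0 + t • vert n := by
        funext t; rw [pt_eq_add_smul_vert x 0 t, sub_zero]
      rw [h2]
      simpa using ((hasDerivAt_id t).smul_const (vert n)).const_add (pt x 0)
    exact ((((contDiffAt_lift hφ (X := pt x t) (by simpa using ht.1)).differentiableAt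
      (by simp)).hasFDerivAt).comp_hasDerivAt t h1).hasDerivWithinAt
  calc _ = ∫⁻ y in g '' Ioc 0 r, h (pt x (regDist φ L (pt x y))) := by
        rw [← himg, ← lintegral_indicator]
        · refine lintegral_congr fun y => ?_
          by_cases hy : regDist φ L (pt x y) ∈ Ioc 0 r
          · rw [indicator_of_mem, indicator_of_mem]
            · simp [unlift]
            · exact hy
            · exact ⟨by simpa using hx, hy⟩
          · rw [indicator_of_notMem, indicator_of_notMem]
            · exact hy
            · exact fun h => hy h.2
        · exact (hρc.comp (continuous_pt.comp (f := fun t : ℝ => (x, t))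
            (by fun_prop))).measurable measurableSet_Ioc
    _ = ∫⁻ t in Ioc 0 r, ENNReal.ofReal |fderiv ℝ (lift φ L) (pt x t) (vert n)| *
          h (pt x (regDist φ L (pt x (g t)))) :=
        lintegral_image_eq_lintegral_abs_deriv_mul measurableSet_Ioc hder
          (strictMono_lift hφ x).injective.injOn _
    _ ≤ ∫⁻ t in Ioc 0 r, ENNReal.ofReal (2 * L + 1) * h (pt x t) := by
        refine setLIntegral_mono' measurableSet_Ioc fun t ht => ?_
        rw [hg, regDist_pt_lift hφ]
        have := fderiv_lift_vert_mem hφ (X := pt x t) (by simpa using ht.1)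
        gcongr
        rw [abs_of_nonneg (zero_le_one.trans this.1)]
        exact this.2
    _ = _ := lintegral_const_mul' _ _ (by finiteness)

/-- The regularized distance satisfies a Carleson measure estimate. -/
lemma exists_regDist_carleson (n : ℕ) (L : ℝ≥0) : ∃ C : ℝ, 0 ≤ C ∧
    ∀ φ : EuclideanSpace ℝ (Fin n) → ℝ, LipschitzWith L φ →
      IsCarlesonWith φ C (hessianMeasure φ (regDist φ L)) := by
  obtain ⟨C, hC, hcar⟩ := exists_smoothing_carleson n L
  have hL := L.coe_nonneg
  set ω := volume.real (Metric.closedBall (0 : EuclideanSpace ℝ (Fin n)) (n + 1)) with hω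
  refine ⟨((2 + L) ^ 2) ^ 2 * ((2 * L + 1) * (C * ω)), by positivity, fun φ hφ a r hr => ?_⟩
  set F : Space n → ℝ := fun X => height X * ‖fderiv ℝ (fderiv ℝ (smoothing φ)) X‖ ^ 2 with hF
  have hFm : Measurable F :=
    continuous_height.measurable.mul ((measurable_fderiv ℝ _).norm.pow_const 2)
  set S := shift φ '' carlesonBox a r with hS
  have hSeq : S = {X | horiz X ∈ cube a r ∧ height X - φ (horiz X) ∈ Ioc 0 r} := by
    ext X; exact mem_shift_box
  have hSm : MeasurableSet S := by
    rw [hSeq]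
    exact (continuous_horiz.measurable (measurableSet_cube a r)).inter
      ((continuous_height.sub (hφ.continuous.comp continuous_horiz)).measurable measurableSet_Ioc)
  have hSd : S ⊆ domain φ := fun X hX => by
    rw [hSeq] at hX
    have := hX.2.1
    exact mem_domain.2 (by linarith)
  calc hessianMeasure φ (regDist φ L) S
      = ∫⁻ X in S, ENNReal.ofReal (regDist φ L X * ‖iteratedFDeriv ℝ 2 (regDist φ L) X‖ ^ 2) := by
        rw [hessianMeasure, withDensity_apply _ hSm, Measure.restrict_restrict hSm,
          inter_eq_left.2 hSd]
    _ ≤ ∫⁻ X in S, ENNReal.ofReal (((2 + L) ^ 2) ^ 2) * ENNReal.ofReal (F (unlift φ L X)) := by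
        refine setLIntegral_mono' hSm fun X hX => ?_
        have h1 := norm_hessian_regDist_le hφ (hSd hX)
        have h2 := (regDist_pos hφ (hSd hX)).le
        rw [← ENNReal.ofReal_mul (by positivity)]
        refine ENNReal.ofReal_le_ofReal ?_
        calc _ ≤ regDist φ L X * ((2 + L) ^ 2 *
              ‖fderiv ℝ (fderiv ℝ (smoothing φ)) (unlift φ L X)‖) ^ 2 := by gcongr
          _ = _ := by simp only [hF, unlift, height_pt]; ring
    _ = ENNReal.ofReal (((2 + L) ^ 2) ^ 2) * ∫⁻ X in S, ENNReal.ofReal (F (unlift φ L X)) :=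
        lintegral_const_mul' _ _ (by finiteness)
    _ ≤ ENNReal.ofReal (((2 + L) ^ 2) ^ 2) *
          ∫⁻ X in {X | horiz X ∈ cube a r ∧ regDist φ L X ∈ Ioc 0 r},
            ENNReal.ofReal (F (unlift φ L X)) := by
        refine mul_le_mul_right (lintegral_mono_set fun X hX => ?_) _
        have h1 := regDist_pos hφ (hSd hX)
        have h2 := regDist_le hφ (hSd hX)
        rw [hSeq] at hX
        exact ⟨hX.1, h1, h2.trans hX.2.2⟩
    _ ≤ ENNReal.ofReal (((2 + L) ^ 2) ^ 2) * (ENNReal.ofReal (2 * L + 1) *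
          ∫⁻ x in cube a r, ∫⁻ t in Ioc 0 r, ENNReal.ofReal (F (pt x t))) :=
        mul_le_mul_right
          (lintegral_unlift_le hφ hFm.ennreal_ofReal (measurableSet_cube a r) r) _
    _ ≤ ENNReal.ofReal (((2 + L) ^ 2) ^ 2) * (ENNReal.ofReal (2 * L + 1) *
          (ENNReal.ofReal C * volume (Metric.closedBall a (n * r + r)))) := by
        refine mul_le_mul_right (mul_le_mul_right ?_ _) _
        -- The cube is enclosed in the ball of radius n r about its corner; the square function
        -- estimate enlarges this by r.
        refine le_trans ?_ (hcar φ hφ a (n * r) r)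
        rw [← Measure.prod_restrict, lintegral_prod]
        · refine le_trans (lintegral_mono_set (cube_subset_closedBall a hr.le)) (le_of_eq ?_)
          simp only [hF, height_pt, norm_iteratedFDeriv_two_eq]
        · simp only [norm_iteratedFDeriv_two_eq]
          have := hFm.comp (continuous_pt (n := n)).measurable
          simp only [hF, Function.comp_def, height_pt] at this
          exact this.ennreal_ofReal.aemeasurable
    _ = _ := by
        rw [show (n : ℝ) * r + r = r * (n + 1) by ring, Measure.addHaar_closedBall_mul _ _ hr.le
          (by positivity), finrank_euclideanSpace_fin,
          ← ofReal_measureReal measure_closedBall_lt_top.ne, ← hω,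
          ← ENNReal.ofReal_mul (by positivity), ← ENNReal.ofReal_mul (by positivity),
          ← ENNReal.ofReal_mul (by positivity), ← ENNReal.ofReal_mul (by positivity)]
        congr 1; ring

/-- Adapted distance functions exist. -/
theorem exists_isAdaptedDistance (n : ℕ) (L : ℝ≥0) : ∃ M : ℝ,
    ∀ φ : EuclideanSpace ℝ (Fin n) → ℝ, LipschitzWith L φ →
      ∃ ρ : Space n → ℝ, IsAdaptedDistance φ M ρ := by
  obtain ⟨C, hC, hcar⟩ := exists_regDist_carleson n L
  have hL := L.coe_nonneg
  -- A single constant for all conditions: 2L + 1 covers the slope 1/(2L + 1) ≤ ∂_yρ ≤ 1 and the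
  -- gradient bound 1 + L, while C covers the Carleson norm.
  refine ⟨2 * L + 1 + C, fun φ hφ => ⟨regDist φ L, ?_⟩⟩
  have hvert : ∀ X ∈ domain φ, fderiv ℝ (regDist φ L) X (vert n) ∈ Icc (1 / (2 * L + 1 : ℝ)) 1 :=
    fun X hX => by
      have h1 := fderiv_lift_vert_mem hφ (height_unlift_pos hφ hX)
      have h2 := zero_lt_one.trans_le h1.1
      rw [fderiv_regDist_vert hφ hX, one_div]
      exact ⟨inv_anti₀ h2 h1.2, inv_le_one_of_one_le₀ h1.1⟩
  refine
    { pos := by positivity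
      lipschitz := ⟨1 + L, (lipschitzWith_regDist hφ).lipschitzOnWith⟩
      contDiffOn := fun X hX => (contDiffAt_regDist hφ hX).contDiffWithinAt
      eq_zero := regDist_graph hφ
      le_vert := fun X hX => (one_div_le_one_div_of_le (by positivity) (by linarith)).trans
        (hvert X hX).1
      vert_le := fun X hX => (hvert X hX).2.trans (by linarith)
      grad_le := fun X hX => (norm_fderiv_regDist_le hφ X).trans (by linarith)
      carleson := fun a r hr => (hcar φ hφ a r hr).trans
        (ENNReal.ofReal_le_ofReal (mul_le_mul_of_nonneg_right (by linarith) (by positivity))) }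

end RegularizedDistance

end AdaptedDistance

end

theorem lemma4p4 (n : ℕ) (hn : 1 ≤ n) (L : ℝ≥0) :
    (∃ M : ℝ, ∀ φ : EuclideanSpace ℝ (Fin n) → ℝ, LipschitzWith L φ →
      ∃ ρ : Space n → ℝ, IsAdaptedDistance φ M ρ) ∧
    ∀ M κ : ℝ, Real.sqrt (1 + (L : ℝ) ^ 2) < κ →
      ∃ C : ℝ≥0, ∀ φ : EuclideanSpace ℝ (Fin n) → ℝ, LipschitzWith L φ →
        ∀ ρ : Space n → ℝ, IsAdaptedDistance φ M ρ →
        ∀ u : Space n → ℝ,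
          InnerProductSpace.HarmonicOnNhd u (cylSection φ ρ 3) →
          HolderUpToBoundary (cylSection φ ρ 3) u →
          ∫⁻ Q in bottom φ 1, ‖u Q‖ₑ ^ 2 ∂(surfaceMeasure φ) ≤
            C * (areaIntegral (cylSection φ ρ 3) u +
              areaIntegral (cylSection φ ρ 3) u ^ (1 / 2 : ℝ) *
                (∫⁻ Q in bottom φ 2,
                  maximal (domain φ) κ
                    ((cylSection φ ρ 2).indicator u) Q ^ 2
                    ∂(surfaceMeasure φ)) ^ (1 / 2 : ℝ) +
              ∫⁻ X in slab φ ρ, ‖u X‖ₑ ^ 2) := by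
  exact ⟨exists_isAdaptedDistance n L, fun M κ hκ => exists_main_bound n L M κ hκ⟩
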